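/- Let $X$ be a relatively compact (i.e. totally bounded) metric space and $m$ a finite Radon measure on $X$ with full support. Let $\mathcal E$ be a Dirichlet form on the real space $L^2(X)=L^2(X,m)$ with domain $V_{1/2}$, that is, a densely defined, symmetric, non-negative, closed bilinear form such that for every $\epsilon>0$ there is $\phi_\epsilon\in C^\infty(\mathbb R)$ with $\phi_\epsilon(t)=t$ on $[0,1]$, $-\epsilon\le\phi_\epsilon\le 1+\epsilon$, $0\le\phi_\epsilon(t)-\phi_\epsilon(\tau)\le t-\tau$ for $\tau<t$, and, for all $u\in V_{1/2}$, $\phi_\epsilon(u)\in V_{1/2}$ and $\mathcal E(\phi_\epsilon(u),\phi_\epsilon(u))\le\mathcal E(u,u)$. Let $A\ge 0$ be the associated self-adjoint operator ($Au=w$ iff $u\in V_{1/2}$ and $\mathcal E(u,v)=(w,v)$ for all $v\in V_{1/2}$). Give $V_{1/2}$ the norm $(\mathcal E(u,u)+\|u\|^2_{L^2})^{1/2}$ and assume that $V_{1/2}\hookrightarrow L^2(X)$ is compact and that $V_{1/2}\hookrightarrow L^{2q_A}(X)$ is continuous for some $q_A\in(1,\infty]$. Put $\theta_A=\frac{q_A}{2(q_A-1)}$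 ($=\frac12$ if $q_A=\infty$) and $\alpha_0=1/\theta_A$. Then $L^2(X)$ has an orthonormal basis $(\varphi_n)$ of eigenfunctions of $A$, $A\varphi_n=\lambda_n\varphi_n$. Fix any such basis, and fix $\varepsilon\ge0$ such that the numbers $\lambda_n+\varepsilon$ have a positive lower bound ($\varepsilon=0$ is allowed if the lowest eigenvalue of $A$ is positive). For $s\ge0$ let $V_s=D((A+\varepsilon)^s)=\{h\in L^2(X):\|h\|_{V_s}^2:=\sum_n(\lambda_n+\varepsilon)^{2s}|(h,\varphi_n)|^2<\infty\}$, and let $V_{-s}$ be its dual, with $L^2(X)\subset V_{-s}$ via the $L^2$ inner product. Let $1<\alpha<2$, $\gamma=1/\alpha$, $u_0\in V_\gamma$, $u_1\in L^2(X)$, and consider $$\mathbb D_t^\alpha u+Au=f(u)\ \text{ in } X\times(0,T),\qquad u(\cdot,0)=u_0,\quad \partial_tu(\cdot,0)=u_1,$$ where $\mathbb D_t^\alpha u(t)=\frac1{\Gamma(2-\alpha)}\,\partial_t^2\int_0^t(t-s)^{1-\alpha}\big(u(s)-u(0)-s\,\partial_tu(0)\big)\,ds$, with $\partial_t^2$ taken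 in $V_{-\gamma}$ in the sense of $W^{2,1}((0,T);V_{-\gamma})$. *Weak solutions.* A function $u$ is a weak solution on $(0,T)$ of type (S) if * $u\in C([0,T];V_\gamma)\cap C^1([0,T];L^2(X))$ and $\mathbb D_t^\alpha u\in C([0,T];V_{-\gamma})$; * $u(0)=u_0$, $\partial_tu(0)=u_1$, and, as $t\to0^+$, $\|u(t)-u_0\|_{V_\sigma}\to0$ and $\|\partial_tu(t)-u_1\|_{V_{-\beta}}\to0$ for some $0\le\sigma<\frac1\alpha$ and some $0<\beta\le1-\frac1\alpha$; * $f(u(t))\in L^2(X)$ for a.e. $t\in(0,T)$, and for every $\varphi\in V_\gamma$ and a.e. $t\in(0,T)$, $\langle\mathbb D_t^\alpha u(t),\varphi\rangle_{V_{-\gamma},V_\gamma}+\mathcal E(u(t),\varphi)=(f(u(t)),\varphi)$ (with $u(t),\varphi\in V_{1/2}$). For $1\le p<\frac1{2-\alpha}$, $\frac1p+\frac1q=1$ and $r>1$, it is a weak solution of type (C) with exponents $(r,q)$ if the same holds with the condition on $\mathbb D^\alpha_tu$ replaced by $\mathbb D_t^\alpha u\in C([0,T];V_{-\gamma})+L^q((0,T);L^2(X))$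 and if moreover $u\in L^{rq}((0,T);L^{2r}(X))$. **Theorem.** (I) Let $q_A>2$ and $1<\alpha<\alpha_0$. Let $f\in C^1(\mathbb R)$ with $f(0)=0$, $|f'(s)|\le Q_1(|s|)$, $|f(s)|\le Q_2(|s|)$ for some monotone increasing $Q_1,Q_2\ge0$ (such $Q_i$ exist for every $f\in C^1(\mathbb R)$). Then there is $T^\star>0$ such that the problem has a unique weak solution $u$ of type (S) on $(0,T^\star)$. (II) Let either $q_A>2$ and $\alpha_0\le\alpha<2$, or $1<q_A\le2$. Let $f\in C^1(\mathbb R)$ with $f(0)=0$ and $|f'(s)|\le C|s|^{r-1}$ for some $C>0$, where $r\in(1,\infty)$ is arbitrary if $q_A>2$ and $\alpha=\alpha_0$, and $r=\frac{\theta_A\alpha}{\theta_A\alpha-1}$ otherwise. Then there are $T^\star>0$ and a function $u$ on $[0,T^\star]$ such that, for all $p,q$ as above, $u$ is a weak solution of type (C) with exponents $(r,q)$ on $(0,T^\star)$, and it is the only weak solution of type (C) on $(0,T^\star)$ with exponents $(r',q)$, whatever $r'>1$. (Here $T^\star$ may depend on the problem, i.e. on $\mathcal E,\alpha,f$ and the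 quantities fixed above, and on $(u_0,u_1)$; in (II) it does not depend on $p,q$.) In both cases, for all $t\in[0,T^\star]$, $f(u(t))\in L^2(X)$ and $$u(t)=\sum_n(u_0,\varphi_n)E_{\alpha,1}(-\lambda_nt^\alpha)\varphi_n+\sum_n(u_1,\varphi_n)\,tE_{\alpha,2}(-\lambda_nt^\alpha)\varphi_n+\sum_n\Big(\int_0^t(f(u(\tau)),\varphi_n)(t-\tau)^{\alpha-1}E_{\alpha,\alpha}(-\lambda_n(t-\tau)^\alpha)\,d\tau\Big)\varphi_n,$$ with each series convergent in $L^2(X)$, where $E_{a,b}(z)=\sum_{k\ge0}z^k/\Gamma(ak+b)$. -/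

import Mathlib

open MeasureTheory Set Filter Topology
open scoped ENNReal NNReal ContDiff

noncomputable section

namespace FracWave

/-- The real Hilbert space `L²(X, m)`. -/
abbrev L2 {X : Type*} [MeasurableSpace X] (m : Measure X) : Type _ := Lp ℝ 2 m

/-- A Dirichlet form on `L²(X, m)`: a densely defined, symmetric, non-negative, closed bilinear
form which is Markovian. The norm on `dom` in the field `closed` is the `L²` norm. -/
structure DirichletForm {X : Type*} [MeasurableSpace X] (m : Measure X) where
  /-- The domain `V_{1/2}` of the form. -/
  dom : Submodule ℝ (L2 m)
  /-- The form itself. -/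
  form : dom →ₗ[ℝ] dom →ₗ[ℝ] ℝ
  dense_dom : Dense (dom : Set (L2 m))
  symm : ∀ u v : dom, form u v = form v u
  nonneg : ∀ u : dom, 0 ≤ form u u
  closed : ∀ κ : ℝ, 0 < κ → ∀ u : ℕ → dom,
    Tendsto (fun p : ℕ × ℕ =>
      form (u p.1 - u p.2) (u p.1 - u p.2) + κ * ‖u p.1 - u p.2‖ ^ 2) atTop (𝓝 0) →
    ∃ v : dom, Tendsto (fun n : ℕ => form (u n - v) (u n - v) + κ * ‖u n - v‖ ^ 2) atTop (𝓝 0)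
  markov : ∀ ε : ℝ, 0 < ε → ∃ φ : ℝ → ℝ, ContDiff ℝ ∞ φ ∧
    (∀ t ∈ Icc (0 : ℝ) 1, φ t = t) ∧
    (∀ t : ℝ, -ε ≤ φ t ∧ φ t ≤ 1 + ε) ∧
    (∀ τ t : ℝ, τ < t → 0 ≤ φ t - φ τ ∧ φ t - φ τ ≤ t - τ) ∧
    ∀ u : dom, ∃ v : dom,
      ((v : L2 m) =ᵐ[m] fun x => φ ((u : L2 m) x)) ∧ form v v ≤ form u u

section Form

variable {X : Type*} [MeasurableSpace X] {m : Measure X}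

/-- `E.IsImage u w` means `u ∈ D(A)` and `A u = w`, where `A` is the non-negative self-adjoint
operator associated with the closed form `E`. -/
def DirichletForm.IsImage (E : DirichletForm m) (u w : L2 m) : Prop :=
  ∃ hu : u ∈ E.dom, ∀ v : E.dom, E.form ⟨u, hu⟩ v = inner ℝ w (v : L2 m)

/-- The embedding of `V_{1/2}` (with the norm `(E(u,u) + ‖u‖²)^{1/2}`) into `L²` is compact: the
unit ball of `V_{1/2}` is relatively compact in `L²`. -/
def DirichletForm.CompactEmbedding (E : DirichletForm m) : Prop :=
  IsCompact (closure {u : L2 m | ∃ hu : u ∈ E.dom, E.form ⟨u, hu⟩ ⟨u, hu⟩ + ‖u‖ ^ 2 ≤ 1})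

/-- The continuous embedding `V_{1/2} ↪ L^{2q}(X, m)`. -/
def DirichletForm.SobolevEmbedding (E : DirichletForm m) (q : ℝ≥0∞) : Prop :=
  ∃ C : ℝ≥0, ∀ u : E.dom, eLpNorm (u : L2 m) (2 * q) m ≤
    C * ENNReal.ofReal (Real.sqrt (E.form u u + ‖(u : L2 m)‖ ^ 2))

/-- An orthonormal (Hilbert) basis of `L²(X, m)` of eigenfunctions of the operator `A` associated
with `E`, with the corresponding eigenvalues. -/
structure EigenSystem (E : DirichletForm m) where
  /-- The index set. -/
  ι : Type
  /-- The eigenfunctions. -/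
  basis : HilbertBasis ι ℝ (L2 m)
  /-- The eigenvalues, repeated according to multiplicity. -/
  eigenvalue : ι → ℝ
  isImage : ∀ i, E.IsImage (basis i) (eigenvalue i • basis i)

variable {E : DirichletForm m}

/-- The numbers `ε ≥ 0` for which the spectrum of `A + ε` has a positive lower bound. If the
lowest eigenvalue of `A` is positive then `ε = 0` is one of them. -/
def EigenSystem.Shift (S : EigenSystem E) : Type :=
  {ε : ℝ // 0 ≤ ε ∧ ∃ δ : ℝ, 0 < δ ∧ ∀ i, δ ≤ S.eigenvalue i + ε}

/-- The weight `(λ_i + ε)^s`. -/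
def EigenSystem.weight (S : EigenSystem E) (ε : S.Shift) (s : ℝ) (i : S.ι) : ℝ :=
  (S.eigenvalue i + ε.1) ^ s

lemma EigenSystem.base_pos (S : EigenSystem E) (ε : S.Shift) (i : S.ι) :
    0 < S.eigenvalue i + ε.1 := by
  obtain ⟨-, δ, hδ, h⟩ := ε.2
  exact hδ.trans_le (h i)

lemma EigenSystem.weight_pos (S : EigenSystem E) (ε : S.Shift) (s : ℝ) (i : S.ι) :
    0 < S.weight ε s i := Real.rpow_pos_of_pos (S.base_pos ε i) s

/-- The domain `D((A + ε)^s)`: all `h ∈ L²` with `∑ᵢ (λ_i + ε)^{2s} (φ_i, h)² < ∞`. -/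
def EigenSystem.fracDomain (S : EigenSystem E) (ε : S.Shift) (s : ℝ) : Submodule ℝ (L2 m) where
  carrier := {h | Memℓp (fun i => S.weight ε s i * inner ℝ (S.basis i) h) 2}
  zero_mem' := by
    simp only [mem_ofPred_eq, inner_zero_right, mul_zero]
    exact zero_memℓp
  add_mem' := by
    intro a b ha hb
    simp only [mem_ofPred_eq, inner_add_right, mul_add] at *
    exact ha.add hb
  smul_mem' := by
    intro c a ha
    simp only [mem_ofPred_eq, inner_smul_right] at *
    have := ha.const_smul c
    convert this using 2 with i
    simp only [Pi.smul_apply, smul_eq_mul]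
    ring

lemma EigenSystem.memℓp_inner (S : EigenSystem E) (h : L2 m) :
    Memℓp (fun i => inner ℝ (S.basis i) h) 2 := by
  have h1 := (S.basis.repr h).2
  have h2 : (fun i => inner ℝ (S.basis i) h) = fun i => S.basis.repr h i :=
    funext fun i => (S.basis.repr_apply_apply h i).symm
  rw [h2]
  exact h1

lemma EigenSystem.fracDomain_mono (S : EigenSystem E) (ε : S.Shift) {σ s : ℝ} (h0 : 0 ≤ σ)
    (hs : σ ≤ s) : S.fracDomain ε s ≤ S.fracDomain ε σ := by
  intro h hh
  have h1 : Memℓp (fun i => S.weight ε s i * inner ℝ (S.basis i) h) 2 := hh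
  have h2 := S.memℓp_inner h
  change Memℓp (fun i => S.weight ε σ i * inner ℝ (S.basis i) h) 2
  refine Memℓp.mono (h1.norm.add h2.norm) fun i => ?_
  have hx := S.base_pos ε i
  simp only [Pi.add_apply, norm_mul, Real.norm_eq_abs, abs_of_pos (S.weight_pos ε _ i)]
  rw [← add_one_mul]
  refine mul_le_mul_of_nonneg_right ?_ (abs_nonneg _)
  have hp := S.weight_pos ε s i
  rcases le_total (S.eigenvalue i + ε.1) 1 with h | h
  · have : S.weight ε σ i ≤ 1 := Real.rpow_le_one hx.le h h0
    linarith
  · have : S.weight ε σ i ≤ S.weight ε s i := Real.rpow_le_rpow_of_exponent_le h hs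
    linarith

/-- The space `V_s = D((A + ε)^s)`, with the norm `(∑ᵢ (λ_i + ε)^{2s} (φ_i, h)²)^{1/2}`. -/
def EigenSystem.V (S : EigenSystem E) (ε : S.Shift) (s : ℝ) : Type _ := S.fracDomain ε s

namespace EigenSystem

instance (S : EigenSystem E) (ε : S.Shift) (s : ℝ) : AddCommGroup (S.V ε s) :=
  inferInstanceAs (AddCommGroup (S.fracDomain ε s))

instance (S : EigenSystem E) (ε : S.Shift) (s : ℝ) : Module ℝ (S.V ε s) :=
  inferInstanceAs (Module ℝ (S.fracDomain ε s))

/-- The inclusion `V_s ⊆ L²` as a linear map. -/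
def toL2Lin (S : EigenSystem E) (ε : S.Shift) (s : ℝ) : S.V ε s →ₗ[ℝ] L2 m :=
  (S.fracDomain ε s).subtype

/-- The sequence of weighted coefficients `(λ_i + ε)^s (φ_i, h)` of `h ∈ V_s`. -/
def toSeq (S : EigenSystem E) (ε : S.Shift) (s : ℝ) :
    S.V ε s →ₗ[ℝ] lp (fun _ : S.ι => ℝ) 2 where
  toFun h := ⟨fun i => S.weight ε s i * inner ℝ (S.basis i) (S.toL2Lin ε s h), h.2⟩
  map_add' a b := by
    ext i
    simp only [map_add, inner_add_right, mul_add]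
    rfl
  map_smul' c a := by
    ext i
    simp [inner_smul_right, mul_left_comm]

lemma toSeq_apply (S : EigenSystem E) (ε : S.Shift) (s : ℝ) (h : S.V ε s) (i : S.ι) :
    S.toSeq ε s h i = S.weight ε s i * inner ℝ (S.basis i) (S.toL2Lin ε s h) := rfl

lemma toSeq_injective (S : EigenSystem E) (ε : S.Shift) (s : ℝ) :
    Function.Injective (S.toSeq ε s) := by
  intro a b hab
  have h : ∀ i, inner ℝ (S.basis i) (S.toL2Lin ε s a) = inner ℝ (S.basis i) (S.toL2Lin ε s b) := by
    intro i
    have := congrArg (fun c : lp (fun _ : S.ι => ℝ) 2 => c i) hab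
    simp only [toSeq_apply] at this
    exact mul_left_cancel₀ (S.weight_pos ε s i).ne' this
  have h2 : S.toL2Lin ε s a = S.toL2Lin ε s b := by
    apply S.basis.repr.injective
    ext i
    rw [S.basis.repr_apply_apply, S.basis.repr_apply_apply, h i]
  exact Subtype.ext h2

instance (S : EigenSystem E) (ε : S.Shift) (s : ℝ) : NormedAddCommGroup (S.V ε s) :=
  NormedAddCommGroup.induced (S.V ε s) (lp (fun _ : S.ι => ℝ) 2) (S.toSeq ε s)
    (S.toSeq_injective ε s)

instance (S : EigenSystem E) (ε : S.Shift) (s : ℝ) : NormedSpace ℝ (S.V ε s) :=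
  NormedSpace.induced ℝ (S.V ε s) (lp (fun _ : S.ι => ℝ) 2) (S.toSeq ε s)

lemma exists_norm_toL2Lin_le (S : EigenSystem E) (ε : S.Shift) {s : ℝ} (hs : 0 ≤ s) :
    ∃ C : ℝ, ∀ v : S.V ε s, ‖S.toL2Lin ε s v‖ ≤ C * ‖v‖ := by
  obtain ⟨-, δ, hδ, hle⟩ := ε.2
  refine ⟨(δ ^ s)⁻¹, fun v => ?_⟩
  have hd : 0 < δ ^ s := Real.rpow_pos_of_pos hδ s
  have hv : ‖v‖ = ‖S.toSeq ε s v‖ := rfl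
  rw [inv_mul_eq_div, le_div_iff₀ hd, mul_comm, hv, ← S.basis.repr.norm_map,
    ← Real.norm_of_nonneg hd.le, ← norm_smul]
  refine lp.norm_mono (by norm_num) fun i => ?_
  rw [toSeq_apply, lp.coeFn_smul, Pi.smul_apply, S.basis.repr_apply_apply, norm_smul, norm_mul]
  refine mul_le_mul_of_nonneg_right ?_ (norm_nonneg _)
  rw [Real.norm_of_nonneg hd.le, Real.norm_of_nonneg (S.weight_pos ε s i).le]
  exact Real.rpow_le_rpow hδ.le (hle i) hs

/-- The continuous inclusion `V_s ↪ L²` for `s ≥ 0`. -/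
def toL2 (S : EigenSystem E) (ε : S.Shift) {s : ℝ} (hs : 0 ≤ s) : S.V ε s →L[ℝ] L2 m :=
  (S.toL2Lin ε s).mkContinuousOfExistsBound (S.exists_norm_toL2Lin_le ε hs)

/-- The inclusion `V_s ⊆ V_σ` for `0 ≤ σ ≤ s`. -/
def incl (S : EigenSystem E) (ε : S.Shift) {σ s : ℝ} (h0 : 0 ≤ σ) (hs : σ ≤ s) :
    S.V ε s →ₗ[ℝ] S.V ε σ :=
  Submodule.inclusion (S.fracDomain_mono ε h0 hs)

/-- The space `V_{-s}`, the dual of `V_s`, with its dual norm. -/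
abbrev Vdual (S : EigenSystem E) (ε : S.Shift) (s : ℝ) : Type _ := StrongDual ℝ (S.V ε s)

/-- The inclusion `L² ⊆ V_{-s}` of the Gelfand triple: `h` acts on `V_s` as `v ↦ (h, v)`. -/
def toVdual (S : EigenSystem E) (ε : S.Shift) {s : ℝ} (hs : 0 ≤ s) (h : L2 m) : S.Vdual ε s :=
  (innerSL ℝ h).comp (S.toL2 ε hs)

end EigenSystem

/-- `w` is the second derivative of `J` on `[0, T]` in the sense of `W^{2,1}((0,T); F)`: `J` is
differentiable on `[0, T]`, and its derivative is the indefinite integral of `w ∈ L¹((0,T); F)` up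
to an additive constant. -/
def IsSecondDeriv {F : Type*} [NormedAddCommGroup F] [NormedSpace ℝ F] (T : ℝ) (J w : ℝ → F) :
    Prop :=
  IntegrableOn w (Ioo 0 T) ∧ ∃ K : ℝ → F,
    (∀ t ∈ Icc 0 T, HasDerivWithinAt J (K t) (Icc 0 T) t) ∧
    ∀ t ∈ Icc 0 T, K t = K 0 + ∫ s in (0 : ℝ)..t, w s

/-- The fractional integral `Γ(2-α)⁻¹ ∫₀ᵗ (t-s)^{1-α} (u(s) - u₀ - s u₁) ds`, whose second
derivative in `t` is the Caputo derivative of order `α` of a function `u` with `u(0) = u₀`,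
`∂ₜu(0) = u₁`. -/
def caputoIntegral (α : ℝ) (u : ℝ → L2 m) (u₀ u₁ : L2 m) (t : ℝ) : L2 m :=
  (Real.Gamma (2 - α))⁻¹ • ∫ s in (0 : ℝ)..t, (t - s) ^ (1 - α) • (u s - u₀ - s • u₁)

/-- The two-parameter Mittag-Leffler function `E_{a,b}` on the real line, for `a, b > 0`. -/
def mittagLeffler (a b z : ℝ) : ℝ := ∑' n : ℕ, z ^ n / Real.Gamma (a * n + b)

lemma gamma_nonneg {α : ℝ} (hα : 1 < α) : 0 ≤ 1 / α := by positivity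

/-- The requirements common to both notions of weak solution on `(0, T)`. Here `γ = 1/α`, `u`
takes values in `V_γ`, `du` is the time derivative of `u` as an `L²`-valued function, and `w` is
the Caputo derivative of `u` as a `V_{-γ}`-valued function. -/
structure WeakSolutionCore (S : EigenSystem E) (ε : S.Shift) {α : ℝ} (hα : 1 < α) (f : ℝ → ℝ)
    (u₀ : S.V ε (1 / α)) (u₁ : L2 m) (T : ℝ) (u : ℝ → S.V ε (1 / α)) (du : ℝ → L2 m)
    (w : ℝ → S.Vdual ε (1 / α)) : Prop where
  continuousOn : ContinuousOn u (Icc 0 T)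
  hasDeriv : ∀ t ∈ Icc 0 T,
    HasDerivWithinAt (fun s => S.toL2 ε (gamma_nonneg hα) (u s)) (du t) (Icc 0 T) t
  continuousOn_deriv : ContinuousOn du (Icc 0 T)
  caputo : IsSecondDeriv T
    (fun t => S.toVdual ε (gamma_nonneg hα)
      (caputoIntegral α (fun s => S.toL2 ε (gamma_nonneg hα) (u s))
        (S.toL2 ε (gamma_nonneg hα) (u 0)) (du 0) t)) w
  init : u 0 = u₀
  init_deriv : du 0 = u₁
  init_lim : ∃ σ : ℝ, ∃ hσ₀ : 0 ≤ σ, ∃ hσ : σ < 1 / α,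
    Tendsto (fun t => ‖S.incl ε hσ₀ hσ.le (u t - u₀)‖) (𝓝[>] 0) (𝓝 0)
  init_deriv_lim : ∃ β : ℝ, ∃ hβ : 0 < β, β ≤ 1 - 1 / α ∧
    Tendsto (fun t => ‖S.toVdual ε hβ.le (du t - u₁)‖) (𝓝[>] 0) (𝓝 0)
  memLp_nonlinearity : ∀ᵐ t ∂(volume.restrict (Ioo 0 T)),
    MemLp (fun x => f (S.toL2 ε (gamma_nonneg hα) (u t) x)) 2 m
  variational : ∀ φ : S.V ε (1 / α), ∀ᵐ t ∂(volume.restrict (Ioo 0 T)),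
    ∃ (hu : S.toL2 ε (gamma_nonneg hα) (u t) ∈ E.dom)
      (hφ : S.toL2 ε (gamma_nonneg hα) φ ∈ E.dom),
      w t φ + E.form ⟨_, hu⟩ ⟨_, hφ⟩ =
        ∫ x, f (S.toL2 ε (gamma_nonneg hα) (u t) x) * S.toL2 ε (gamma_nonneg hα) φ x ∂m

/-- Weak solutions on `(0, T)` in the subcritical case: the Caputo derivative belongs to
`C([0,T]; V_{-γ})`. -/
def IsWeakSolution (S : EigenSystem E) (ε : S.Shift) {α : ℝ} (hα : 1 < α) (f : ℝ → ℝ)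
    (u₀ : S.V ε (1 / α)) (u₁ : L2 m) (T : ℝ) (u : ℝ → S.V ε (1 / α)) : Prop :=
  ∃ (du : ℝ → L2 m) (w : ℝ → S.Vdual ε (1 / α)),
    WeakSolutionCore S ε hα f u₀ u₁ T u du w ∧ ContinuousOn w (Icc 0 T)

/-- `u ∈ L^a((0,T); L^b(X))`, for an `L²`-valued function `u`. -/
def MemMixedLp (a b : ℝ≥0∞) [Fact (1 ≤ b)] (T : ℝ) (u : ℝ → L2 m) : Prop :=
  ∃ v : ℝ → Lp ℝ b m, MemLp v a (volume.restrict (Ioo 0 T)) ∧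
    ∀ᵐ t ∂(volume.restrict (Ioo 0 T)), v t =ᵐ[m] u t

/-- Weak solutions on `(0, T)` in the critical and supercritical cases, with exponents `r > 1` and
`q`: in addition `u ∈ L^{rq}((0,T); L^{2r}(X))`, and the Caputo derivative belongs to
`C([0,T]; V_{-γ}) + L^q((0,T); L²(X))`. -/
def IsWeakSolutionCrit (S : EigenSystem E) (ε : S.Shift) {α : ℝ} (hα : 1 < α) (f : ℝ → ℝ)
    (u₀ : S.V ε (1 / α)) (u₁ : L2 m) (r : ℝ) (q : ℝ≥0∞) (T : ℝ)
    (u : ℝ → S.V ε (1 / α)) : Prop :=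
  1 < r ∧ ∃ (du : ℝ → L2 m) (w : ℝ → S.Vdual ε (1 / α)),
    WeakSolutionCore S ε hα f u₀ u₁ T u du w ∧
    (∃ _ : Fact (1 ≤ ENNReal.ofReal (2 * r)),
      MemMixedLp (ENNReal.ofReal r * q) (ENNReal.ofReal (2 * r)) T
        (fun t => S.toL2 ε (gamma_nonneg hα) (u t))) ∧
    ∃ (θ₁ : ℝ → S.Vdual ε (1 / α)) (θ₂ : ℝ → L2 m), ContinuousOn θ₁ (Icc 0 T) ∧
      MemLp θ₂ q (volume.restrict (Ioo 0 T)) ∧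
      ∀ᵐ t ∂(volume.restrict (Ioo 0 T)), w t = θ₁ t + S.toVdual ε (gamma_nonneg hα) (θ₂ t)

/-- The variation-of-constants formula on `[0, T]`, each of the three series converging in `L²`. -/
def VariationOfConstants (S : EigenSystem E) (ε : S.Shift) {α : ℝ} (hα : 1 < α) (f : ℝ → ℝ)
    (u₀ : S.V ε (1 / α)) (u₁ : L2 m) (T : ℝ) (u : ℝ → S.V ε (1 / α)) : Prop :=
  (∀ t ∈ Icc 0 T, MemLp (fun x => f (S.toL2 ε (gamma_nonneg hα) (u t) x)) 2 m) ∧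
  ∀ t ∈ Icc 0 T, ∃ s₁ s₂ s₃ : L2 m,
    HasSum (fun i => (inner ℝ (S.toL2 ε (gamma_nonneg hα) u₀) (S.basis i) *
      mittagLeffler α 1 (-S.eigenvalue i * t ^ α)) • S.basis i) s₁ ∧
    HasSum (fun i => (inner ℝ u₁ (S.basis i) *
      (t * mittagLeffler α 2 (-S.eigenvalue i * t ^ α))) • S.basis i) s₂ ∧
    (∀ i, IntervalIntegrable (fun τ =>
      (∫ x, f (S.toL2 ε (gamma_nonneg hα) (u τ) x) * S.basis i x ∂m) *
        ((t - τ) ^ (α - 1) * mittagLeffler α α (-S.eigenvalue i * (t - τ) ^ α))) volume 0 t) ∧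
    HasSum (fun i => (∫ τ in (0 : ℝ)..t,
      (∫ x, f (S.toL2 ε (gamma_nonneg hα) (u τ) x) * S.basis i x ∂m) *
        ((t - τ) ^ (α - 1) * mittagLeffler α α (-S.eigenvalue i * (t - τ) ^ α))) • S.basis i) s₃ ∧
    S.toL2 ε (gamma_nonneg hα) (u t) = s₁ + s₂ + s₃

end Form

/-- The exponent `θ_A = q / (2 (q - 1))`, written so that it equals `1/2` for `q = ∞`. -/
def thetaA (q : ℝ≥0∞) : ℝ := 1 / (2 * (1 - (q⁻¹).toReal))

/-- The critical value `α₀ = 1/θ_A = 2 (q - 1) / q`. -/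
def alpha0 (q : ℝ≥0∞) : ℝ := 1 / thetaA q

/-- Polynomial growth condition on the nonlinearity. -/
def Hf1 (f : ℝ → ℝ) (r : ℝ) : Prop :=
  ContDiff ℝ 1 f ∧ f 0 = 0 ∧ ∃ C : ℝ, 0 < C ∧ ∀ s : ℝ, |deriv f s| ≤ C * |s| ^ (r - 1)

/-- The condition on the nonlinearity that imposes no growth restriction. -/
def Hf2 (f : ℝ → ℝ) : Prop :=
  ContDiff ℝ 1 f ∧ f 0 = 0 ∧ ∃ Q₁ Q₂ : ℝ → ℝ,
    MonotoneOn Q₁ (Ici 0) ∧ MonotoneOn Q₂ (Ici 0) ∧ (∀ s, 0 ≤ s → 0 ≤ Q₁ s ∧ 0 ≤ Q₂ s) ∧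
    ∀ s : ℝ, |deriv f s| ≤ Q₁ |s| ∧ |f s| ≤ Q₂ |s|

/-- The admissible exponents `r` of the growth condition `Hf1`. -/
def AdmissibleExponent (q : ℝ≥0∞) (α r : ℝ) : Prop :=
  (2 < q ∧ ((α = alpha0 q ∧ 1 < r) ∨ (alpha0 q < α ∧ r = thetaA q * α / (thetaA q * α - 1)))) ∨
  (q ≤ 2 ∧ r = thetaA q * α / (thetaA q * α - 1))

end FracWave

end

open FracWave

/-! In the eigenbasis of `A` the problem splits into scalar fractional equations, solved by the
kernels e_b(t) = t^(b-1) E_{α,b}(-λt^α). The theorem then becomes a contraction argument in C([0,T];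
V_{1/α}) for the mild equation u = (free solution) + e_α(A) * f(u). Three ingredients make this
work.

(1) Linear estimates: λ^θ |e_b(t)| ≤ C t^(b-1-αθ), uniformly in λ ≥ 0, for 0 ≤ θ ≤ 1 and αθ < b
(`exists_rpow_mul_abs_mlKernel_le`). They come from an absolutely convergent integral over the line
Re s = 1. For b = α and θ = 1/α the bound is t^(α-2), integrable because α > 1, so the kernel
smooths L² into V_{1/α}.

(2) Embeddings. The Sobolev embedding gives Nash's inequality, and the Markov property makes the
resolvents contractions in L¹. Iterating the resolvent bounds the spectral projection to 1 + λ ≤ Λ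
from L¹ to L², with squared norm at most CΛ^(2θ_A) (`exists_sum_sq_le`). Summing over frequencies
gives V_s ⊂ L^∞ for s > θ_A (`exists_ae_abs_le`) and V_s ⊂ L^p with the endpoint exponent p =
2θ_A/(θ_A - s) for 0 < s < θ_A (`exists_eLpNorm_le`). Hence V_{1/α} lies in L^∞ when α < α₀, and in
L^{2r} for the exponents r of case (II), the critical one included. In both cases u ↦ f(u) is
Lipschitz from bounded sets of V_{1/α} to L², so the two cases share one existence and uniqueness
theorem (`exists_solution`).

(3) Weak and mild solutions coincide (`weakSolutionCore_of_mild`, `mild_of_weakSolutionCore`).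
Tested on an eigenfunction, the Caputo equation says that g_{2-α} * (v - a - bt) is the double
integral of F - λv, where g_b denotes the kernel e_b for λ = 0. The identities g_δ * e_b = e_{b+δ}
and e_b + λ e_{b+α} = g_b solve this equation explicitly and give its uniqueness. Uniqueness of u
uses only continuity in V_{1/α} and the equation itself, so the exponents in the definition of a
type (C) solution play no role in it. -/

namespace FracWave

/-! ### Laplace transforms of powers and the Bromwich integral for 1/Γ. -/

/-- The Laplace transform of `t ^ (b - 1)` on the right half plane. -/
lemma integral_rpow_mul_cexp_neg_mul_Ioi {b : ℝ} (hb : 0 < b) {r : ℂ} (hr : 0 < r.re) :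
    ∫ t in Ioi (0 : ℝ), ((t ^ (b - 1) : ℝ) : ℂ) * Complex.exp (-(r * t)) =
      Real.Gamma b * r ^ (-(b : ℂ)) := by
  -- The integral is the complex moment generating function at -r of the measure with density
  -- t^(b-1), hence holomorphic in Re r > 0. It agrees with Γ(b) r^(-b) on the positive reals, and
  -- the identity theorem does the rest.
  set μ : Measure ℝ := (volume.restrict (Ioi (0 : ℝ))).withDensity
    (fun t => ENNReal.ofReal (t ^ (b - 1))) with hμ
  have hmeas : Measurable fun t : ℝ => (t ^ (b - 1)).toNNReal := by fun_prop
  have hpos : ∀ᵐ t ∂(volume.restrict (Ioi (0 : ℝ))), 0 ≤ t ^ (b - 1) := by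
    filter_upwards [ae_restrict_mem measurableSet_Ioi] with t ht
    exact Real.rpow_nonneg (le_of_lt ht) _
  have hint : ∀ z : ℂ, ∫ t, Complex.exp (z * t) ∂μ =
      ∫ t in Ioi (0 : ℝ), ((t ^ (b - 1) : ℝ) : ℂ) * Complex.exp (z * t) := by
    intro z
    rw [hμ]
    change ∫ t, Complex.exp (z * t) ∂((volume.restrict (Ioi (0 : ℝ))).withDensity
      (fun t => (((t ^ (b - 1)).toNNReal : ℝ≥0) : ℝ≥0∞))) = _
    rw [integral_withDensity_eq_integral_smul hmeas]
    refine integral_congr_ae ?_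
    filter_upwards [hpos] with t ht
    rw [NNReal.smul_def, Real.coe_toNNReal _ ht, Complex.real_smul]
  have hset : Iio (0 : ℝ) ⊆ interior (ProbabilityTheory.integrableExpSet id μ) := by
    refine interior_maximal (fun x hx => ?_) isOpen_Iio
    change Integrable (fun t => Real.exp (x * id t)) μ
    change Integrable (fun t => Real.exp (x * id t)) ((volume.restrict (Ioi (0 : ℝ))).withDensity
      (fun t => (((t ^ (b - 1)).toNNReal : ℝ≥0) : ℝ≥0∞)))
    rw [integrable_withDensity_iff_integrable_smul hmeas]
    have h1 : Integrable (fun t : ℝ => t ^ (b - 1) * Real.exp (-(-x * t)))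
        (volume.restrict (Ioi (0 : ℝ))) := by
      -- A non-integrable function has integral 0 by convention, so the nonzero Gamma value
      -- certifies integrability.
      refine Integrable.of_integral_ne_zero ?_
      have hx' : 0 < -x := by simpa using hx
      rw [Real.integral_rpow_mul_exp_neg_mul_Ioi hb hx']
      have := Real.Gamma_pos_of_pos hb
      positivity
    refine h1.congr ?_
    filter_upwards [hpos] with t ht
    simp [NNReal.smul_def, Real.coe_toNNReal _ ht]
  set U : Set ℂ := {z | 0 < z.re}
  have hU : IsOpen U := isOpen_lt continuous_const Complex.continuous_re
  have hUc : IsPreconnected U := (convex_halfSpace_re_gt 0).isPreconnected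
  have hF : AnalyticOnNhd ℂ (fun z => ProbabilityTheory.complexMGF id μ (-z)) U := by
    refine DifferentiableOn.analyticOnNhd (fun z hz => ?_) hU
    refine DifferentiableAt.differentiableWithinAt ?_
    have h1 := (ProbabilityTheory.hasDerivAt_complexMGF (X := id) (μ := μ) (z := -z)
      (hset (by simpa [U] using hz))).differentiableAt
    exact h1.comp z differentiableAt_id.neg
  have hG : AnalyticOnNhd ℂ (fun z => (Real.Gamma b : ℂ) * z ^ (-(b : ℂ))) U := by
    refine DifferentiableOn.analyticOnNhd (fun z hz => ?_) hU
    refine DifferentiableAt.differentiableWithinAt ?_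
    refine DifferentiableAt.const_mul ?_ _
    exact DifferentiableAt.cpow_const differentiableAt_id (Or.inl hz)
  have hval : ∀ z : ℂ, ProbabilityTheory.complexMGF id μ (-z) =
      ∫ t in Ioi (0 : ℝ), ((t ^ (b - 1) : ℝ) : ℂ) * Complex.exp (-(z * t)) := by
    intro z
    have := hint (-z)
    simpa [ProbabilityTheory.complexMGF] using this
  have hreal : ∀ x : ℝ, 0 < x → ProbabilityTheory.complexMGF id μ (-(x : ℂ)) =
      (Real.Gamma b : ℂ) * (x : ℂ) ^ (-(b : ℂ)) := by
    intro x hx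
    have h1 := Real.integral_rpow_mul_exp_neg_mul_Ioi hb hx
    rw [hval]
    have h2 : ∀ t : ℝ, ((t ^ (b - 1) : ℝ) : ℂ) * Complex.exp (-(x * t)) =
        ((t ^ (b - 1) * Real.exp (-(x * t)) : ℝ) : ℂ) := by intro t; push_cast; rfl
    simp_rw [h2]
    rw [integral_complex_ofReal, h1, one_div, Real.inv_rpow hx.le, ← Real.rpow_neg hx.le, mul_comm]
    push_cast
    rw [Complex.ofReal_cpow hx.le]
    push_cast
    rfl
  have := hF.eqOn_of_preconnected_of_frequently_eq hG hUc (z₀ := 1) (by simp [U]) ?_ hr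
  · rw [← hval]; exact this
  -- Real points to the right of 1 accumulate at 1, which is all the identity theorem needs.
  · have hmap : Tendsto (fun x : ℝ => (x : ℂ)) (𝓝[>] 1) (𝓝[≠] 1) := by
      refine tendsto_nhdsWithin_iff.2 ⟨?_, ?_⟩
      · have : Tendsto (fun x : ℝ => (x : ℂ)) (𝓝 1) (𝓝 ((1 : ℝ) : ℂ)) :=
          Complex.continuous_ofReal.tendsto 1
        simpa using this.mono_left nhdsWithin_le_nhds
      · filter_upwards [self_mem_nhdsWithin] with x hx h1
        have : x = 1 := by exact_mod_cast (mem_singleton_iff.1 h1)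
        exact hx.ne' this
    refine hmap.frequently (Eventually.frequently ?_)
    filter_upwards [self_mem_nhdsWithin] with x hx
    exact hreal x (zero_lt_one.trans hx)

/-- The line `Re s = 1`, parametrised so that it fits the Fourier transform. -/
noncomputable def bromwich (ξ : ℝ) : ℂ := 1 + 2 * Real.pi * ξ * Complex.I

lemma bromwich_re (ξ : ℝ) : (bromwich ξ).re = 1 := by simp [bromwich]

lemma bromwich_im (ξ : ℝ) : (bromwich ξ).im = 2 * Real.pi * ξ := by simp [bromwich]

lemma bromwich_ne_zero (ξ : ℝ) : bromwich ξ ≠ 0 := fun h => by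
  have := bromwich_re ξ
  simp [h] at this

@[fun_prop]
lemma continuous_bromwich : Continuous bromwich := by unfold bromwich; fun_prop

lemma one_le_norm_bromwich (ξ : ℝ) : 1 ≤ ‖bromwich ξ‖ := by
  have := Complex.re_le_norm (bromwich ξ)
  rwa [bromwich_re] at this

lemma bromwich_mem_slitPlane (ξ : ℝ) : bromwich ξ ∈ Complex.slitPlane :=
  Or.inl (by rw [bromwich_re]; norm_num)

lemma norm_bromwich_cpow (ξ b : ℝ) : ‖bromwich ξ ^ (b : ℂ)‖ = ‖bromwich ξ‖ ^ b :=
  Complex.norm_cpow_real _ _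

lemma continuous_bromwich_cpow (b : ℂ) : Continuous fun ξ => bromwich ξ ^ b :=
  continuous_bromwich.cpow continuous_const bromwich_mem_slitPlane

lemma integrable_norm_bromwich_rpow {b : ℝ} (hb : 1 < b) :
    Integrable fun ξ : ℝ => ‖bromwich ξ‖ ^ (-b) := by
  have h := integrable_rpow_neg_one_add_norm_sq (E := ℝ) (μ := volume) (r := b) (by simpa using hb)
  refine h.mono' ?_ (ae_of_all _ fun ξ => ?_)
  · exact (Continuous.rpow_const (by fun_prop)
      fun ξ => Or.inl (by have := one_le_norm_bromwich ξ; positivity)).aestronglyMeasurable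
  · rw [Real.norm_of_nonneg (by positivity)]
    have h1 : (1 + ‖ξ‖ ^ 2) ≤ ‖bromwich ξ‖ ^ 2 := by
      rw [Complex.sq_norm, Complex.normSq_apply, bromwich_re, bromwich_im, Real.norm_eq_abs, sq_abs]
      have : (3 : ℝ) < Real.pi := Real.pi_gt_three
      have h2 : (1 : ℝ) ≤ 4 * (Real.pi * Real.pi) := by nlinarith
      nlinarith [mul_le_mul_of_nonneg_right h2 (sq_nonneg ξ)]
    calc ‖bromwich ξ‖ ^ (-b) = (‖bromwich ξ‖ ^ 2) ^ (-b / 2) := by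
          rw [← Real.rpow_natCast, ← Real.rpow_mul (norm_nonneg _)]
          congr 1; push_cast; ring
      _ ≤ (1 + ‖ξ‖ ^ 2) ^ (-b / 2) :=
          Real.rpow_le_rpow_of_nonpos (by positivity) h1 (by linarith)

/-- Hankel's formula for the reciprocal of the Gamma function, on the line `Re s = 1`. -/
lemma integral_bromwich {b : ℝ} (hb : 1 < b) :
    ∫ ξ : ℝ, Complex.exp (bromwich ξ) * bromwich ξ ^ (-(b : ℂ)) = ((Real.Gamma b)⁻¹ : ℝ) := by
  -- Fourier inversion at t = 1 for t^(b-1) e^(-t) on the half-line. Its transform is Γ(b) s^(-b) at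
  -- s = `bromwich ξ`, integrable since b > 1, and e^(2πiξ) = e^(-1) e^s.
  set f : ℝ → ℂ := (Ioi (0 : ℝ)).indicator fun t => ((t ^ (b - 1) : ℝ) : ℂ) * Complex.exp (-t)
    with hf
  have hΓ := Real.Gamma_pos_of_pos (zero_lt_one.trans hb)
  have hfi : Integrable f := by
    rw [hf, integrable_indicator_iff measurableSet_Ioi]
    have h0 := integral_rpow_mul_cexp_neg_mul_Ioi (zero_lt_one.trans hb) (r := 1) (by simp)
    refine Integrable.of_integral_ne_zero ?_
    simp only [one_mul] at h0
    rw [h0]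
    simpa using hΓ.ne'
  have hfour : FourierTransform.fourier f = fun ξ => (Real.Gamma b : ℂ) * bromwich ξ ^ (-(b : ℂ)) := by
    ext ξ
    rw [Real.fourier_eq]
    rw [← integral_rpow_mul_cexp_neg_mul_Ioi (zero_lt_one.trans hb) (r := bromwich ξ)
      (by rw [bromwich_re]; norm_num), ← integral_indicator measurableSet_Ioi]
    congr 1
    ext t
    rw [Circle.smul_def, Real.fourierChar_apply, smul_eq_mul, hf]
    by_cases ht : t ∈ Ioi (0 : ℝ)
    · rw [indicator_of_mem ht, indicator_of_mem ht, mul_left_comm, ← Complex.exp_add]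
      congr 2
      simp [bromwich]
      ring
    · rw [indicator_of_notMem ht, indicator_of_notMem ht, mul_zero]
  have hfouri : Integrable (FourierTransform.fourier f) := by
    rw [hfour]
    refine Integrable.const_mul ?_ _
    refine (integrable_norm_bromwich_rpow hb).mono'
      (continuous_bromwich_cpow _).aestronglyMeasurable (ae_of_all _ fun ξ => ?_)
    rw [← Complex.ofReal_neg, norm_bromwich_cpow]
  have hcont : ContinuousAt f 1 := by
    have h1 : f =ᶠ[𝓝 1] fun t => ((t ^ (b - 1) : ℝ) : ℂ) * Complex.exp (-t) := by
      filter_upwards [Ioi_mem_nhds (zero_lt_one' ℝ)] with t ht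
      rw [hf, indicator_of_mem ht]
    refine ContinuousAt.congr ?_ h1.symm
    refine ContinuousAt.mul ?_ (by fun_prop)
    exact Complex.continuous_ofReal.continuousAt.comp
      (Real.continuousAt_rpow_const _ _ (Or.inl one_ne_zero))
  have h := hfi.fourierInv_fourier_eq hfouri hcont
  rw [Real.fourierInv_eq] at h
  rw [hfour] at h
  have h1 : f 1 = Complex.exp (-1) := by simp [hf]
  rw [h1] at h
  have h2 : ∫ v : ℝ, Real.fourierChar (inner ℝ v 1) • ((Real.Gamma b : ℂ) * bromwich v ^ (-(b : ℂ)))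
      = Real.Gamma b * Complex.exp (-1) *
        ∫ ξ : ℝ, Complex.exp (bromwich ξ) * bromwich ξ ^ (-(b : ℂ)) := by
    rw [← integral_const_mul]
    congr 1
    ext ξ
    rw [Circle.smul_def, Real.fourierChar_apply, smul_eq_mul]
    have : Complex.exp (2 * Real.pi * inner ℝ ξ 1 * Complex.I : ℂ) =
        Complex.exp (-1) * Complex.exp (bromwich ξ) := by
      rw [← Complex.exp_add]; congr 1; simp [bromwich]
    push_cast
    rw [this]
    ring
  rw [h2] at h
  have h3 : Complex.exp (-1) ≠ 0 := Complex.exp_ne_zero _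
  have h4 : (Real.Gamma b : ℂ) ≠ 0 := by exact_mod_cast hΓ.ne'
  push_cast
  field_simp
  have h5 : Complex.exp (-1) * ((Real.Gamma b : ℂ) *
      ∫ ξ : ℝ, Complex.exp (bromwich ξ) * bromwich ξ ^ (-(b : ℂ))) = Complex.exp (-1) * 1 := by
    rw [mul_one, ← mul_assoc, mul_comm (Complex.exp _)]
    exact h
  have := mul_left_cancel₀ h3 h5
  rw [mul_comm]
  exact this

end FracWave

/-! ### Decay of Mittag-Leffler functions on the negative half-line. -/

namespace FracWave

lemma summable_pow_div_Gamma {α β : ℝ} (hα : 1 < α) (hβ : 0 < β) (R : ℝ) :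
    Summable fun k : ℕ => |R| ^ k / Real.Gamma (α * k + β) := by
  -- The shift by 2 brings the arguments into [2, ∞), where Γ increases: Γ(α(k+2)+β) ≥ Γ(k+2) =
  -- (k+1)! ≥ k!.
  rw [← summable_nat_add_iff 2]
  refine Summable.of_nonneg_of_le (fun k => ?_) (fun k => ?_)
    ((Real.summable_pow_div_factorial |R|).mul_left (|R| ^ 2))
  · have := Real.Gamma_pos_of_pos (show 0 < α * ((k + 2 : ℕ) : ℝ) + β by positivity)
    positivity
  · have h1 : ((k.factorial : ℕ) : ℝ) ≤ Real.Gamma (α * ((k + 2 : ℕ) : ℝ) + β) := by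
      have h2 : (k.factorial : ℝ) ≤ ((k + 1).factorial : ℝ) := by
        exact_mod_cast Nat.factorial_le (Nat.le_succ k)
      refine h2.trans ?_
      rw [← Real.Gamma_nat_eq_factorial]
      refine Real.Gamma_strictMonoOn_Ici.monotoneOn ?_ ?_ ?_
      · simp only [mem_Ici]; push_cast; linarith [(Nat.cast_nonneg k : (0 : ℝ) ≤ k)]
      · simp only [mem_Ici]; push_cast
        nlinarith [(Nat.cast_nonneg k : (0 : ℝ) ≤ k)]
      · push_cast
        nlinarith [(Nat.cast_nonneg k : (0 : ℝ) ≤ k)]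
    have h3 : (0 : ℝ) < k.factorial := by exact_mod_cast Nat.factorial_pos k
    rw [pow_add, mul_comm, mul_div_assoc]
    gcongr

lemma hasSum_mittagLeffler {α β : ℝ} (hα : 1 < α) (hβ : 0 < β) (z : ℝ) :
    HasSum (fun k : ℕ => z ^ k / Real.Gamma (α * k + β)) (mittagLeffler α β z) := by
  refine Summable.hasSum ?_
  refine Summable.of_norm_bounded (summable_pow_div_Gamma hα hβ z) fun k => ?_
  rw [norm_div, norm_pow, Real.norm_eq_abs,
    Real.norm_of_nonneg (Real.Gamma_pos_of_pos (by positivity)).le]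

section Bound

variable {α β : ℝ}

/-- A sector estimate for `s ^ (-α)` on the line `Re s = 1`. -/
lemma exists_le_norm_one_add_mul (hα : 1 < α) (hα2 : α < 2) : ∃ c : ℝ, 0 < c ∧
    ∀ (ξ x : ℝ), 0 ≤ x → c * (1 + x * ‖bromwich ξ ^ (-α : ℂ)‖) ≤
      ‖1 + x * bromwich ξ ^ (-α : ℂ)‖ := by
  -- On the line |arg s| < π/2, so w = s^(-α) has |arg w| < πα/2 < π, whence Re w ≥ -κ|w| with κ <
  -- 1.
  set κ := -Real.cos (Real.pi * α / 2) with hκ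
  have hπ := Real.pi_pos
  have hκ1 : κ < 1 := by
    have : -1 < Real.cos (Real.pi * α / 2) := by
      rw [← Real.cos_pi]
      exact Real.cos_lt_cos_of_nonneg_of_le_pi (by positivity) le_rfl (by nlinarith)
    linarith
  have hκ2 : -1 ≤ κ := by linarith [Real.cos_le_one (Real.pi * α / 2)]
  -- The constant is read off from 1 - 2κρ + ρ² = (1-κ)/2 · (1+ρ)² + (1+κ)/2 · (1-ρ)² with ρ = x|w|.
  refine ⟨√((1 - κ) / 2), Real.sqrt_pos.2 (by linarith), fun ξ x hx => ?_⟩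
  set w := bromwich ξ ^ (-α : ℂ) with hw
  have hre : -κ * ‖w‖ ≤ w.re := by
    have h1 : w.re = ‖bromwich ξ‖ ^ (-α) * Real.cos (Complex.arg (bromwich ξ) * (-α)) := by
      rw [hw, ← Complex.ofReal_neg, Complex.cpow_ofReal_re]
    have h2 : ‖w‖ = ‖bromwich ξ‖ ^ (-α) := by rw [hw, ← Complex.ofReal_neg, norm_bromwich_cpow]
    rw [h1, h2, mul_comm, hκ, neg_neg]
    refine mul_le_mul_of_nonneg_left ?_ (by positivity)
    rw [← Real.cos_abs (Complex.arg (bromwich ξ) * (-α)), abs_mul, abs_neg,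
      abs_of_pos (zero_lt_one.trans hα)]
    have h3 : |Complex.arg (bromwich ξ)| < Real.pi / 2 :=
      Complex.abs_arg_lt_pi_div_two_iff.2 (Or.inl (by rw [bromwich_re]; norm_num))
    refine Real.cos_le_cos_of_nonneg_of_le_pi (by positivity) (by nlinarith) ?_
    nlinarith
  refine (sq_le_sq₀ (by positivity) (norm_nonneg _)).1 ?_
  · rw [mul_pow, Real.sq_sqrt (by linarith), Complex.sq_norm, Complex.normSq_apply]
    have h4 : w.re * w.re + w.im * w.im = ‖w‖ ^ 2 := by
      rw [Complex.sq_norm, Complex.normSq_apply]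
    simp only [Complex.add_re, Complex.one_re, Complex.re_ofReal_mul, Complex.add_im,
      Complex.one_im, Complex.im_ofReal_mul, zero_add]
    have h5 := mul_le_mul_of_nonneg_left hre hx
    have h6 : (0 : ℝ) ≤ (1 + κ) / 2 * (1 - x * ‖w‖) ^ 2 := by
      have : 0 ≤ 1 + κ := by linarith
      positivity
    have h7 : (1 + x * w.re) * (1 + x * w.re) + x * w.im * (x * w.im) =
      1 + 2 * (x * w.re) + x ^ 2 * ‖w‖ ^ 2 := by rw [← h4]; ring
    rw [h7]
    nlinarith

/-- The integrand in the integral representation of the Mittag-Leffler function. -/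
noncomputable def mlIntegrand (α β : ℝ) (z : ℂ) (ξ : ℝ) : ℂ :=
  Complex.exp (bromwich ξ) * bromwich ξ ^ (-(β + 1 : ℂ)) *
    (β / (1 + z * bromwich ξ ^ (-α : ℂ)) -
      α * (z * bromwich ξ ^ (-α : ℂ)) / (1 + z * bromwich ξ ^ (-α : ℂ)) ^ 2)

lemma norm_bromwich_cpow_neg_le_one (hα : 0 < α) (ξ : ℝ) : ‖bromwich ξ ^ (-α : ℂ)‖ ≤ 1 := by
  rw [← Complex.ofReal_neg, norm_bromwich_cpow]
  exact Real.rpow_le_one_of_one_le_of_nonpos (one_le_norm_bromwich ξ) (by linarith)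

lemma norm_exp_mul_bromwich_cpow (b ξ : ℝ) :
    ‖Complex.exp (bromwich ξ) * bromwich ξ ^ (-(b + 1 : ℂ))‖ =
      Real.exp 1 * ‖bromwich ξ‖ ^ (-(b + 1)) := by
  rw [norm_mul, Complex.norm_exp, bromwich_re]
  congr 1
  rw [← norm_bromwich_cpow]; push_cast; rfl

lemma bromwich_cpow_add_mul (α β : ℝ) (k : ℕ) (ξ : ℝ) :
    bromwich ξ ^ (-(((α * k + β + 1 : ℝ)) : ℂ)) =
      bromwich ξ ^ (-(β + 1 : ℂ)) * (bromwich ξ ^ (-α : ℂ)) ^ k := by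
  rw [← Complex.cpow_nat_mul, ← Complex.cpow_add _ _ (bromwich_ne_zero ξ)]
  congr 1
  push_cast
  ring

/-- A geometric series plus its differentiated series; the latter produces the squared denominator
of `mlIntegrand`. -/
lemma hasSum_linear_mul_geometric {y : ℂ} (hy : ‖y‖ < 1) :
    HasSum (fun k : ℕ => (α * k + β : ℂ) * (-y) ^ k) (β / (1 + y) - α * y / (1 + y) ^ 2) := by
  have h1 := (hasSum_coe_mul_geometric_of_norm_lt_one (r := -y) (by simpa using hy)).mul_left
    (α : ℂ)
  have h2 := (hasSum_geometric_of_norm_lt_one (ξ := -y) (by simpa using hy)).mul_left (β : ℂ)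
  convert! h1.add h2 using 1
  · ext k; ring
  · rw [sub_neg_eq_add]; ring

/-- The classical integrand e^s s^(-β)/(1 + z s^(-α)) is absolutely integrable only for β > 1.
`mlIntegrand` is e^s times minus the s-derivative of the remaining factor, that is, the result of
one integration by parts. This gains a power of s and admits every β > 0; the velocity needs β = α -
1 < 1. For ‖z‖ < 1 the bracket is expanded and integrated termwise, the factor αk+β cancelling
against Γ(αk+β+1). -/
lemma hasSum_mlIntegrand (hα : 1 < α) (hβ : 0 < β) {z : ℂ} (hz : ‖z‖ < 1) :
    HasSum (fun k : ℕ => (-z) ^ k / (Real.Gamma (α * k + β) : ℂ)) (∫ ξ, mlIntegrand α β z ξ) := by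
  set F : ℕ → ℝ → ℂ := fun k ξ => ((α * k + β : ℝ) : ℂ) * (-z) ^ k *
    (Complex.exp (bromwich ξ) * bromwich ξ ^ (-(((α * k + β + 1 : ℝ)) : ℂ))) with hF
  have hbd : ∀ k ξ, ‖F k ξ‖ ≤ (α * k + β) * ‖z‖ ^ k *
      (Real.exp 1 * ‖bromwich ξ‖ ^ (-(β + 1))) := by
    intro k ξ
    rw [hF]
    simp only [norm_mul, norm_pow, norm_neg]
    rw [Complex.norm_of_nonneg (by positivity), bromwich_cpow_add_mul, norm_mul, ← mul_assoc
      (‖Complex.exp _‖), ← norm_mul, norm_exp_mul_bromwich_cpow, norm_pow]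
    refine mul_le_mul_of_nonneg_left ?_ (by positivity)
    refine mul_le_of_le_one_right (by positivity) ?_
    exact pow_le_one₀ (norm_nonneg _) (norm_bromwich_cpow_neg_le_one (by linarith) ξ)
  have hmeas : ∀ k, AEStronglyMeasurable (F k) volume := by
    intro k
    refine Continuous.aestronglyMeasurable ?_
    exact continuous_const.mul ((Complex.continuous_exp.comp continuous_bromwich).mul
      (continuous_bromwich_cpow _))
  have hInt : Integrable fun ξ : ℝ => Real.exp 1 * ‖bromwich ξ‖ ^ (-(β + 1)) :=
    (integrable_norm_bromwich_rpow (by linarith)).const_mul _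
  have hFi : ∀ k, Integrable (F k) := fun k =>
    (hInt.const_mul _).mono' (hmeas k) (ae_of_all _ (hbd k))
  have hsum : Summable fun k : ℕ => (α * k + β) * ‖z‖ ^ k := by
    have h1 := ((hasSum_coe_mul_geometric_of_norm_lt_one (r := ‖z‖) (by simpa using hz)).mul_left
      α).summable
    have h2 := ((hasSum_geometric_of_norm_lt_one (ξ := ‖z‖) (by simpa using hz)).mul_left
      β).summable
    refine (h1.add h2).congr fun k => by ring
  have hs2 : Summable fun k => ∫ ξ, ‖F k ξ‖ := by
    refine Summable.of_nonneg_of_le (fun k => by positivity) (fun k => ?_)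
      (hsum.mul_right (∫ ξ, Real.exp 1 * ‖bromwich ξ‖ ^ (-(β + 1))))
    rw [← integral_const_mul]
    exact integral_mono (hFi k).norm (hInt.const_mul _) (hbd k)
  have h := hasSum_integral_of_summable_integral_norm hFi hs2
  convert! h using 1
  · ext k
    rw [hF]
    have hb : 0 < α * k + β := by positivity
    rw [integral_const_mul, integral_bromwich (by linarith), Real.Gamma_add_one hb.ne']
    have h1 : ((α * k + β : ℝ) : ℂ) ≠ 0 := by exact_mod_cast hb.ne'
    have h2 : (Real.Gamma (α * k + β) : ℂ) ≠ 0 := by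
      exact_mod_cast (Real.Gamma_pos_of_pos hb).ne'
    rw [mul_inv, Complex.ofReal_mul, Complex.ofReal_inv, Complex.ofReal_inv]
    field_simp
  · congr 1
    ext ξ
    have hy : ‖z * bromwich ξ ^ (-α : ℂ)‖ < 1 := by
      rw [norm_mul]
      exact mul_lt_one_of_nonneg_of_lt_one_left (norm_nonneg _) hz
        (norm_bromwich_cpow_neg_le_one (by linarith) ξ)
    have h3 := (hasSum_linear_mul_geometric (α := α) (β := β) hy).mul_left
      (Complex.exp (bromwich ξ) * bromwich ξ ^ (-(β + 1 : ℂ)))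
    rw [mlIntegrand, ← h3.tsum_eq]
    refine tsum_congr fun k => ?_
    rw [hF]
    simp only
    rw [bromwich_cpow_add_mul, neg_pow (z * _), mul_pow, neg_pow z]
    push_cast
    ring

lemma continuous_mlIntegrand {z : ℂ}
    (hz : ∀ ξ, 1 + z * bromwich ξ ^ (-α : ℂ) ≠ 0) : Continuous (mlIntegrand α β z) := by
  unfold mlIntegrand
  have h1 := continuous_bromwich_cpow (-α : ℂ)
  have h2 := continuous_bromwich_cpow (-(β + 1 : ℂ))
  have h3 : Continuous fun ξ => 1 + z * bromwich ξ ^ (-α : ℂ) := by fun_prop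
  refine ((Complex.continuous_exp.comp continuous_bromwich).mul h2).mul ?_
  exact (continuous_const.div h3 hz).sub ((by fun_prop : Continuous fun ξ : ℝ =>
    (α : ℂ) * (z * bromwich ξ ^ (-α : ℂ))).div (h3.pow 2) fun ξ => pow_ne_zero _ (hz ξ))

/-- Differentiation under the integral sign: the lower bound d on the denominators and |s^(-α)| ≤ 1
on the line give a majorant independent of z near z₀. -/
lemma differentiableOn_integral_mlIntegrand (hα : 1 < α) (hβ : 0 < β) {U : Set ℂ}
    (hU : IsOpen U) {d : ℝ} (hd : 0 < d)
    (hUd : ∀ z ∈ U, ∀ ξ, d ≤ ‖1 + z * bromwich ξ ^ (-α : ℂ)‖) :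
    DifferentiableOn ℂ (fun z => ∫ ξ, mlIntegrand α β z ξ) U := by
  intro z₀ hz₀
  refine DifferentiableAt.differentiableWithinAt ?_
  set F' : ℂ → ℝ → ℂ := fun z ξ => Complex.exp (bromwich ξ) * bromwich ξ ^ (-(β + 1 : ℂ)) *
    (β * (-(bromwich ξ ^ (-α : ℂ))) / (1 + z * bromwich ξ ^ (-α : ℂ)) ^ 2 -
      (α * bromwich ξ ^ (-α : ℂ) * (1 + z * bromwich ξ ^ (-α : ℂ)) ^ 2 -
        α * (z * bromwich ξ ^ (-α : ℂ)) *
          (2 * (1 + z * bromwich ξ ^ (-α : ℂ)) * bromwich ξ ^ (-α : ℂ))) /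
        ((1 + z * bromwich ξ ^ (-α : ℂ)) ^ 2) ^ 2) with hF'
  have hne : ∀ z ∈ U, ∀ ξ, 1 + z * bromwich ξ ^ (-α : ℂ) ≠ 0 := fun z hz ξ h => by
    have := hUd z hz ξ
    rw [h, norm_zero] at this
    linarith
  set R := ‖z₀‖ + 1
  set C := β / d ^ 2 + (α * (1 + R) ^ 2 + α * R * (2 * (1 + R))) / (d ^ 2) ^ 2 with hC
  have hInt : Integrable fun ξ : ℝ => Real.exp 1 * ‖bromwich ξ‖ ^ (-(β + 1)) :=
    (integrable_norm_bromwich_rpow (by linarith)).const_mul _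
  have hw := norm_bromwich_cpow_neg_le_one (zero_lt_one.trans hα)
  have h := hasDerivAt_integral_of_dominated_loc_of_deriv_le (μ := volume) (𝕜 := ℂ)
    (F := fun z ξ => mlIntegrand α β z ξ) (F' := F') (x₀ := z₀) (s := U ∩ Metric.ball z₀ 1)
    (bound := fun ξ => (Real.exp 1 * ‖bromwich ξ‖ ^ (-(β + 1))) * C)
    (inter_mem (hU.mem_nhds hz₀) (Metric.ball_mem_nhds _ one_pos))
    ?_ ?_ ?_ ?_ (hInt.mul_const _) ?_
  · exact h.2.differentiableAt
  · filter_upwards [hU.mem_nhds hz₀] with z hz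
    exact (continuous_mlIntegrand (hne z hz)).aestronglyMeasurable
  · refine (hInt.mul_const (β / d + α * ‖z₀‖ / d ^ 2)).mono'
      (continuous_mlIntegrand (hne z₀ hz₀)).aestronglyMeasurable (ae_of_all _ fun ξ => ?_)
    rw [mlIntegrand, norm_mul, norm_exp_mul_bromwich_cpow]
    refine mul_le_mul_of_nonneg_left ?_ (by positivity)
    refine (norm_sub_le _ _).trans ?_
    simp only [norm_div, norm_mul, norm_pow, Complex.norm_real, Real.norm_eq_abs, abs_of_pos hβ,
      abs_of_pos (zero_lt_one.trans hα)]
    have := hUd z₀ hz₀ ξ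
    have hw := hw ξ
    gcongr
    exact mul_le_of_le_one_right (norm_nonneg _) hw
  · refine Continuous.aestronglyMeasurable ?_
    have h1 := continuous_bromwich_cpow (-α : ℂ)
    have h2 := continuous_bromwich_cpow (-(β + 1 : ℂ))
    have h3 : Continuous fun ξ => 1 + z₀ * bromwich ξ ^ (-α : ℂ) := by fun_prop
    refine ((Complex.continuous_exp.comp continuous_bromwich).mul h2).mul ?_
    refine Continuous.sub (Continuous.div (by fun_prop) (by fun_prop) fun ξ => ?_)
      (Continuous.div (by fun_prop) (by fun_prop) fun ξ => ?_)
    · exact pow_ne_zero _ (hne z₀ hz₀ ξ)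
    · exact pow_ne_zero _ (pow_ne_zero _ (hne z₀ hz₀ ξ))
  · refine ae_of_all _ fun ξ z hz => ?_
    rw [hF']
    simp only
    rw [norm_mul, norm_exp_mul_bromwich_cpow]
    refine mul_le_mul_of_nonneg_left ?_ (by positivity)
    have h1 := hUd z hz.1 ξ
    have h2 : ‖z‖ ≤ R := by
      have := hz.2
      rw [Metric.mem_ball, dist_eq_norm] at this
      have := norm_le_norm_add_norm_sub' z z₀
      simp only [R]
      linarith
    have h3 : ‖1 + z * bromwich ξ ^ (-α : ℂ)‖ ≤ 1 + R := by
      refine (norm_add_le _ _).trans ?_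
      rw [norm_one, norm_mul]
      have := mul_le_mul h2 (hw ξ) (norm_nonneg _) (by positivity)
      linarith
    refine (norm_sub_le _ _).trans ?_
    rw [hC]
    refine add_le_add ?_ ?_
    · rw [norm_div, norm_mul, norm_neg, norm_pow, Complex.norm_real, Real.norm_of_nonneg hβ.le]
      gcongr
      exact mul_le_of_le_one_right hβ.le (hw ξ)
    · rw [norm_div, norm_pow, norm_pow]
      gcongr
      refine (norm_sub_le _ _).trans ?_
      simp only [norm_mul, norm_pow, Complex.norm_real, Real.norm_eq_abs,
        abs_of_pos (zero_lt_one.trans hα), Complex.norm_ofNat]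
      have hw := hw ξ
      have h5 : α * ‖bromwich ξ ^ (-α : ℂ)‖ ≤ α := mul_le_of_le_one_right (by positivity) hw
      have h6 : ‖z‖ * ‖bromwich ξ ^ (-α : ℂ)‖ ≤ R := by
        have := mul_le_mul h2 hw (norm_nonneg _) (by positivity)
        linarith
      have h7 : 2 * ‖1 + z * bromwich ξ ^ (-α : ℂ)‖ * ‖bromwich ξ ^ (-α : ℂ)‖ ≤ 2 * (1 + R) := by
        have := mul_le_mul h3 hw (norm_nonneg _) (by positivity)
        linarith
      gcongr
  · refine ae_of_all _ fun ξ z hz => ?_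
    have hd1 : HasDerivAt (fun z : ℂ => z * bromwich ξ ^ (-α : ℂ)) (bromwich ξ ^ (-α : ℂ)) z := by
      simpa using (hasDerivAt_id z).mul_const (bromwich ξ ^ (-α : ℂ))
    have hd2 := hd1.const_add 1
    have hd3 := hd2.pow 2
    have hd4 := (hasDerivAt_const z (β : ℂ)).div hd2 (hne z hz.1 ξ)
    have hd5 := (hd1.const_mul (α : ℂ)).div hd3 (pow_ne_zero _ (hne z hz.1 ξ))
    refine ((hd4.sub hd5).const_mul
      (Complex.exp (bromwich ξ) * bromwich ξ ^ (-(β + 1 : ℂ)))).congr_deriv ?_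
    rw [hF']
    push_cast
    simp only [Pi.pow_apply]
    ring

lemma differentiable_tsum_pow_div_Gamma (hα : 1 < α) (hβ : 0 < β) :
    Differentiable ℂ fun z : ℂ => ∑' k : ℕ, (-z) ^ k / (Real.Gamma (α * k + β) : ℂ) := by
  intro z₀
  have h := Complex.differentiableOn_tsum_of_summable_norm
    (summable_pow_div_Gamma hα hβ (‖z₀‖ + 1)) (U := Metric.ball z₀ 1)
    (F := fun (k : ℕ) (z : ℂ) => (-z) ^ k / (Real.Gamma (α * k + β) : ℂ))
    (fun k => (by fun_prop)) Metric.isOpen_ball fun k z hz => ?_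
  · exact h.differentiableAt (Metric.ball_mem_nhds _ one_pos)
  · have hΓ := Real.Gamma_pos_of_pos (show 0 < α * k + β by positivity)
    rw [norm_div, norm_pow, norm_neg, Complex.norm_real, Real.norm_of_nonneg hΓ.le]
    have h2 : ‖z‖ ≤ |‖z₀‖ + 1| := by
      rw [Metric.mem_ball, dist_eq_norm] at hz
      have := norm_le_norm_add_norm_sub' z z₀
      refine le_trans ?_ (le_abs_self _)
      linarith
    gcongr

/-- The integral representation of the Mittag-Leffler function on the negative half-line. -/
lemma integral_mlIntegrand (hα : 1 < α) (hα2 : α < 2) (hβ : 0 < β) {x : ℝ} (hx : 0 ≤ x) :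
    ∫ ξ, mlIntegrand α β x ξ = (mittagLeffler α β (-x) : ℂ) := by
  obtain ⟨c, hc, hcb⟩ := exists_le_norm_one_add_mul hα hα2
  -- Within c/2 of the half-axis the sector estimate keeps the denominators above c/2, so both sides
  -- are holomorphic there. The neighbourhood is convex, and near 0 the power series gives equality.
  set ray : Set ℂ := Complex.ofReal '' Ici 0
  set U := Metric.thickening (c / 2) ray with hU
  have hUd : ∀ z ∈ U, ∀ ξ, c / 2 ≤ ‖1 + z * bromwich ξ ^ (-α : ℂ)‖ := by
    intro z hz ξ
    rw [hU, Metric.mem_thickening_iff] at hz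
    obtain ⟨_, ⟨x₀, hx₀, rfl⟩, hzx⟩ := hz
    have h1 := hcb ξ x₀ hx₀
    have h2 : c ≤ ‖1 + x₀ * bromwich ξ ^ (-α : ℂ)‖ := by
      refine le_trans ?_ h1
      have h0 : (0 : ℝ) ≤ x₀ := hx₀
      exact le_mul_of_one_le_right hc.le (by linarith [mul_nonneg h0 (norm_nonneg
        (bromwich ξ ^ (-α : ℂ)))])
    have h3 : ‖(1 + z * bromwich ξ ^ (-α : ℂ)) - (1 + x₀ * bromwich ξ ^ (-α : ℂ))‖ ≤ c / 2 := by
      rw [add_sub_add_left_eq_sub, ← sub_mul, norm_mul, ← dist_eq_norm]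
      exact (mul_le_of_le_one_right dist_nonneg
        (norm_bromwich_cpow_neg_le_one (by linarith) ξ)).trans hzx.le
    have h4 := norm_sub_norm_le (1 + x₀ * bromwich ξ ^ (-α : ℂ)) (1 + z * bromwich ξ ^ (-α : ℂ))
    rw [norm_sub_rev] at h4
    linarith
  have hconv : Convex ℝ U := by
    refine Convex.thickening ?_ _
    exact (convex_Ici (0 : ℝ)).is_linear_image (f := Complex.ofReal)
      ⟨fun a b => Complex.ofReal_add a b, fun a b => by simp⟩
  have hF := (differentiableOn_integral_mlIntegrand hα hβ Metric.isOpen_thickening (half_pos hc)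
    hUd).analyticOnNhd Metric.isOpen_thickening
  have hG := (differentiable_tsum_pow_div_Gamma hα hβ).differentiableOn.analyticOnNhd
    (s := U) Metric.isOpen_thickening
  have h0 : (0 : ℂ) ∈ U := Metric.self_subset_thickening (half_pos hc) _ ⟨0, by simp, by simp⟩
  have hxU : (x : ℂ) ∈ U := Metric.self_subset_thickening (half_pos hc) _ ⟨x, hx, rfl⟩
  have heq := hF.eqOn_of_preconnected_of_eventuallyEq hG hconv.isPreconnected h0 (by
    filter_upwards [Metric.ball_mem_nhds (0 : ℂ) one_pos] with z hz
    rw [mem_ball_zero_iff] at hz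
    exact (hasSum_mlIntegrand hα hβ hz).tsum_eq.symm) hxU
  refine heq.trans ?_
  rw [mittagLeffler, Complex.ofReal_tsum]
  push_cast
  rfl

/-- Decay of the Mittag-Leffler function on the negative half-line. -/
theorem exists_rpow_mul_abs_mittagLeffler_le (hα : 1 < α) (hα2 : α < 2) (hβ : 0 < β) {θ : ℝ}
    (hθ0 : 0 ≤ θ) (hθ1 : θ ≤ 1) (hθ : α * θ < β) :
    ∃ C : ℝ, 0 < C ∧ ∀ x : ℝ, 0 ≤ x → x ^ θ * |mittagLeffler α β (-x)| ≤ C := by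
  obtain ⟨c, hc, hcb⟩ := exists_le_norm_one_add_mul hα hα2
  -- With ρ = x|s|^(-α) one has x^θ = ρ^θ |s|^(αθ) and ρ^θ ≤ 1 + ρ, while the bracket of
  -- `mlIntegrand` is O(1/(1+ρ)). The integrand is therefore O(|s|^(-(β+1-αθ))) uniformly in x,
  -- which is integrable exactly when αθ < β.
  have hI := integrable_norm_bromwich_rpow (b := β + 1 - α * θ) (by linarith)
  set K := Real.exp 1 * (β / c + α / c ^ 2)
  -- The added 1 only makes the constant visibly positive.
  refine ⟨K * ((∫ ξ : ℝ, ‖bromwich ξ‖ ^ (-(β + 1 - α * θ))) + 1), ?_, fun x hx => ?_⟩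
  · have : 0 ≤ ∫ ξ : ℝ, ‖bromwich ξ‖ ^ (-(β + 1 - α * θ)) := by positivity
    positivity
  have h1 : |mittagLeffler α β (-x)| = ‖∫ ξ, mlIntegrand α β x ξ‖ := by
    rw [integral_mlIntegrand hα hα2 hβ hx, Complex.norm_real, Real.norm_eq_abs]
  rw [h1, ← Real.norm_of_nonneg (Real.rpow_nonneg hx θ), ← norm_smul, ← integral_smul]
  refine (norm_integral_le_of_norm_le (hI.const_mul K) (ae_of_all _ fun ξ => ?_)).trans ?_
  · have hρ := hcb ξ x hx
    have hw : ‖bromwich ξ ^ (-α : ℂ)‖ = ‖bromwich ξ‖ ^ (-α) := by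
      rw [← Complex.ofReal_neg, norm_bromwich_cpow]
    set ρ := x * ‖bromwich ξ ^ (-α : ℂ)‖ with hρd
    have hρ0 : 0 ≤ ρ := by positivity
    have hs : 0 < ‖bromwich ξ‖ := by linarith [one_le_norm_bromwich ξ]
    have hxθ : x ^ θ = ρ ^ θ * ‖bromwich ξ‖ ^ (α * θ) := by
      rw [hρd, hw, Real.mul_rpow hx (by positivity), ← Real.rpow_mul hs.le, mul_assoc,
        ← Real.rpow_add hs]
      simp
    have hρθ : ρ ^ θ ≤ 1 + ρ := by
      rcases le_total ρ 1 with h | h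
      · have := Real.rpow_le_one hρ0 h hθ0
        linarith
      · have := Real.rpow_le_rpow_of_exponent_le h hθ1
        rw [Real.rpow_one] at this
        linarith
    have hmain : ‖(β : ℂ) / (1 + x * bromwich ξ ^ (-α : ℂ)) -
        α * (x * bromwich ξ ^ (-α : ℂ)) / (1 + x * bromwich ξ ^ (-α : ℂ)) ^ 2‖ ≤
        (β / c + α / c ^ 2) / (1 + ρ) := by
      refine (norm_sub_le _ _).trans ?_
      simp only [norm_div, norm_mul, norm_pow, Complex.norm_real, Real.norm_eq_abs, abs_of_pos hβ,
        abs_of_pos (zero_lt_one.trans hα), abs_of_nonneg hx, ← hρd]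
      have e1 : β / ‖1 + (x : ℂ) * bromwich ξ ^ (-α : ℂ)‖ ≤ β / (c * (1 + ρ)) := by gcongr
      have e2 : α * ρ / ‖1 + (x : ℂ) * bromwich ξ ^ (-α : ℂ)‖ ^ 2 ≤
        α * (1 + ρ) / (c * (1 + ρ)) ^ 2 := by gcongr; linarith
      refine (add_le_add e1 e2).trans (le_of_eq ?_)
      field_simp
    rw [norm_smul, Real.norm_of_nonneg (Real.rpow_nonneg hx θ), mlIntegrand, norm_mul,
      norm_exp_mul_bromwich_cpow, hxθ]
    calc ρ ^ θ * ‖bromwich ξ‖ ^ (α * θ) * (Real.exp 1 * ‖bromwich ξ‖ ^ (-(β + 1)) * _)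
        ≤ (1 + ρ) * ‖bromwich ξ‖ ^ (α * θ) * (Real.exp 1 * ‖bromwich ξ‖ ^ (-(β + 1)) *
          ((β / c + α / c ^ 2) / (1 + ρ))) := by gcongr
      _ = K * (‖bromwich ξ‖ ^ (α * θ) * ‖bromwich ξ‖ ^ (-(β + 1))) := by
          simp only [K]; field_simp
      _ = K * ‖bromwich ξ‖ ^ (-(β + 1 - α * θ)) := by
          rw [← Real.rpow_add hs]; congr 2; ring
  · rw [integral_const_mul]
    have hK : 0 < K := by positivity
    linarith

end Bound

end FracWave

/-! ### Causal convolutions, operator-valued and scalar. -/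

namespace FracWave

section Conv

variable {E G : Type*} [NormedAddCommGroup E] [NormedSpace ℝ E] [NormedAddCommGroup G]
  [NormedSpace ℝ G]

/-- The causal convolution of an operator-valued kernel with a function. -/
noncomputable def opConv (K : ℝ → E →L[ℝ] G) (F : ℝ → E) (t : ℝ) : G :=
  ∫ τ in (0 : ℝ)..t, K (t - τ) (F τ)

/-- A strongly continuous operator-valued kernel on `(0, ∞)` with an integrable majorant. -/
structure IsConvKernel (T : ℝ) (K : ℝ → E →L[ℝ] G) (k : ℝ → ℝ) : Prop where
  continuousOn_bound : ContinuousOn k (Ioi 0)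
  integrable : IntervalIntegrable k volume 0 T
  norm_le : ∀ τ ∈ Ioc 0 T, ‖K τ‖ ≤ k τ
  continuousOn : ∀ x, ContinuousOn (fun τ => K τ x) (Ioi 0)

variable {T : ℝ} {K : ℝ → E →L[ℝ] G} {k : ℝ → ℝ} {F : ℝ → E}

lemma IsConvKernel.mono {T' : ℝ} (hK : IsConvKernel T K k) (h0 : 0 ≤ T') (h : T' ≤ T) :
    IsConvKernel T' K k :=
  ⟨hK.1, hK.2.mono_set (by rw [uIcc_of_le h0, uIcc_of_le (h0.trans h)]; exact Icc_subset_Icc_right h),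
    fun τ hτ => hK.3 τ ⟨hτ.1, hτ.2.trans h⟩, hK.4⟩

/-- Strong continuity together with the locally bounded majorant k yields joint continuity of (τ, x)
↦ K τ x. -/
lemma IsConvKernel.continuousWithinAt (hK : IsConvKernel T K k) {f : ℝ → ℝ} {g : ℝ → E} {s : Set ℝ}
    {x : ℝ} (hf : ContinuousWithinAt f s x) (hfs : ∀ᶠ y in 𝓝[s] x, f y ∈ Ioc 0 T)
    (hfx : f x ∈ Ioc 0 T) (hg : ContinuousWithinAt g s x) :
    ContinuousWithinAt (fun y => K (f y) (g y)) s x := by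
  have h1 : Tendsto (fun y => k (f y) * ‖g y - g x‖ + ‖K (f y) (g x) - K (f x) (g x)‖)
      (𝓝[s] x) (𝓝 (k (f x) * ‖g x - g x‖ + ‖K (f x) (g x) - K (f x) (g x)‖)) := by
    have hk : Tendsto (fun y => k (f y)) (𝓝[s] x) (𝓝 (k (f x))) :=
      ((hK.1.continuousAt (Ioi_mem_nhds hfx.1)).tendsto).comp hf
    have hK' : Tendsto (fun y => K (f y) (g x)) (𝓝[s] x) (𝓝 (K (f x) (g x))) :=
      (((hK.4 (g x)).continuousAt (Ioi_mem_nhds hfx.1)).tendsto).comp hf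
    exact (hk.mul (hg.sub_const _).norm).add (hK'.sub_const _).norm
  simp only [sub_self, norm_zero, mul_zero, add_zero] at h1
  refine tendsto_iff_norm_sub_tendsto_zero.2 (squeeze_zero' (Eventually.of_forall fun _ =>
    norm_nonneg _) ?_ h1)
  filter_upwards [hfs] with y hy
  have : K (f y) (g y) - K (f x) (g x) = K (f y) (g y - g x) + (K (f y) (g x) - K (f x) (g x)) := by
    rw [map_sub]; abel
  rw [this]
  refine (norm_add_le _ _).trans (add_le_add_left ?_ _)
  exact (ContinuousLinearMap.le_opNorm _ _).trans
    (mul_le_mul_of_nonneg_right (hK.3 _ hy) (norm_nonneg _))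

lemma IsConvKernel.integrableOn (hK : IsConvKernel T K k) (hF : ContinuousOn F (Icc 0 T))
    {t : ℝ} (ht : t ∈ Icc 0 T) :
    IntegrableOn (fun τ => K τ (F (t - τ))) (Ioo 0 t) := by
  obtain ⟨M, hM⟩ := isCompact_Icc.exists_bound_of_continuousOn hF
  have hk : IntegrableOn k (Ioo 0 t) := by
    have := (intervalIntegrable_iff_integrableOn_Ioo_of_le (ht.1.trans ht.2)).1 hK.2
    exact this.mono_set (Ioo_subset_Ioo_right ht.2)
  refine (hk.mul_const M).mono' ?_ ?_
  · refine ContinuousOn.aestronglyMeasurable (fun τ hτ => ?_) measurableSet_Ioo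
    refine hK.continuousWithinAt (f := fun τ => τ) continuousWithinAt_id ?_ ⟨hτ.1, hτ.2.le.trans ht.2⟩ ?_
    · filter_upwards [self_mem_nhdsWithin] with y hy using ⟨hy.1, hy.2.le.trans ht.2⟩
    · refine (hF (t - τ) ⟨by linarith [hτ.2], by linarith [hτ.1, ht.2]⟩).comp
        (by fun_prop) fun y hy => ⟨by linarith [hy.2], by linarith [hy.1, ht.2]⟩
  · filter_upwards [ae_restrict_mem measurableSet_Ioo] with τ hτ
    refine (ContinuousLinearMap.le_opNorm _ _).trans ?_
    have h1 := hK.3 τ ⟨hτ.1, hτ.2.le.trans ht.2⟩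
    exact mul_le_mul h1 (hM _ ⟨by linarith [hτ.2], by linarith [hτ.1, ht.2]⟩)
      (norm_nonneg _) ((norm_nonneg _).trans h1)

lemma IsConvKernel.intervalIntegrable (hK : IsConvKernel T K k) (hF : ContinuousOn F (Icc 0 T))
    {t : ℝ} (ht : t ∈ Icc 0 T) :
    IntervalIntegrable (fun τ => K (t - τ) (F τ)) volume 0 t := by
  have h := (intervalIntegrable_iff_integrableOn_Ioo_of_le ht.1).2 (hK.integrableOn hF ht)
  have h2 := h.comp_sub_left t
  simp only [sub_zero, sub_self, sub_sub_cancel] at h2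
  exact h2.symm

lemma opConv_eq (K : ℝ → E →L[ℝ] G) (F : ℝ → E) (t : ℝ) :
    opConv K F t = ∫ τ in (0 : ℝ)..t, K τ (F (t - τ)) := by
  have := intervalIntegral.integral_comp_sub_left (a := 0) (b := t) (fun τ => K τ (F (t - τ))) t
  simp only [sub_sub_cancel, sub_zero, sub_self] at this
  exact this

/-- In the form ∫ K(τ) F(t-τ) dτ the singular factor does not depend on t. Extended by zero, the
integrand is dominated by M k(τ) and continuous in t at t₀ except for τ = t₀, so dominated
convergence applies. -/
lemma IsConvKernel.continuousOn_opConv (hK : IsConvKernel T K k) (hF : ContinuousOn F (Icc 0 T)) :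
    ContinuousOn (opConv K F) (Icc 0 T) := by
  intro t₀ ht₀
  have hT : 0 ≤ T := ht₀.1.trans ht₀.2
  obtain ⟨M, hM⟩ := isCompact_Icc.exists_bound_of_continuousOn hF
  have hM0 : 0 ≤ M := (norm_nonneg _).trans (hM 0 ⟨le_rfl, hT⟩)
  set Gf : ℝ → ℝ → G := fun t => (Ioo 0 t).indicator fun τ => K τ (F (t - τ)) with hGf
  have hk : IntegrableOn k (Ioo 0 T) :=
    (intervalIntegrable_iff_integrableOn_Ioo_of_le hT).1 hK.2
  have heq : ∀ t ∈ Icc 0 T, opConv K F t = ∫ τ in Ioo 0 T, Gf t τ := by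
    intro t ht
    rw [opConv_eq, intervalIntegral.integral_of_le ht.1, integral_Ioc_eq_integral_Ioo, hGf,
      setIntegral_indicator measurableSet_Ioo, inter_eq_self_of_subset_right
      (Ioo_subset_Ioo_right ht.2)]
  refine ContinuousWithinAt.congr ?_ heq (heq t₀ ht₀)
  refine continuousWithinAt_of_dominated (bound := fun τ => k τ * M) ?_ ?_ (hk.mul_const M) ?_
  · filter_upwards [self_mem_nhdsWithin] with t ht
    exact ((integrable_indicator_iff measurableSet_Ioo).2
      (hK.integrableOn hF ht)).aestronglyMeasurable.restrict
  · filter_upwards [self_mem_nhdsWithin] with t ht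
    filter_upwards [ae_restrict_mem measurableSet_Ioo] with τ hτ
    have h1 := hK.3 τ ⟨hτ.1, hτ.2.le⟩
    rw [hGf]
    by_cases h : τ ∈ Ioo 0 t
    · simp only [indicator_of_mem h]
      refine (ContinuousLinearMap.le_opNorm _ _).trans ?_
      exact mul_le_mul h1 (hM _ ⟨by linarith [h.2], by linarith [hτ.1, ht.2]⟩)
        (norm_nonneg _) ((norm_nonneg _).trans h1)
    · simp only [indicator_of_notMem h, norm_zero]
      exact mul_nonneg ((norm_nonneg _).trans h1) hM0
  · have hne : ∀ᵐ τ ∂(volume.restrict (Ioo 0 T)), τ ≠ t₀ :=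
      ae_restrict_of_ae (Measure.ae_ne volume t₀)
    filter_upwards [ae_restrict_mem measurableSet_Ioo, hne] with τ hτ hτ0
    rcases lt_or_gt_of_ne hτ0 with h | h
    · have hmem : ∀ᶠ t in 𝓝[Icc 0 T] t₀, τ < t :=
        nhdsWithin_le_nhds (Ioi_mem_nhds h)
      refine ContinuousWithinAt.congr_of_eventuallyEq (f := fun t => K τ (F (t - τ))) ?_ ?_ ?_
      · refine (K τ).continuous.continuousAt.comp_continuousWithinAt ?_
        have h3 : ContinuousWithinAt F (Icc 0 T) (t₀ - τ) :=
          hF _ ⟨by linarith, by linarith [hτ.1, ht₀.2]⟩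
        refine Tendsto.comp h3 (tendsto_nhdsWithin_iff.2 ⟨?_, ?_⟩)
        · exact ((continuous_id.sub continuous_const).tendsto t₀).mono_left nhdsWithin_le_nhds
        · filter_upwards [hmem, self_mem_nhdsWithin] with t ht ht'
          exact ⟨by simp; linarith, by simp; linarith [hτ.1, ht'.2]⟩
      · filter_upwards [hmem] with t ht
        exact indicator_of_mem (s := Ioo 0 t) (show τ ∈ Ioo 0 t from ⟨hτ.1, ht⟩) _
      · exact indicator_of_mem (s := Ioo 0 t₀) (show τ ∈ Ioo 0 t₀ from ⟨hτ.1, h⟩) _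
    · refine ContinuousWithinAt.congr_of_eventuallyEq (f := fun _ => 0) continuousWithinAt_const ?_ ?_
      · filter_upwards [nhdsWithin_le_nhds (Iio_mem_nhds h)] with t ht
        exact indicator_of_notMem (fun h' => absurd h'.2 (not_lt.2 (le_of_lt ht))) _
      · exact indicator_of_notMem (fun h' => absurd h'.2 (not_lt.2 h.le)) _

lemma IsConvKernel.norm_opConv_le (hK : IsConvKernel T K k) {M : ℝ} {t : ℝ} (ht : t ∈ Icc 0 T)
    (hM : ∀ τ ∈ Icc 0 t, ‖F τ‖ ≤ M) : ‖opConv K F t‖ ≤ (∫ τ in (0 : ℝ)..t, k τ) * M := by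
  rw [opConv_eq, ← intervalIntegral.integral_mul_const]
  refine intervalIntegral.norm_integral_le_of_norm_le ht.1 (ae_of_all _ fun τ hτ => ?_) ?_
  · have h1 := hK.3 τ ⟨hτ.1, hτ.2.trans ht.2⟩
    refine (ContinuousLinearMap.le_opNorm _ _).trans ?_
    exact mul_le_mul h1 (hM _ ⟨by linarith [hτ.2], by linarith [hτ.1]⟩)
      (norm_nonneg _) ((norm_nonneg _).trans h1)
  · exact (hK.mono ht.1 ht.2).2.mul_const M

lemma IsConvKernel.map_opConv {G' : Type*} [NormedAddCommGroup G'] [NormedSpace ℝ G']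
    [CompleteSpace G] [CompleteSpace G']
    (hK : IsConvKernel T K k) (hF : ContinuousOn F (Icc 0 T)) {t : ℝ} (ht : t ∈ Icc 0 T)
    (L : G →L[ℝ] G') : L (opConv K F t) = ∫ τ in (0 : ℝ)..t, L (K (t - τ) (F τ)) :=
  (L.intervalIntegral_comp_comm (hK.intervalIntegrable hF ht)).symm

end Conv

/-- The causal convolution of two real functions. -/
noncomputable def conv (a b : ℝ → ℝ) (t : ℝ) : ℝ := ∫ τ in (0 : ℝ)..t, a (t - τ) * b τ

section ScalarConv

variable {T : ℝ} {a b c : ℝ → ℝ}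

lemma conv_comm (a b : ℝ → ℝ) (t : ℝ) : conv a b t = conv b a t := by
  have := intervalIntegral.integral_comp_sub_left (a := 0) (b := t) (fun τ => a τ * b (t - τ)) t
  simp only [sub_sub_cancel, sub_zero, sub_self] at this
  rw [conv, conv, this]
  simp_rw [mul_comm (a _)]

lemma conv_congr {a' b' : ℝ → ℝ} {t : ℝ} (ht : 0 ≤ t) (ha : ∀ τ ∈ Ioo 0 t, a τ = a' τ)
    (hb : ∀ τ ∈ Ioo 0 t, b τ = b' τ) : conv a b t = conv a' b' t := by
  rw [conv, conv, intervalIntegral.integral_of_le ht, intervalIntegral.integral_of_le ht,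
    integral_Ioc_eq_integral_Ioo, integral_Ioc_eq_integral_Ioo]
  refine setIntegral_congr_fun measurableSet_Ioo fun τ hτ => ?_
  rw [ha _ ⟨by linarith [hτ.2], by linarith [hτ.1]⟩, hb _ hτ]

lemma isConvKernel_lsmul (hc : ContinuousOn a (Ioi 0)) (hi : IntervalIntegrable a volume 0 T) :
    IsConvKernel T (fun τ => ContinuousLinearMap.lsmul ℝ ℝ (E := ℝ) (a τ)) (fun τ => |a τ|) where
  continuousOn_bound := hc.abs
  integrable := hi.norm
  norm_le τ _ := by
    refine ContinuousLinearMap.opNorm_le_bound _ (abs_nonneg _) fun x => ?_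
    simp
  continuousOn x := by exact hc.mul continuousOn_const

lemma opConv_lsmul (a b : ℝ → ℝ) (t : ℝ) :
    opConv (fun τ => ContinuousLinearMap.lsmul ℝ ℝ (E := ℝ) (a τ)) b t = conv a b t := by
  simp [opConv, conv]

lemma continuousOn_conv (hc : ContinuousOn a (Ioi 0)) (hi : IntervalIntegrable a volume 0 T)
    (hb : ContinuousOn b (Icc 0 T)) : ContinuousOn (conv a b) (Icc 0 T) := by
  have := (isConvKernel_lsmul hc hi).continuousOn_opConv hb
  exact this.congr fun t _ => (opConv_lsmul a b t).symm

lemma intervalIntegrable_conv (hc : ContinuousOn a (Ioi 0)) (hi : IntervalIntegrable a volume 0 T)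
    (hb : ContinuousOn b (Icc 0 T)) {t : ℝ} (ht : t ∈ Icc 0 T) :
    IntervalIntegrable (fun τ => a (t - τ) * b τ) volume 0 t := by
  simpa using (isConvKernel_lsmul hc hi).intervalIntegrable hb ht

lemma conv_add_right {b' : ℝ → ℝ} (hc : ContinuousOn a (Ioi 0))
    (hi : IntervalIntegrable a volume 0 T)
    (hb : ContinuousOn b (Icc 0 T)) (hb' : ContinuousOn b' (Icc 0 T)) {t : ℝ} (ht : t ∈ Icc 0 T) :
    conv a (fun s => b s + b' s) t = conv a b t + conv a b' t := by
  rw [conv, conv, conv, ← intervalIntegral.integral_add (intervalIntegrable_conv hc hi hb ht)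
    (intervalIntegrable_conv hc hi hb' ht)]
  simp_rw [mul_add]

lemma conv_const_mul_right (a b : ℝ → ℝ) (r t : ℝ) :
    conv a (fun s => r * b s) t = r * conv a b t := by
  rw [conv, conv, ← intervalIntegral.integral_const_mul]
  simp_rw [mul_left_comm]

lemma convolution_eq_conv {A B : ℝ → ℝ} (hA : ∀ t ≤ 0, A t = 0) (hB : ∀ t ≤ 0, B t = 0) {t : ℝ}
    (ht : 0 ≤ t) : convolution A B (ContinuousLinearMap.mul ℝ ℝ) volume t = conv A B t := by
  rw [conv_comm, conv, convolution_def, intervalIntegral.integral_of_le ht,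
    ← integral_indicator measurableSet_Ioc]
  congr 1
  ext τ
  by_cases h : τ ∈ Ioc 0 t
  · rw [indicator_of_mem h, ContinuousLinearMap.mul_apply', mul_comm]
  · rw [indicator_of_notMem h, ContinuousLinearMap.mul_apply']
    rcases le_or_gt τ 0 with h1 | h1
    · rw [hA _ h1, zero_mul]
    · rw [hB (t - τ) (by by_contra h2; exact h ⟨h1, by linarith⟩), mul_zero]

lemma convolution_eq_zero {A B : ℝ → ℝ} (hA : ∀ t ≤ 0, A t = 0) (hB : ∀ t ≤ 0, B t = 0) {t : ℝ}
    (ht : t ≤ 0) : convolution A B (ContinuousLinearMap.mul ℝ ℝ) volume t = 0 := by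
  rw [convolution_def, ← integral_zero (μ := volume) (α := ℝ) (G := ℝ)]
  congr 1
  ext τ
  rw [ContinuousLinearMap.mul_apply']
  rcases le_or_gt τ 0 with h1 | h1
  · rw [hA _ h1, zero_mul]
  · rw [hB (t - τ) (by linarith), mul_zero]

/-- Associativity of the causal convolution of two integrable functions and a bounded one. -/
lemma conv_assoc (ha : IntervalIntegrable a volume 0 T) (hb : IntervalIntegrable b volume 0 T)
    (hc : ContinuousOn c (Icc 0 T)) {t : ℝ} (ht : t ∈ Icc 0 T) :
    conv (conv a b) c t = conv a (conv b c) t := by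
  have hT : 0 ≤ T := ht.1.trans ht.2
  obtain ⟨M, hM⟩ := isCompact_Icc.exists_bound_of_continuousOn hc
  have hM0 : 0 ≤ M := (norm_nonneg _).trans (hM 0 ⟨le_rfl, hT⟩)
  -- Cut off outside (0, T), the functions are integrable on ℝ and vanish for t ≤ 0, so causal and
  -- full-line convolutions agree. Boundedness of c makes the triple integral converge at every t
  -- rather than almost every t.
  set A := (Ioo 0 T).indicator a
  set B := (Ioo 0 T).indicator b
  set C := (Ioo 0 T).indicator c
  have hA0 : ∀ t ≤ 0, A t = 0 := fun t ht => indicator_of_notMem (fun h => absurd h.1 (not_lt.2 ht)) _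
  have hB0 : ∀ t ≤ 0, B t = 0 := fun t ht => indicator_of_notMem (fun h => absurd h.1 (not_lt.2 ht)) _
  have hC0 : ∀ t ≤ 0, C t = 0 := fun t ht => indicator_of_notMem (fun h => absurd h.1 (not_lt.2 ht)) _
  have hA : Integrable A := (integrable_indicator_iff measurableSet_Ioo).2
    ((intervalIntegrable_iff_integrableOn_Ioo_of_le hT).1 ha)
  have hB : Integrable B := (integrable_indicator_iff measurableSet_Ioo).2
    ((intervalIntegrable_iff_integrableOn_Ioo_of_le hT).1 hb)
  have hC : Integrable C := (integrable_indicator_iff measurableSet_Ioo).2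
    ((hc.integrableOn_Icc).mono_set Ioo_subset_Icc_self)
  have hCb : ∀ x, ‖C x‖ ≤ M := by
    intro x
    by_cases h : x ∈ Ioo 0 T
    · simp only [C, indicator_of_mem h]; exact hM _ (Ioo_subset_Icc_self h)
    · simp only [C, indicator_of_notMem h, norm_zero]; exact hM0
  have hassoc := convolution_assoc (ContinuousLinearMap.mul ℝ ℝ) (ContinuousLinearMap.mul ℝ ℝ)
    (ContinuousLinearMap.mul ℝ ℝ) (ContinuousLinearMap.mul ℝ ℝ) (μ := volume) (ν := volume)
    (f := A) (g := B) (k := C) (x₀ := t) (fun x y z => by simp [mul_assoc]) hA.1 hB.1 hC.1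
    (hA.ae_convolution_exists _ hB) (hB.norm.ae_convolution_exists _ hC.norm) (by
      have hm := hB.norm.integrable_convolution (ContinuousLinearMap.mul ℝ ℝ) hC.norm
      refine (hA.norm.mul_const ((∫ x, ‖B x‖) * M)).mono' ?_ (ae_of_all _ fun τ => ?_)
      · exact hA.norm.1.mul (hm.1.comp_quasiMeasurePreserving
          (quasiMeasurePreserving_sub_left _ t))
      · rw [ContinuousLinearMap.mul_apply', norm_mul, norm_norm]
        refine mul_le_mul_of_nonneg_left ?_ (norm_nonneg _)
        rw [convolution_def, ← integral_mul_const]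
        refine norm_integral_le_of_norm_le (hB.norm.mul_const M) (ae_of_all _ fun σ => ?_)
        rw [ContinuousLinearMap.mul_apply', norm_mul, norm_norm, norm_norm]
        exact mul_le_mul_of_nonneg_left (hCb _) (norm_nonneg _))
  rw [convolution_eq_conv (fun s hs => convolution_eq_zero hA0 hB0 hs) hC0 ht.1,
    convolution_eq_conv hA0 (fun s hs => convolution_eq_zero hB0 hC0 hs) ht.1] at hassoc
  have hsub : ∀ s ∈ Ioo 0 t, s ∈ Ioo 0 T := fun s hs => ⟨hs.1, hs.2.trans_le ht.2⟩
  have e1 : conv (conv a b) c t =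
      conv (convolution A B (ContinuousLinearMap.mul ℝ ℝ) volume) C t := by
    refine conv_congr ht.1 (fun s hs => ?_) fun s hs => (indicator_of_mem (hsub s hs) _).symm
    rw [convolution_eq_conv hA0 hB0 hs.1.le]
    refine conv_congr hs.1.le (fun r hr => ?_) fun r hr => ?_ <;>
    exact (indicator_of_mem (hsub r ⟨hr.1, hr.2.trans hs.2⟩) _).symm
  have e2 : conv a (conv b c) t =
      conv A (convolution B C (ContinuousLinearMap.mul ℝ ℝ) volume) t := by
    refine conv_congr ht.1 (fun s hs => (indicator_of_mem (hsub s hs) _).symm) fun s hs => ?_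
    rw [convolution_eq_conv hB0 hC0 hs.1.le]
    refine conv_congr hs.1.le (fun r hr => ?_) fun r hr => ?_ <;>
    exact (indicator_of_mem (hsub r ⟨hr.1, hr.2.trans hs.2⟩) _).symm
  rw [e1, e2, hassoc]

end ScalarConv

end FracWave

/-! ### Mittag-Leffler kernels: the two identities and the uniform bound. -/

namespace FracWave

/-- The kernel `t ^ (β - 1) E_{α,β}(-l t ^ α)`. For `l = 0` this is `t ^ (β - 1) / Γ(β)`. -/
noncomputable def mlKernel (α l β t : ℝ) : ℝ := t ^ (β - 1) * mittagLeffler α β (-l * t ^ α)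

section Kernel

variable {α l β : ℝ}

lemma continuous_mittagLeffler (hα : 1 < α) (hβ : 0 < β) : Continuous (mittagLeffler α β) := by
  have h := (differentiable_tsum_pow_div_Gamma hα hβ).continuous
  have h2 : mittagLeffler α β = fun x : ℝ =>
      (∑' k : ℕ, (-(-(x : ℂ))) ^ k / (Real.Gamma (α * k + β) : ℂ)).re := by
    ext x
    rw [← Complex.ofReal_re (mittagLeffler α β x), mittagLeffler, Complex.ofReal_tsum]
    push_cast
    simp only [neg_neg]
  rw [h2]
  exact Complex.continuous_re.comp (h.comp (by fun_prop : Continuous fun x : ℝ => -(x : ℂ)))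

lemma mittagLeffler_zero (hα : 1 < α) (hβ : 0 < β) : mittagLeffler α β 0 = (Real.Gamma β)⁻¹ := by
  have h := hasSum_mittagLeffler hα hβ 0
  have h2 := hasSum_single (f := fun k : ℕ => (0 : ℝ) ^ k / Real.Gamma (α * k + β)) 0
    fun k hk => by simp [hk]
  simpa using h.unique h2

/-- Split off the term k = 0 of the series and shift the index. -/
lemma mittagLeffler_eq_add (hα : 1 < α) (hβ : 0 < β) (z : ℝ) :
    mittagLeffler α β z = (Real.Gamma β)⁻¹ + z * mittagLeffler α (β + α) z := by
  have h1 := (hasSum_mittagLeffler hα (show 0 < β + α by linarith) z).mul_left z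
  have h2 := hasSum_mittagLeffler hα hβ z
  have h3 := (hasSum_nat_add_iff' 1).2 h2
  simp only [Finset.range_one, Finset.sum_singleton, pow_zero, Nat.cast_zero, mul_zero, zero_add,
    one_div] at h3
  have h4 : (fun k : ℕ => z * (z ^ k / Real.Gamma (α * k + (β + α)))) =
      fun k : ℕ => z ^ (k + 1) / Real.Gamma (α * ((k + 1 : ℕ) : ℝ) + β) := by
    ext k
    rw [pow_succ]
    push_cast
    rw [show α * ((k : ℝ) + 1) + β = α * k + (β + α) by ring]
    ring
  rw [h4] at h1
  have := h1.unique h3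
  linarith

lemma continuousOn_mlKernel (hα : 1 < α) (hβ : 0 < β) : ContinuousOn (mlKernel α l β) (Ioi 0) := by
  have h := continuous_mittagLeffler hα hβ
  refine ContinuousOn.mul (fun t ht => ?_) (h.comp_continuousOn ?_)
  · exact (Real.continuousAt_rpow_const _ _ (Or.inl (ne_of_gt ht))).continuousWithinAt
  · exact (continuous_const.mul (Real.continuous_rpow_const (by linarith))).continuousOn

lemma continuous_mlKernel (hα : 1 < α) (hβ : 1 ≤ β) : Continuous (mlKernel α l β) := by
  have h := continuous_mittagLeffler hα (zero_lt_one.trans_le hβ)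
  exact (Real.continuous_rpow_const (by linarith)).mul
    (h.comp (continuous_const.mul (Real.continuous_rpow_const (by linarith))))

lemma intervalIntegrable_mlKernel (hα : 1 < α) (hβ : 0 < β) (a b : ℝ) :
    IntervalIntegrable (mlKernel α l β) volume a b := by
  have h := continuous_mittagLeffler hα hβ
  refine (intervalIntegral.intervalIntegrable_rpow' (by linarith)).mul_continuousOn ?_
  exact (h.comp (continuous_const.mul (Real.continuous_rpow_const (by linarith)))).continuousOn

lemma mlKernel_zero_left (hα : 1 < α) (hβ : 0 < β) (t : ℝ) :
    mlKernel α 0 β t = t ^ (β - 1) / Real.Gamma β := by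
  rw [mlKernel, neg_zero, zero_mul, mittagLeffler_zero hα hβ, div_eq_mul_inv]

lemma mlKernel_zero_one (hα : 1 < α) (t : ℝ) : mlKernel α 0 1 t = 1 := by
  rw [mlKernel_zero_left hα one_pos]; simp

lemma mlKernel_zero_two (hα : 1 < α) (t : ℝ) : mlKernel α 0 2 t = t := by
  rw [mlKernel_zero_left hα two_pos]
  have : (2 : ℝ) - 1 = 1 := by norm_num
  rw [this, Real.rpow_one, Real.Gamma_two, div_one]

lemma mlKernel_at_zero (hβ : 1 < β) : mlKernel α l β 0 = 0 := by
  rw [mlKernel, Real.zero_rpow (by linarith), zero_mul]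

lemma mlKernel_one_at_zero (hα : 1 < α) : mlKernel α l 1 0 = 1 := by
  rw [mlKernel, Real.zero_rpow (by linarith : α ≠ 0), mul_zero, mittagLeffler_zero hα one_pos]
  simp

/-- The resolvent identity: it trades the index β + α for β at the price of the power kernel g_β.
Together with `conv_mlKernel`, where convolution with g_δ raises the index by δ, it carries the
whole scalar theory. -/
lemma mlKernel_add (hα : 1 < α) (hβ : 0 < β) {t : ℝ} (ht : 0 ≤ t) :
    mlKernel α l β t + l * mlKernel α l (β + α) t = mlKernel α 0 β t := by
  rw [mlKernel_zero_left hα hβ, mlKernel, mlKernel, mittagLeffler_eq_add hα hβ]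
  rcases ht.eq_or_lt with rfl | ht
  · rw [Real.zero_rpow (by linarith : α ≠ 0), Real.zero_rpow (by linarith : β + α - 1 ≠ 0)]
    ring
  · rw [show β + α - 1 = (β - 1) + α by ring, Real.rpow_add ht]
    ring

lemma integral_sub_rpow_mul_rpow {δ : ℝ} (hβ : 0 < β) (hδ : 0 < δ) {t : ℝ} (ht : 0 < t) :
    ∫ τ in (0 : ℝ)..t, (t - τ) ^ (δ - 1) * τ ^ (β - 1) =
      t ^ (β + δ - 1) * (Real.Gamma β * Real.Gamma δ / Real.Gamma (β + δ)) := by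
  have h := Complex.betaIntegral_scaled β δ ht
  rw [Complex.betaIntegral_eq_Gamma_mul_div _ _ (by simpa) (by simpa)] at h
  have h2 : ∫ x in (0 : ℝ)..t, (x : ℂ) ^ ((β : ℂ) - 1) * ((t : ℂ) - x) ^ ((δ : ℂ) - 1) =
      ((∫ τ in (0 : ℝ)..t, (t - τ) ^ (δ - 1) * τ ^ (β - 1) : ℝ) : ℂ) := by
    rw [← intervalIntegral.integral_ofReal]
    refine intervalIntegral.integral_congr fun x hx => ?_
    rw [uIcc_of_le ht.le] at hx
    push_cast
    rw [Complex.ofReal_cpow hx.1, Complex.ofReal_cpow (by linarith [hx.2])]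
    push_cast
    ring
  rw [h2] at h
  rw [← Complex.ofReal_inj, h]
  push_cast
  rw [Complex.ofReal_cpow ht.le, ← Complex.Gamma_ofReal, ← Complex.Gamma_ofReal,
    ← Complex.Gamma_ofReal]
  push_cast
  ring_nf

lemma intervalIntegrable_sub_rpow_mul_rpow {δ : ℝ} (hβ : 0 < β) (hδ : 0 < δ) {t : ℝ} (ht : 0 < t) :
    IntervalIntegrable (fun τ => (t - τ) ^ (δ - 1) * τ ^ (β - 1)) volume 0 t := by
  -- Otherwise the integral would be 0 by convention, whereas its Beta value is positive.
  by_contra h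
  have h1 := integral_sub_rpow_mul_rpow hβ hδ ht
  rw [intervalIntegral.integral_undef h] at h1
  have h2 := Real.Gamma_pos_of_pos hβ
  have h3 := Real.Gamma_pos_of_pos hδ
  have h4 := Real.Gamma_pos_of_pos (add_pos hβ hδ)
  have : 0 < t ^ (β + δ - 1) * (Real.Gamma β * Real.Gamma δ / Real.Gamma (β + δ)) := by positivity
  linarith

/-- A Beta integral for each term of the series. The sum of the L¹ norms is a Mittag-Leffler series
in absolute values, which justifies the exchange of sum and integral. -/
lemma conv_mlKernel {δ : ℝ} (hα : 1 < α) (hβ : 0 < β) (hδ : 0 < δ) {t : ℝ} (ht : 0 < t) :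
    conv (mlKernel α 0 δ) (mlKernel α l β) t = mlKernel α l (β + δ) t := by
  set F : ℕ → ℝ → ℝ := fun k τ => ((-l) ^ k / Real.Gamma (α * k + β) / Real.Gamma δ) *
    ((t - τ) ^ (δ - 1) * τ ^ (α * k + β - 1)) with hF
  have hb : ∀ k : ℕ, 0 < α * k + β := fun k => by positivity
  have hΓ := fun k : ℕ => Real.Gamma_pos_of_pos (hb k)
  have hΓδ := Real.Gamma_pos_of_pos hδ
  have hFi : ∀ k, Integrable (F k) (volume.restrict (Ioc 0 t)) := fun k =>
    (((intervalIntegrable_iff_integrableOn_Ioc_of_le ht.le).1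
      (intervalIntegrable_sub_rpow_mul_rpow (hb k) hδ ht)).const_mul _)
  have hval : ∀ k : ℕ, ∫ τ in Ioc 0 t, (t - τ) ^ (δ - 1) * τ ^ (α * k + β - 1) =
      t ^ (α * k + β + δ - 1) * (Real.Gamma (α * k + β) * Real.Gamma δ /
        Real.Gamma (α * k + β + δ)) := fun k => by
    rw [← intervalIntegral.integral_of_le ht.le]
    exact integral_sub_rpow_mul_rpow (hb k) hδ ht
  have hpow : ∀ k : ℕ, t ^ (α * k + β + δ - 1) = t ^ (β + δ - 1) * (t ^ α) ^ k := fun k => by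
    rw [← Real.rpow_natCast, ← Real.rpow_mul ht.le, ← Real.rpow_add ht]; congr 1; ring
  have hterm : ∀ (k : ℕ) (x : ℝ), (x / Real.Gamma (α * k + β) / Real.Gamma δ) *
      (t ^ (α * k + β + δ - 1) * (Real.Gamma (α * k + β) * Real.Gamma δ /
        Real.Gamma (α * k + β + δ))) =
      t ^ (β + δ - 1) * (x * (t ^ α) ^ k / Real.Gamma (α * k + (β + δ))) := fun k x => by
    have := (hΓ k).ne'
    rw [hpow, add_assoc]
    field_simp
  have hs : Summable fun k => ∫ τ in Ioc 0 t, ‖F k τ‖ := by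
    have h1 : ∀ k, ∫ τ in Ioc 0 t, ‖F k τ‖ = t ^ (β + δ - 1) *
        (|-l * t ^ α| ^ k / Real.Gamma (α * k + (β + δ))) := by
      intro k
      have h2 : ∫ τ in Ioc 0 t, ‖F k τ‖ = ∫ τ in Ioc 0 t,
          (|-l| ^ k / Real.Gamma (α * k + β) / Real.Gamma δ) *
            ((t - τ) ^ (δ - 1) * τ ^ (α * k + β - 1)) := by
        refine setIntegral_congr_fun measurableSet_Ioc fun τ hτ => ?_
        rw [hF]
        simp only
        rw [norm_mul, norm_div, norm_div, norm_pow, Real.norm_eq_abs, Real.norm_eq_abs,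
          Real.norm_eq_abs, Real.norm_eq_abs, abs_of_pos (hΓ k), abs_of_pos hΓδ,
          abs_of_nonneg (mul_nonneg (Real.rpow_nonneg (by linarith [hτ.2]) _)
          (Real.rpow_nonneg hτ.1.le _))]
      rw [h2, integral_const_mul, hval, hterm, ← mul_pow, abs_mul,
        abs_of_pos (Real.rpow_pos_of_pos ht α)]
    simp_rw [h1]
    exact (summable_pow_div_Gamma hα (add_pos hβ hδ) _).mul_left _
  have h := hasSum_integral_of_summable_integral_norm hFi hs
  have h2 : ∀ k, ∫ τ in Ioc 0 t, F k τ = t ^ (β + δ - 1) *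
      ((-l * t ^ α) ^ k / Real.Gamma (α * k + (β + δ))) := by
    intro k
    rw [hF]
    simp only
    rw [integral_const_mul, hval, hterm, ← mul_pow]
  simp_rw [h2] at h
  have h3 := (hasSum_mittagLeffler hα (add_pos hβ hδ) (-l * t ^ α)).mul_left (t ^ (β + δ - 1))
  rw [mlKernel, ← h.unique h3, conv, intervalIntegral.integral_of_le ht.le]
  refine setIntegral_congr_fun measurableSet_Ioc fun τ hτ => ?_
  rw [mlKernel_zero_left hα hδ, mlKernel]
  have h4 := ((hasSum_mittagLeffler hα hβ (-l * τ ^ α)).mul_left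
    ((t - τ) ^ (δ - 1) / Real.Gamma δ * τ ^ (β - 1))).tsum_eq
  rw [← mul_assoc, ← h4]
  refine tsum_congr fun k => ?_
  rw [hF]
  simp only
  have : τ ^ (α * k + β - 1) = τ ^ (β - 1) * (τ ^ α) ^ k := by
    rw [← Real.rpow_natCast, ← Real.rpow_mul hτ.1.le, ← Real.rpow_add hτ.1]; congr 1; ring
  rw [this, mul_pow]
  ring

/-- Scaling: the decay bound is applied at x = l t^α. Uniformity in l is what later turns scalar
bounds into operator bounds. -/
lemma exists_rpow_mul_abs_mlKernel_le (hα : 1 < α) (hα2 : α < 2) (hβ : 0 < β) {θ : ℝ}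
    (hθ0 : 0 ≤ θ) (hθ1 : θ ≤ 1) (hθ : α * θ < β) :
    ∃ C : ℝ, 0 < C ∧ ∀ l : ℝ, 0 ≤ l → ∀ t : ℝ, 0 < t →
      l ^ θ * |mlKernel α l β t| ≤ C * t ^ (β - 1 - α * θ) := by
  obtain ⟨C, hC, h⟩ := exists_rpow_mul_abs_mittagLeffler_le hα hα2 hβ hθ0 hθ1 hθ
  refine ⟨C, hC, fun l hl t ht => ?_⟩
  have h1 := h (l * t ^ α) (by positivity)
  rw [Real.mul_rpow hl (by positivity), ← Real.rpow_mul ht.le, ← neg_mul] at h1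
  rw [mlKernel, abs_mul, abs_of_pos (Real.rpow_pos_of_pos ht _)]
  have h2 : t ^ (β - 1) = t ^ (α * θ) * t ^ (β - 1 - α * θ) := by
    rw [← Real.rpow_add ht]; congr 1; ring
  rw [h2]
  have h3 : 0 ≤ t ^ (β - 1 - α * θ) := by positivity
  have := mul_le_mul_of_nonneg_right h1 h3
  linarith

end Kernel

/-! ### The scalar fractional equation along one eigenfunction. -/

section Volterra

variable {α l a b T : ℝ} {F u v : ℝ → ℝ}

lemma conv_zero (f g : ℝ → ℝ) : conv f g 0 = 0 := by simp [conv]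

lemma conv_one (hα : 1 < α) (f : ℝ → ℝ) (t : ℝ) :
    conv (mlKernel α 0 1) f t = ∫ s in (0 : ℝ)..t, f s := by
  simp [conv, mlKernel_zero_one hα]

lemma hasDerivWithinAt_integral_Icc {E : Type*} [NormedAddCommGroup E] [NormedSpace ℝ E]
    [CompleteSpace E] {f : ℝ → E} (hf : ContinuousOn f (Icc 0 T)) {t : ℝ} (ht : t ∈ Icc 0 T) :
    HasDerivWithinAt (fun t => ∫ s in (0 : ℝ)..t, f s) (f t) (Icc 0 T) t := by
  have hT : 0 ≤ T := ht.1.trans ht.2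
  set g := IccExtend hT ((Icc 0 T).domRestrict f) with hg
  have hgc : Continuous g := (continuousOn_iff_continuous_domRestrict.1 hf).Icc_extend'
  have hgf : ∀ s ∈ Icc 0 T, g s = f s := fun s hs => by rw [hg, IccExtend_of_mem _ _ hs]; rfl
  have h1 : HasDerivAt (fun t => ∫ s in (0 : ℝ)..t, g s) (g t) t :=
    intervalIntegral.integral_hasDerivAt_right (hgc.intervalIntegrable _ _)
      (hgc.stronglyMeasurableAtFilter _ _) hgc.continuousAt
  have h2 : ∀ t ∈ Icc 0 T, ∫ s in (0 : ℝ)..t, f s = ∫ s in (0 : ℝ)..t, g s := fun t ht => by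
    refine intervalIntegral.integral_congr fun s hs => ?_
    rw [uIcc_of_le ht.1] at hs
    exact (hgf s ⟨hs.1, hs.2.trans ht.2⟩).symm
  rw [← hgf t ht]
  exact h1.hasDerivWithinAt.congr h2 (h2 t ht)

lemma conv_conv_mlKernel {β δ : ℝ} (hα : 1 < α) (hβ : 0 < β) (hδ : 0 < δ)
    (hF : ContinuousOn F (Icc 0 T)) {t : ℝ} (ht : t ∈ Icc 0 T) :
    conv (mlKernel α 0 δ) (conv (mlKernel α l β) F) t = conv (mlKernel α l (β + δ)) F t := by
  rw [← conv_assoc (intervalIntegrable_mlKernel hα hδ 0 T) (intervalIntegrable_mlKernel hα hβ 0 T)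
    hF ht]
  exact conv_congr ht.1 (fun τ hτ => conv_mlKernel hα hβ hδ hτ.1) fun _ _ => rfl

/-- The coefficient of the variation-of-constants formula along an eigenfunction. -/
noncomputable def mlSolution (α l a b : ℝ) (F : ℝ → ℝ) (t : ℝ) : ℝ :=
  a * mlKernel α l 1 t + b * mlKernel α l 2 t + conv (mlKernel α l α) F t

/-- The derivative of `mlSolution`. -/
noncomputable def mlSolutionDeriv (α l a b : ℝ) (F : ℝ → ℝ) (t : ℝ) : ℝ :=
  -(a * (l * mlKernel α l α t)) + b * mlKernel α l 1 t + conv (mlKernel α l (α - 1)) F t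

lemma continuousOn_mlSolution (hα : 1 < α) (hF : ContinuousOn F (Icc 0 T)) :
    ContinuousOn (mlSolution α l a b F) (Icc 0 T) := by
  refine ContinuousOn.add (Continuous.continuousOn ?_) (continuousOn_conv
    (continuousOn_mlKernel hα (by linarith)) (intervalIntegrable_mlKernel hα (by linarith) _ _) hF)
  have h1 := continuous_mlKernel (l := l) hα (le_refl 1)
  have h2 := continuous_mlKernel (l := l) hα (one_le_two)
  fun_prop

lemma conv_mlSolution {δ : ℝ} (hα : 1 < α) (hδ : 0 < δ) (hF : ContinuousOn F (Icc 0 T)) {t : ℝ}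
    (ht : t ∈ Icc 0 T) (ht0 : 0 < t) :
    conv (mlKernel α 0 δ) (mlSolution α l a b F) t =
      a * mlKernel α l (1 + δ) t + b * mlKernel α l (2 + δ) t +
        conv (mlKernel α l (α + δ)) F t := by
  have hc := continuousOn_mlKernel (l := 0) hα hδ
  have hi := intervalIntegrable_mlKernel (l := 0) hα hδ 0 T
  have h1 := (continuous_mlKernel (l := l) hα (le_refl 1)).continuousOn (s := Icc 0 T)
  have h2 := (continuous_mlKernel (l := l) hα (one_le_two)).continuousOn (s := Icc 0 T)
  have h3 := continuousOn_conv (continuousOn_mlKernel (l := l) hα (zero_lt_one.trans hα))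
    (intervalIntegrable_mlKernel hα (zero_lt_one.trans hα) 0 T) hF
  have h12 : ContinuousOn (fun s => a * mlKernel α l 1 s + b * mlKernel α l 2 s) (Icc 0 T) :=
    (h1.const_mul a).add (h2.const_mul b)
  unfold mlSolution
  rw [conv_add_right hc hi h12 h3 ht,
    conv_add_right hc hi (h1.const_mul a) (h2.const_mul b) ht, conv_const_mul_right,
    conv_const_mul_right, conv_mlKernel hα one_pos hδ ht0, conv_mlKernel hα two_pos hδ ht0,
    conv_conv_mlKernel hα (by linarith) hδ hF ht]

lemma mlSolution_zero (hα : 1 < α) : mlSolution α l a b F 0 = a := by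
  rw [mlSolution, mlKernel_one_at_zero hα, mlKernel_at_zero one_lt_two, conv_zero]; ring

lemma conv_mlKernel_add {β : ℝ} (hα : 1 < α) (hβ : 0 < β) (hF : ContinuousOn F (Icc 0 T)) {t : ℝ}
    (ht : t ∈ Icc 0 T) :
    conv (mlKernel α l β) F t + l * conv (mlKernel α l (β + α)) F t =
      conv (mlKernel α 0 β) F t := by
  have h1 := intervalIntegrable_conv (continuousOn_mlKernel (l := l) hα hβ)
    (intervalIntegrable_mlKernel hα hβ 0 T) hF ht
  have h2 := intervalIntegrable_conv (continuousOn_mlKernel (l := l) hα (by linarith : 0 < β + α))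
    (intervalIntegrable_mlKernel hα (by linarith) 0 T) hF ht
  rw [conv, conv, conv, ← intervalIntegral.integral_const_mul,
    ← intervalIntegral.integral_add h1 (h2.const_mul l)]
  refine intervalIntegral.integral_congr fun τ hτ => ?_
  rw [uIcc_of_le ht.1] at hτ
  rw [← mlKernel_add hα hβ (sub_nonneg.2 hτ.2)]
  ring

/-- The variation-of-constants formula solves the Volterra equation. -/
lemma mlSolution_volterra (hα : 1 < α) (hF : ContinuousOn F (Icc 0 T)) {t : ℝ}
    (ht : t ∈ Icc 0 T) :
    mlSolution α l a b F t = a + b * t +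
      conv (mlKernel α 0 α) (fun s => F s - l * mlSolution α l a b F s) t := by
  rcases ht.1.eq_or_lt with rfl | ht0
  · rw [mlSolution_zero hα, conv_zero]; ring
  have hα0 := zero_lt_one.trans hα
  have hu := continuousOn_mlSolution (l := l) (a := a) (b := b) hα hF
  have h1 := conv_mlSolution (l := l) (a := a) (b := b) hα hα0 hF ht ht0
  have hc := continuousOn_mlKernel (l := 0) hα hα0
  have hi := intervalIntegrable_mlKernel (l := 0) hα hα0 0 T
  have h2 : conv (mlKernel α 0 α) (fun s => F s - l * mlSolution α l a b F s) t =
      conv (mlKernel α 0 α) F t - l * conv (mlKernel α 0 α) (mlSolution α l a b F) t := by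
    have := conv_add_right hc hi hF (hu.const_mul (-l)) ht
    rw [conv_const_mul_right] at this
    simp only [neg_mul, ← sub_eq_add_neg] at this
    exact this
  -- Convolution with g_α has produced the indices 1+α, 2+α and 2α; the resolvent identity pairs
  -- each with 1, 2 and α, leaving a + bt + g_α * F.
  have e1 := mlKernel_add (l := l) hα one_pos ht.1
  have e2 := mlKernel_add (l := l) hα two_pos ht.1
  have e3 := conv_mlKernel_add (l := l) hα hα0 hF ht
  rw [mlKernel_zero_one hα] at e1
  rw [mlKernel_zero_two hα] at e2
  rw [h2, h1]
  unfold mlSolution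
  linear_combination a * e1 + b * e2 + e3

/-- Injectivity of the Abel integral operator on continuous functions. -/
lemma eq_zero_of_conv_eq_zero {δ : ℝ} (hT : 0 < T) (hα : 1 < α) (hδ : 0 < δ) (hδ1 : δ < 1)
    (hv : ContinuousOn v (Icc 0 T)) (h : ∀ t ∈ Icc 0 T, conv (mlKernel α 0 δ) v t = 0) :
    ∀ t ∈ Icc 0 T, v t = 0 := by
  intro t ht
  have h1 : ∀ t ∈ Icc 0 T, ∫ s in (0 : ℝ)..t, v s = 0 := by
    intro t ht
    rw [← conv_one hα]
    -- Abel's device: convolving with g_{1-δ} gives g_1 * v = ∫ v = 0, and differentiation recovers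
    -- v.
    have h2 := conv_conv_mlKernel (l := 0) (δ := 1 - δ) hα hδ (by linarith) hv ht
    rw [show δ + (1 - δ) = 1 by ring] at h2
    rw [← h2, conv_congr ht.1 (b' := fun _ => 0) (fun _ _ => rfl)
      fun τ hτ => h τ ⟨hτ.1.le, hτ.2.le.trans ht.2⟩]
    simp [conv]
  have h3 : HasDerivWithinAt (fun t => ∫ s in (0 : ℝ)..t, v s) (v t) (Icc 0 T) t :=
    hasDerivWithinAt_integral_Icc hv ht
  have h4 : HasDerivWithinAt (fun t => ∫ s in (0 : ℝ)..t, v s) 0 (Icc 0 T) t :=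
    (hasDerivWithinAt_const t (Icc 0 T) (0 : ℝ)).congr h1 (h1 t ht)
  exact (uniqueDiffOn_Icc hT t ht).eq_deriv _ h3 h4

/-- Uniqueness for the Volterra equation. -/
lemma eq_zero_of_volterra (hα : 1 < α) (hv : ContinuousOn v (Icc 0 T))
    (h : ∀ t ∈ Icc 0 T, v t = -l * conv (mlKernel α 0 α) v t) : ∀ t ∈ Icc 0 T, v t = 0 := by
  intro t ht
  have hα0 := zero_lt_one.trans hα
  -- Convolving the equation with the resolvent kernel e_α gives e_α * v = -l e_{2α} * v. By the
  -- resolvent identity g_α * v = 0, and the equation itself then says v = 0; no Gronwall estimate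
  -- is needed.
  have h1 : conv (mlKernel α l α) v t = -l * conv (mlKernel α l (α + α)) v t := by
    rw [conv_congr ht.1 (b' := fun s => -l * conv (mlKernel α 0 α) v s) (fun _ _ => rfl)
      fun τ hτ => h τ ⟨hτ.1.le, hτ.2.le.trans ht.2⟩, conv_const_mul_right]
    congr 1
    rw [← conv_assoc (intervalIntegrable_mlKernel hα hα0 0 T)
      (intervalIntegrable_mlKernel hα hα0 0 T) hv ht]
    exact conv_congr ht.1 (fun τ hτ => by
      rw [conv_comm]; exact conv_mlKernel hα hα0 hα0 hτ.1) fun _ _ => rfl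
  have h2 := conv_mlKernel_add (l := l) hα hα0 hv ht
  rw [h t ht, ← h2, h1]
  ring

/-- The fractional integral of order `2 - α` of the variation-of-constants formula. -/
lemma conv_mlSolution_sub (hα : 1 < α) (hα2 : α < 2) (hF : ContinuousOn F (Icc 0 T)) {t : ℝ}
    (ht : t ∈ Icc 0 T) :
    conv (mlKernel α 0 (2 - α)) (fun s => mlSolution α l a b F s - a - b * s) t =
      ∫ s in (0 : ℝ)..t, ∫ r in (0 : ℝ)..s, (F r - l * mlSolution α l a b F r) := by
  set w := fun s => F s - l * mlSolution α l a b F s with hw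
  have hwc : ContinuousOn w (Icc 0 T) :=
    hF.sub ((continuousOn_mlSolution hα hF).const_mul l)
  have h1 : conv (mlKernel α 0 (2 - α)) (fun s => mlSolution α l a b F s - a - b * s) t =
      conv (mlKernel α 0 (2 - α)) (conv (mlKernel α 0 α) w) t := by
    refine conv_congr ht.1 (fun _ _ => rfl) fun τ hτ => ?_
    rw [mlSolution_volterra hα hF ⟨hτ.1.le, hτ.2.le.trans ht.2⟩]
    ring
  -- g_{2-α} * g_α = g_2 = g_1 * g_1, the double integral.
  rw [h1, conv_conv_mlKernel hα (by linarith) (by linarith) hwc ht, ← conv_one hα]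
  rw [conv_congr ht.1 (b' := conv (mlKernel α 0 1) w) (fun _ _ => rfl)
    fun τ _ => (conv_one hα w τ).symm, conv_conv_mlKernel hα one_pos one_pos hwc ht]
  congr 2
  norm_num

/-- The difference d from the explicit solution satisfies g_{2-α} * (d + l g_α * d) = 0, because g_2
= g_{2-α} * g_α. Abel injectivity followed by Volterra uniqueness gives d = 0, so continuity of v is
all the regularity required. -/
lemma eq_mlSolution_of_conv_sub (hT : 0 < T) (hα : 1 < α) (hα2 : α < 2) (hF : ContinuousOn F (Icc 0 T))
    (hv : ContinuousOn v (Icc 0 T))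
    (h : ∀ t ∈ Icc 0 T, conv (mlKernel α 0 (2 - α)) (fun s => v s - a - b * s) t =
      ∫ s in (0 : ℝ)..t, ∫ r in (0 : ℝ)..s, (F r - l * v r)) :
    ∀ t ∈ Icc 0 T, v t = mlSolution α l a b F t := by
  set u := mlSolution α l a b F with hu
  have huc : ContinuousOn u (Icc 0 T) := continuousOn_mlSolution hα hF
  have hα0 := zero_lt_one.trans hα
  have hδ : 0 < 2 - α := by linarith
  set d := fun s => v s + (-1) * u s with hd
  have hdc : ContinuousOn d (Icc 0 T) := hv.add (huc.const_mul _)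
  have hgc := continuousOn_mlKernel (l := 0) hα hδ
  have hgi := intervalIntegrable_mlKernel (l := 0) hα hδ 0 T
  have hz := eq_zero_of_conv_eq_zero (T := T) (v := fun s => d s + l * conv (mlKernel α 0 α) d s)
    hT hα hδ (by linarith) (hdc.add ((continuousOn_conv (continuousOn_mlKernel hα hα0)
      (intervalIntegrable_mlKernel hα hα0 0 T) hdc).const_mul l)) (fun t ht => by
    have hb : ContinuousOn (fun s => -a - b * s) (Icc 0 T) := by fun_prop
    have h1 := h t ht
    have h2 := conv_mlSolution_sub (l := l) (a := a) (b := b) hα hα2 hF ht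
    rw [← hu] at h2
    have e1 : conv (mlKernel α 0 (2 - α)) (fun s => v s - a - b * s) t =
        conv (mlKernel α 0 (2 - α)) v t + conv (mlKernel α 0 (2 - α)) (fun s => -a - b * s) t := by
      rw [← conv_add_right hgc hgi hv hb ht]; congr 1; ext s; ring
    have e2 : conv (mlKernel α 0 (2 - α)) (fun s => u s - a - b * s) t =
        conv (mlKernel α 0 (2 - α)) u t + conv (mlKernel α 0 (2 - α)) (fun s => -a - b * s) t := by
      rw [← conv_add_right hgc hgi huc hb ht]; congr 1; ext s; ring
    have hII : ∀ f : ℝ → ℝ, ContinuousOn f (Icc 0 T) →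
        ∫ s in (0 : ℝ)..t, ∫ r in (0 : ℝ)..s, f r = conv (mlKernel α 0 2) f t := by
      intro f hf
      rw [← conv_one hα, conv_congr ht.1 (b' := conv (mlKernel α 0 1) f) (fun _ _ => rfl)
        fun τ _ => (conv_one hα f τ).symm, conv_conv_mlKernel hα one_pos one_pos hf ht]
      norm_num
    have hg2c := continuousOn_mlKernel (l := 0) hα two_pos
    have hg2i := intervalIntegrable_mlKernel (l := 0) hα two_pos 0 T
    have hFv : ContinuousOn (fun s => F s - l * v s) (Icc 0 T) := hF.sub (hv.const_mul l)
    have hFu : ContinuousOn (fun s => F s - l * u s) (Icc 0 T) := hF.sub (huc.const_mul l)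
    rw [hII _ hFv, e1] at h1
    rw [hII _ hFu, e2] at h2
    have e3 : conv (mlKernel α 0 2) (fun s => F s - l * v s) t =
        conv (mlKernel α 0 2) F t + -l * conv (mlKernel α 0 2) v t := by
      rw [← conv_const_mul_right, ← conv_add_right hg2c hg2i hF (hv.const_mul _) ht]
      congr 1; ext s; ring
    have e4 : conv (mlKernel α 0 2) (fun s => F s - l * u s) t =
        conv (mlKernel α 0 2) F t + -l * conv (mlKernel α 0 2) u t := by
      rw [← conv_const_mul_right, ← conv_add_right hg2c hg2i hF (huc.const_mul _) ht]
      congr 1; ext s; ring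
    rw [conv_add_right hgc hgi hdc ((continuousOn_conv (continuousOn_mlKernel hα hα0)
      (intervalIntegrable_mlKernel hα hα0 0 T) hdc).const_mul l) ht, conv_const_mul_right,
      conv_conv_mlKernel hα hα0 hδ hdc ht, show α + (2 - α) = 2 by ring, hd,
      conv_add_right hgc hgi hv (huc.const_mul _) ht,
      conv_add_right hg2c hg2i hv (huc.const_mul _) ht, conv_const_mul_right, conv_const_mul_right]
    rw [e3] at h1
    rw [e4] at h2
    linear_combination h1 - h2)
  have := eq_zero_of_volterra (l := l) hα hdc fun t ht => by linarith [hz t ht]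
  intro t ht
  have := this t ht
  rw [hd] at this
  linarith

/-- Integration raises every index by one, and the constant a completes -a l e_{1+α} to a e_1 by the
resolvent identity. -/
lemma mlSolution_eq_integral (hα : 1 < α) (hF : ContinuousOn F (Icc 0 T)) {t : ℝ}
    (ht : t ∈ Icc 0 T) :
    mlSolution α l a b F t = a + ∫ s in (0 : ℝ)..t, mlSolutionDeriv α l a b F s := by
  rcases ht.1.eq_or_lt with rfl | ht0
  · rw [mlSolution_zero hα]; simp
  have hα0 := zero_lt_one.trans hα
  have hα1 : 0 < α - 1 := by linarith
  have h1 := (continuous_mlKernel (l := l) hα (le_refl 1)).continuousOn (s := Icc 0 T)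
  have h2 := (continuous_mlKernel (l := l) hα hα.le).continuousOn (s := Icc 0 T)
  have h3 := continuousOn_conv (continuousOn_mlKernel (l := l) hα hα1)
    (intervalIntegrable_mlKernel hα hα1 0 T) hF
  have hc := continuousOn_mlKernel (l := 0) hα one_pos
  have hi := intervalIntegrable_mlKernel (l := 0) hα one_pos 0 T
  have e : mlSolutionDeriv α l a b F = fun t =>
    ((-(a * l)) * mlKernel α l α t + b * mlKernel α l 1 t) + conv (mlKernel α l (α - 1)) F t := by
    ext t; rw [mlSolutionDeriv]; ring
  have h12 : ContinuousOn (fun s => -(a * l) * mlKernel α l α s + b * mlKernel α l 1 s) (Icc 0 T) :=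
    (h2.const_mul _).add (h1.const_mul b)
  rw [← conv_one hα, e, conv_add_right hc hi h12 h3 ht,
    conv_add_right hc hi (h2.const_mul _) (h1.const_mul b) ht, conv_const_mul_right,
    conv_const_mul_right, conv_mlKernel hα one_pos one_pos ht0, conv_mlKernel hα hα0 one_pos ht0,
    conv_conv_mlKernel hα hα1 one_pos hF ht, sub_add_cancel, mlSolution]
  have e1 := mlKernel_add (l := l) hα one_pos ht.1
  rw [mlKernel_zero_one hα, add_comm 1 α] at e1
  norm_num
  linear_combination a * e1

end Volterra

end FracWave

/-! ### Spectral theory of the form. -/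

namespace FracWave

/-- The spectral theorem for injective compact self-adjoint operators, with a small index type. -/
lemma exists_hilbertBasis_of_isCompactOperator {H : Type*} [NormedAddCommGroup H]
    [InnerProductSpace ℝ H] [CompleteSpace H] {T : H →L[ℝ] H} (hTc : IsCompactOperator T)
    (hTs : ∀ x y, inner ℝ (T x) y = inner ℝ x (T y)) (h0 : ∀ x, T x = 0 → x = 0) :
    ∃ (ι : Type) (B : HilbertBasis ι ℝ H) (ν : ι → ℝ), ∀ i, ν i ≠ 0 ∧ T (B i) = ν i • B i := by
  replace hTs : (T : H →ₗ[ℝ] H).IsSymmetric := hTs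
  -- Eigenspaces for ν ≠ 0 are finite-dimensional, so the basis is indexed by pairs of a nonzero
  -- real and an element of a finite set. This index lives in `Type` whatever the universe of H, as
  -- `EigenSystem` demands.
  let V : {ν : ℝ // ν ≠ 0} → Submodule ℝ H := fun ν => Module.End.eigenspace T.toLinearMap ν
  have hfin : ∀ ν, FiniteDimensional ℝ (V ν) := fun ν =>
    ContinuousLinearMap.finite_dimensional_eigenspace hTc ν.1 ν.2
  let bs : ∀ ν, OrthonormalBasis (Fin (Module.finrank ℝ (V ν))) ℝ (V ν) := fun ν =>
    stdOrthonormalBasis ℝ (V ν)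
  have hfam : OrthogonalFamily ℝ (fun ν => V ν) fun ν => (V ν).subtypeₗᵢ :=
    hTs.orthogonalFamily_eigenspaces.comp (f := fun ν : {ν : ℝ // ν ≠ 0} => ν.1)
      Subtype.val_injective
  let vec : (Σ ν : {ν : ℝ // ν ≠ 0}, Fin (Module.finrank ℝ (V ν))) → H :=
    fun a => (V a.1).subtypeₗᵢ (bs a.1 a.2)
  have hvec : Orthonormal ℝ vec :=
    hfam.orthonormal_sigma_orthonormal fun ν => (bs ν).orthonormal
  have hspan : (Submodule.span ℝ (Set.range vec))ᗮ = ⊥ := by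
    rw [eq_bot_iff, ← ContinuousLinearMap.orthogonalComplement_iSup_eigenspaces_eq_bot hTc hTs]
    refine Submodule.orthogonal_le (iSup_le fun ν => ?_)
    -- By injectivity 0 has no eigenvectors; the other eigenspaces are spanned by their chosen
    -- bases.
    by_cases hν : ν = 0
    · intro x hx
      have h1 : T x = ν • x := Module.End.mem_eigenspace_iff.1 hx
      rw [hν, zero_smul] at h1
      rw [h0 x h1]
      exact zero_mem _
    · intro x hx
      have h1 := (bs ⟨ν, hν⟩).sum_repr ⟨x, hx⟩
      have h2 : x = ∑ i, (bs ⟨ν, hν⟩).repr ⟨x, hx⟩ i • vec ⟨⟨ν, hν⟩, i⟩ := by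
        have := congrArg (V ⟨ν, hν⟩).subtype h1
        rw [map_sum] at this
        exact this.symm
      rw [h2]
      exact Submodule.sum_mem _ fun i _ => Submodule.smul_mem _ _
        (Submodule.subset_span (mem_range_self _))
  refine ⟨_, HilbertBasis.mkOfOrthogonalEqBot hvec hspan, fun a => a.1.1, fun a => ⟨a.1.2, ?_⟩⟩
  rw [HilbertBasis.coe_mkOfOrthogonalEqBot]
  exact Module.End.mem_eigenspace_iff.1 (bs a.1 a.2).2

section EnergySpace

variable {X : Type*} [MeasurableSpace X] {m : Measure X}

/-- The form domain as a Hilbert space with inner product `E(u, v) + (u, v)`. -/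
def DirichletForm.Energy (E : DirichletForm m) : Type _ := E.dom

namespace DirichletForm

variable (E : DirichletForm m)

instance : AddCommGroup E.Energy := inferInstanceAs (AddCommGroup E.dom)

instance : Module ℝ E.Energy := inferInstanceAs (Module ℝ E.dom)

/-- The inclusion of the energy space in `L²`. -/
def energyLin : E.Energy →ₗ[ℝ] L2 m := E.dom.subtype

/-- An element of the form domain, as an element of the energy space. -/
def toE (u : E.dom) : E.Energy := u

/-- An element of the energy space, as an element of the form domain. -/
def ofE (u : E.Energy) : E.dom := u

/-- The inner product of the energy space. -/
@[reducible] noncomputable def energyCore : InnerProductSpace.Core ℝ E.Energy where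
  inner u v := E.form (E.ofE u) (E.ofE v) +
    inner ℝ (E.energyLin u) (E.energyLin v)
  conj_inner_symm u v := by
    simp only [conj_trivial]
    rw [real_inner_comm]
    exact congrArg (· + _) (E.symm _ _)
  re_inner_nonneg u := by
    simp only [RCLike.re_to_real]
    exact add_nonneg (E.nonneg _) real_inner_self_nonneg
  add_left u v w := by
    rw [map_add, inner_add_left]
    change E.form ((E.ofE u) + (E.ofE v)) (E.ofE w) + _ = _
    rw [map_add, LinearMap.add_apply]
    ring
  smul_left u v r := by
    rw [map_smul, inner_smul_left]
    change E.form (r • (E.ofE u)) (E.ofE v) + _ = _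
    rw [map_smul, LinearMap.smul_apply, smul_eq_mul]
    simp only [conj_trivial]
    ring
  definite u hu := by
    have h1 := E.nonneg (E.ofE u)
    have h2 : 0 ≤ inner ℝ (E.energyLin u) (E.energyLin u) := real_inner_self_nonneg
    have h3 : inner ℝ (E.energyLin u) (E.energyLin u) = 0 := by linarith
    exact Subtype.ext (inner_self_eq_zero.1 h3)

noncomputable instance : NormedAddCommGroup E.Energy := E.energyCore.toNormedAddCommGroup

noncomputable instance : InnerProductSpace ℝ E.Energy := InnerProductSpace.ofCore E.energyCore.toCore

variable {E}

lemma inner_energy (u v : E.Energy) :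
    inner ℝ u v = E.form (E.ofE u) (E.ofE v) +
      inner ℝ (E.energyLin u) (E.energyLin v) := rfl

lemma norm_sq_energy (u : E.Energy) :
    ‖u‖ ^ 2 = E.form (E.ofE u) (E.ofE u) + ‖E.energyLin u‖ ^ 2 := by
  rw [← real_inner_self_eq_norm_sq, inner_energy, real_inner_self_eq_norm_sq]

lemma norm_energyLin_le (u : E.Energy) : ‖E.energyLin u‖ ≤ ‖u‖ := by
  have h := norm_sq_energy u
  have h2 := E.nonneg (E.ofE u)
  exact abs_le_of_sq_le_sq' (by linarith) (norm_nonneg _) |>.2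

/-- Closedness of the form with κ = 1 is completeness for the energy norm. -/
instance : CompleteSpace E.Energy := by
  refine Metric.complete_of_cauchySeq_tendsto fun u hu => ?_
  rw [cauchySeq_iff_tendsto_dist_atTop_0] at hu
  have h1 := hu.pow 2
  have h2 : (fun n : ℕ × ℕ => dist (u n.1) (u n.2) ^ 2) = fun p : ℕ × ℕ =>
      E.form ((E.ofE (u p.1)) - (E.ofE (u p.2)))
        ((E.ofE (u p.1)) - (E.ofE (u p.2))) +
      1 * ‖(E.ofE (u p.1)) - (E.ofE (u p.2))‖ ^ 2 := by
    ext p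
    rw [dist_eq_norm, norm_sq_energy, one_mul]
    rfl
  rw [h2] at h1
  obtain ⟨v, hv⟩ := E.closed 1 one_pos (fun n => (E.ofE (u n))) (by simpa using h1)
  refine ⟨E.toE v, tendsto_iff_norm_sub_tendsto_zero.2 ?_⟩
  have h3 : Tendsto (fun n => ‖u n - (E.toE v)‖ ^ 2) atTop (𝓝 0) := by
    refine hv.congr fun n => ?_
    rw [norm_sq_energy, one_mul]
    rfl
  have h4 := h3.sqrt
  simpa [Real.sqrt_sq] using h4

variable (E)

/-- The continuous inclusion of the energy space in `L²`. -/
noncomputable def energyEmb : E.Energy →L[ℝ] L2 m :=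
  E.energyLin.mkContinuous 1 fun u => by rw [one_mul]; exact norm_energyLin_le u

/-- The operator `(A + 1)⁻¹`, with values in the energy space. -/
noncomputable def energyRes : L2 m →L[ℝ] E.Energy := ContinuousLinearMap.adjoint E.energyEmb

variable {E}

lemma inner_energyRes (g : L2 m) (v : E.Energy) :
    inner ℝ (E.energyRes g) v = inner ℝ g (E.energyEmb v) :=
  ContinuousLinearMap.adjoint_inner_left _ _ _

lemma energyEmb_injective : Function.Injective E.energyEmb := fun _ _ h => Subtype.ext h

lemma energyRes_injective {g : L2 m} (h : E.energyRes g = 0) : g = 0 := by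
  refine E.dense_dom.eq_zero_of_inner_left (𝕜 := ℝ) fun v hv => ?_
  have := inner_energyRes g (E.toE ⟨v, hv⟩)
  rw [h, inner_zero_left] at this
  exact this.symm

lemma isCompactOperator_energyEmb (hE : E.CompactEmbedding) : IsCompactOperator E.energyEmb := by
  change IsCompactOperator E.energyLin
  rw [isCompactOperator_iff_isCompact_closure_image_closedBall (𝕜₁ := ℝ) _ one_pos]
  unfold DirichletForm.CompactEmbedding at hE
  convert! hE using 2
  ext u
  constructor
  · rintro ⟨v, hv, rfl⟩
    refine ⟨Subtype.property (E.ofE v), ?_⟩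
    rw [mem_closedBall_zero_iff] at hv
    have := norm_sq_energy v
    have h2 : ‖v‖ ^ 2 ≤ 1 := pow_le_one₀ (norm_nonneg _) hv
    rw [this] at h2
    exact h2
  · rintro ⟨hu, h⟩
    refine ⟨E.toE ⟨u, hu⟩, ?_, rfl⟩
    rw [mem_closedBall_zero_iff]
    have := norm_sq_energy (E.toE ⟨u, hu⟩)
    have h2 : ‖(E.toE ⟨u, hu⟩)‖ ^ 2 ≤ 1 := by rw [this]; exact h
    exact (pow_le_one_iff_of_nonneg (norm_nonneg _) two_ne_zero).1 h2

/-- Compactness of the embedding of the form domain yields an eigenbasis. -/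
theorem nonempty_eigenSystem (hE : E.CompactEmbedding) : Nonempty (EigenSystem E) := by
  -- On L² the operator (A+1)⁻¹ is J J*, with J the embedding of the energy space. It is compact
  -- because J is, and injective because the domain is dense. An eigenvalue ν of it gives the
  -- eigenvalue ν⁻¹ - 1 of A.
  have hTc : IsCompactOperator (E.energyEmb ∘L E.energyRes) :=
    (isCompactOperator_energyEmb hE).comp_clm E.energyRes
  have hTin : ∀ x y, inner ℝ ((E.energyEmb ∘L E.energyRes) x) y =
      inner ℝ (E.energyRes x) (E.energyRes y) := fun x y => by
    rw [real_inner_comm (E.energyRes y), inner_energyRes, real_inner_comm]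
    rfl
  obtain ⟨ι, B, ν, hν⟩ := exists_hilbertBasis_of_isCompactOperator hTc
    (fun x y => (hTin x y).trans ((real_inner_comm _ _).trans
      ((hTin y x).symm.trans (real_inner_comm _ _))))
    fun x hx => energyRes_injective (energyEmb_injective (hx.trans (map_zero _).symm))
  refine ⟨⟨ι, B, fun i => (ν i)⁻¹ - 1, fun i => ?_⟩⟩
  obtain ⟨hν0, h1⟩ := hν i
  have h2 : B i = E.energyEmb ((ν i)⁻¹ • E.energyRes (B i)) := by
    rw [map_smul]
    change B i = (ν i)⁻¹ • (E.energyEmb ∘L E.energyRes) (B i)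
    rw [h1, smul_smul, inv_mul_cancel₀ hν0, one_smul]
  have hmem : B i ∈ E.dom := by
    rw [h2]
    exact Subtype.property (E.ofE ((ν i)⁻¹ • E.energyRes (B i)))
  refine ⟨hmem, fun v => ?_⟩
  have h3 : E.toE ⟨B i, hmem⟩ = (ν i)⁻¹ • E.energyRes (B i) := energyEmb_injective h2
  have h4 : inner ℝ (E.toE ⟨B i, hmem⟩) (E.toE v) = E.form ⟨B i, hmem⟩ v +
    inner ℝ (B i) (v : L2 m) := inner_energy _ _
  rw [h3, inner_smul_left, inner_energyRes] at h4
  rw [sub_smul, one_smul, inner_sub_left, inner_smul_left]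
  simp only [conj_trivial] at h4 ⊢
  change (ν i)⁻¹ * inner ℝ (B i) (v : L2 m) = _ at h4
  linarith

end DirichletForm

namespace EigenSystem

variable {E : DirichletForm m} (S : EigenSystem E)

lemma form_basis (i : S.ι) {h : S.basis i ∈ E.dom} (v : E.dom) :
    E.form ⟨S.basis i, h⟩ v = S.eigenvalue i * inner ℝ (S.basis i) (v : L2 m) := by
  obtain ⟨_, h2⟩ := S.isImage i
  rw [h2 v, inner_smul_left]
  rfl

lemma basis_mem_dom (i : S.ι) : S.basis i ∈ E.dom := (S.isImage i).1

lemma norm_basis (i : S.ι) : ‖S.basis i‖ = 1 := S.basis.orthonormal.1 i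

lemma eigenvalue_nonneg (i : S.ι) : 0 ≤ S.eigenvalue i := by
  have h := E.nonneg ⟨S.basis i, S.basis_mem_dom i⟩
  rw [S.form_basis, real_inner_self_eq_norm_sq, S.norm_basis] at h
  simpa using h

/-- The eigenfunctions, normalised in the energy space. -/
noncomputable def energyVec (i : S.ι) : E.Energy :=
  (√(1 + S.eigenvalue i))⁻¹ • (E.toE ⟨S.basis i, S.basis_mem_dom i⟩)

lemma inner_energyVec (i : S.ι) (v : E.Energy) :
    inner ℝ (S.energyVec i) v = √(1 + S.eigenvalue i) * inner ℝ (S.basis i) (E.energyEmb v) := by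
  have h : 0 < 1 + S.eigenvalue i := by linarith [S.eigenvalue_nonneg i]
  rw [energyVec, inner_smul_left, DirichletForm.inner_energy]
  have h1 := S.form_basis i (h := S.basis_mem_dom i) (E.ofE v)
  change (√(1 + S.eigenvalue i))⁻¹ * (E.form ⟨S.basis i, S.basis_mem_dom i⟩ (E.ofE v) +
    inner ℝ (S.basis i) (E.energyEmb v)) = _
  rw [h1]
  change (√(1 + S.eigenvalue i))⁻¹ * (S.eigenvalue i * inner ℝ (S.basis i) (E.energyEmb v) +
    inner ℝ (S.basis i) (E.energyEmb v)) = _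
  have h2 := Real.sqrt_pos.2 h
  have h3 := Real.mul_self_sqrt h.le
  field_simp
  rw [sq, h3]
  ring

lemma energyEmb_energyVec (i : S.ι) :
    E.energyEmb (S.energyVec i) = (√(1 + S.eigenvalue i))⁻¹ • S.basis i := by
  rw [energyVec, map_smul]; rfl

lemma orthonormal_energyVec : Orthonormal ℝ S.energyVec := by
  classical
  rw [orthonormal_iff_ite]
  intro i j
  rw [S.inner_energyVec, S.energyEmb_energyVec, inner_smul_right,
    orthonormal_iff_ite.1 S.basis.orthonormal i j]
  split_ifs with hij
  · subst hij
    have h : 0 < 1 + S.eigenvalue i := by linarith [S.eigenvalue_nonneg i]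
    have h2 := Real.sqrt_pos.2 h
    field_simp
  · simp

/-- The Hilbert basis of the energy space given by the eigenfunctions. -/
noncomputable def energyBasis : HilbertBasis S.ι ℝ E.Energy :=
  HilbertBasis.mkOfOrthogonalEqBot S.orthonormal_energyVec (by
    rw [eq_bot_iff]
    intro v hv
    have h1 : ∀ i, inner ℝ (S.basis i) (E.energyEmb v) = 0 := by
      intro i
      have h2 := (Submodule.mem_orthogonal _ v).1 hv (S.energyVec i)
        (Submodule.subset_span (mem_range_self i))
      rw [S.inner_energyVec] at h2
      have h : 0 < 1 + S.eigenvalue i := by linarith [S.eigenvalue_nonneg i]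
      exact (mul_eq_zero.1 h2).resolve_left (Real.sqrt_pos.2 h).ne'
    rw [Submodule.mem_bot]
    refine DirichletForm.energyEmb_injective (S.basis.repr.injective ?_)
    ext i
    rw [S.basis.repr_apply_apply, h1]
    simp)

lemma energyBasis_apply (i : S.ι) : S.energyBasis i = S.energyVec i := by
  rw [energyBasis, HilbertBasis.coe_mkOfOrthogonalEqBot]

/-- The spectral description of the form. -/
lemma hasSum_form (u v : E.dom) :
    HasSum (fun i => (1 + S.eigenvalue i) *
      (inner ℝ (S.basis i) (u : L2 m) * inner ℝ (S.basis i) (v : L2 m)))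
      (E.form u v + inner ℝ (u : L2 m) (v : L2 m)) := by
  -- Parseval in the energy space, whose Hilbert basis is φ_i/√(1+λ_i).
  have h := S.energyBasis.hasSum_inner_mul_inner (E.toE u) (E.toE v)
  convert! h using 1
  ext i
  rw [energyBasis_apply, real_inner_comm (S.energyVec i) (E.toE u), S.inner_energyVec, S.inner_energyVec]
  have h : 0 ≤ 1 + S.eigenvalue i := by linarith [S.eigenvalue_nonneg i]
  have h3 := Real.mul_self_sqrt h
  change (1 + S.eigenvalue i) * (inner ℝ (S.basis i) (E.energyEmb (E.toE u)) *
    inner ℝ (S.basis i) (E.energyEmb (E.toE v))) = _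
  linear_combination (-(inner ℝ (S.basis i) (E.energyEmb (E.toE u)) *
    inner ℝ (S.basis i) (E.energyEmb (E.toE v)))) * h3

/-- The sequence √(1+λ_i)(φ_i, u) is the coefficient sequence of some element of the complete energy
space, and that element has the same L² coefficients as u. -/
lemma mem_dom_of_summable {u : L2 m}
    (hu : Summable fun i => (1 + S.eigenvalue i) * inner ℝ (S.basis i) u ^ 2) : u ∈ E.dom := by
  have hpos : ∀ i, 0 < 1 + S.eigenvalue i := fun i => by linarith [S.eigenvalue_nonneg i]
  have hmem : Memℓp (fun i => √(1 + S.eigenvalue i) * inner ℝ (S.basis i) u) 2 := by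
    refine memℓp_gen ?_
    refine hu.congr fun i => ?_
    simp only [ENNReal.toReal_ofNat, Real.rpow_ofNat, Real.norm_eq_abs, sq_abs, mul_pow,
      Real.sq_sqrt (hpos i).le]
  set w : E.Energy := S.energyBasis.repr.symm ⟨_, hmem⟩ with hw
  have h1 : E.energyEmb w = u := by
    refine S.basis.repr.injective ?_
    ext i
    rw [S.basis.repr_apply_apply, S.basis.repr_apply_apply]
    have h2 := S.energyBasis.repr_apply_apply w i
    rw [energyBasis_apply, S.inner_energyVec, hw, LinearIsometryEquiv.apply_symm_apply] at h2
    exact (mul_left_cancel₀ (Real.sqrt_pos.2 (hpos i)).ne' h2).symm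
  rw [← h1]
  exact Subtype.property (E.ofE w)

end EigenSystem

end EnergySpace

end FracWave

/-! ### Markov property and L¹ contraction of resolvents. -/

namespace FracWave

section Markov

variable {X : Type*} [MeasurableSpace X] {m : Measure X} {E : DirichletForm m}

lemma abs_sub_le_of_contraction {φ : ℝ → ℝ} (h01 : ∀ t ∈ Icc (0 : ℝ) 1, φ t = t)
    (hφ : ∀ τ t : ℝ, τ < t → 0 ≤ φ t - φ τ ∧ φ t - φ τ ≤ t - τ) {s t : ℝ} (hs : s ∈ Icc (0 : ℝ) 1) :
    |φ t - s| ≤ |t - s| := by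
  have h0 := h01 0 (by simp)
  have h1 := h01 1 (by simp)
  rcases lt_or_ge t 0 with ht | ht
  · have := hφ t 0 ht
    rw [abs_of_nonpos (by linarith [hs.1]), abs_of_nonpos (by linarith [hs.1])]
    linarith
  · rcases le_or_gt t 1 with ht1 | ht1
    · rw [h01 t ⟨ht, ht1⟩]
    · have := hφ 1 t ht1
      rw [abs_of_nonneg (by linarith [hs.2]), abs_of_nonneg (by linarith [hs.2])]
      linarith

/-- The resolvents of a Dirichlet form are Markovian. -/
lemma DirichletForm.mem_Icc_of_resolvent {κ : ℝ} (hκ : 0 < κ) {u : E.dom} {s : L2 m}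
    (hu : ∀ v : E.dom, E.form u v + κ * inner ℝ (u : L2 m) (v : L2 m) =
      κ * inner ℝ s (v : L2 m)) (hs : ∀ᵐ x ∂m, s x ∈ Icc (0 : ℝ) 1) :
    ∀ᵐ x ∂m, (u : L2 m) x ∈ Icc (0 : ℝ) 1 := by
  -- u is the unique minimiser of E(v,v) + κ‖v - s‖². Passing from u to φ(u) increases neither term,
  -- so φ(u) = u, and u inherits the bounds -ε and 1 + ε of φ.
  have key : ∀ ε : ℝ, 0 < ε → ∀ᵐ x ∂m, -ε ≤ (u : L2 m) x ∧ (u : L2 m) x ≤ 1 + ε := by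
    intro ε hε
    obtain ⟨φ, -, h01, hb, hc, hφ⟩ := E.markov ε hε
    obtain ⟨v, hv, hE⟩ := hφ u
    have hnorm : ‖(v : L2 m) - s‖ ≤ ‖(u : L2 m) - s‖ := by
      refine Lp.norm_le_norm_of_ae_le ?_
      filter_upwards [hv, hs, Lp.coeFn_sub (v : L2 m) s, Lp.coeFn_sub (u : L2 m) s] with x h1 h2 h3 h4
      rw [h3, h4, Pi.sub_apply, Pi.sub_apply, h1]
      exact abs_sub_le_of_contraction h01 hc h2
    set w := v - u with hw
    have hvw : v = u + w := by rw [hw]; abel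
    have h1 := hu w
    have h2 : E.form v v = E.form u u + 2 * E.form u w + E.form w w := by
      rw [hvw]
      simp only [map_add, LinearMap.add_apply]
      rw [E.symm w u]; ring
    have h3 : ‖(v : L2 m) - s‖ ^ 2 = ‖(u : L2 m) - s‖ ^ 2 +
        2 * (inner ℝ (u : L2 m) (w : L2 m) - inner ℝ s (w : L2 m)) + ‖(w : L2 m)‖ ^ 2 := by
      have : (v : L2 m) - s = ((u : L2 m) - s) + w := by rw [hvw, Submodule.coe_add]; abel
      rw [this, norm_add_sq_real, inner_sub_left]
    have h4 : ‖(v : L2 m) - s‖ ^ 2 ≤ ‖(u : L2 m) - s‖ ^ 2 := by gcongr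
    have h5 := E.nonneg w
    have h6 : κ * ‖(w : L2 m)‖ ^ 2 ≤ 0 := by nlinarith
    have h7 : ‖(w : L2 m)‖ = 0 := by
      have : ‖(w : L2 m)‖ ^ 2 ≤ 0 := by nlinarith [sq_nonneg ‖(w : L2 m)‖]
      exact pow_eq_zero_iff two_ne_zero |>.1 (le_antisymm this (sq_nonneg _))
    have h8 : (v : L2 m) = u := by
      rw [hvw, Submodule.coe_add, norm_eq_zero.1 h7, add_zero]
    rw [h8] at hv
    filter_upwards [hv] with x hx
    rw [hx]
    exact hb _
  have h2 : ∀ᵐ x ∂m, ∀ n : ℕ, -(1 / ((n : ℝ) + 1)) ≤ (u : L2 m) x ∧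
      (u : L2 m) x ≤ 1 + 1 / ((n : ℝ) + 1) := ae_all_iff.2 fun n => key _ (by positivity)
  filter_upwards [h2] with x hx
  have ht := tendsto_one_div_add_atTop_nhds_zero_nat (𝕜 := ℝ)
  refine ⟨?_, ?_⟩
  · have := le_of_tendsto (ht.neg) (Eventually.of_forall fun n => (hx n).1)
    simpa using this
  · have := ge_of_tendsto (ht.const_add 1) (Eventually.of_forall fun n => (hx n).2)
    simpa using this

namespace EigenSystem

variable (S : EigenSystem E)

lemma one_le_add_eigenvalue (i : S.ι) : 1 ≤ 1 + S.eigenvalue i := by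
  linarith [S.eigenvalue_nonneg i]

lemma summable_inner_sq (g : L2 m) : Summable fun i => inner ℝ (S.basis i) g ^ 2 := by
  have := S.basis.summable_inner_mul_inner g g
  refine this.congr fun i => ?_
  rw [real_inner_comm, sq]

lemma tsum_inner_sq (g : L2 m) : HasSum (fun i => inner ℝ (S.basis i) g ^ 2) (‖g‖ ^ 2) := by
  have := S.basis.hasSum_inner_mul_inner g g
  rw [real_inner_self_eq_norm_sq] at this
  convert! this using 1
  ext i
  rw [real_inner_comm, sq]

/-- The element of `L²` with given square summable coefficients. -/
noncomputable def ofCoeff (c : S.ι → ℝ) (hc : Memℓp c 2) : L2 m := S.basis.repr.symm ⟨c, hc⟩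

lemma inner_ofCoeff (c : S.ι → ℝ) (hc : Memℓp c 2) (i : S.ι) :
    inner ℝ (S.basis i) (S.ofCoeff c hc) = c i := by
  rw [← S.basis.repr_apply_apply, ofCoeff, LinearIsometryEquiv.apply_symm_apply]

lemma ext_inner {f g : L2 m} (h : ∀ i, inner ℝ (S.basis i) f = inner ℝ (S.basis i) g) : f = g := by
  refine S.basis.repr.injective ?_
  ext i
  rw [S.basis.repr_apply_apply, S.basis.repr_apply_apply, h]

/-- The resolvent `(1 + h (A + 1))⁻¹`. -/
lemma exists_resolvent {h : ℝ} (hh : 0 < h) (g : L2 m) : ∃ u : E.dom,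
    (∀ i, inner ℝ (S.basis i) (u : L2 m) =
      inner ℝ (S.basis i) g / (1 + h * (1 + S.eigenvalue i))) ∧
    ∀ v : E.dom, h * (E.form u v + inner ℝ (u : L2 m) (v : L2 m)) +
      inner ℝ (u : L2 m) (v : L2 m) = inner ℝ g (v : L2 m) := by
  have hμ : ∀ i, 0 < h * (1 + S.eigenvalue i) := fun i => by
    have := S.one_le_add_eigenvalue i; positivity
  have hmem : Memℓp (fun i => inner ℝ (S.basis i) g / (1 + h * (1 + S.eigenvalue i))) 2 := by
    refine (S.memℓp_inner g).norm.mono fun i => ?_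
    rw [norm_div, Real.norm_of_nonneg (by linarith [hμ i] : 0 ≤ 1 + h * (1 + S.eigenvalue i))]
    have h1 : 1 ≤ 1 + h * (1 + S.eigenvalue i) := by linarith [hμ i]
    rw [div_le_iff₀ (by linarith)]
    have h2 := norm_nonneg (inner ℝ (S.basis i) g)
    nlinarith
  have hc := S.inner_ofCoeff _ hmem
  set u := S.ofCoeff _ hmem
  have hdom : u ∈ E.dom := by
    refine S.mem_dom_of_summable ?_
    refine Summable.of_nonneg_of_le (fun i => ?_) (fun i => ?_)
      ((S.summable_inner_sq g).mul_left h⁻¹)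
    · have := S.one_le_add_eigenvalue i; positivity
    · rw [hc, div_pow, mul_div_assoc', div_le_iff₀ (by have := hμ i; positivity)]
      have h1 := hμ i
      have h2 : h * (1 + S.eigenvalue i) ≤ (1 + h * (1 + S.eigenvalue i)) ^ 2 := by nlinarith
      calc (1 + S.eigenvalue i) * inner ℝ (S.basis i) g ^ 2
          = h⁻¹ * inner ℝ (S.basis i) g ^ 2 * (h * (1 + S.eigenvalue i)) := by field_simp
        _ ≤ _ := by gcongr
  refine ⟨⟨u, hdom⟩, hc, fun v => ?_⟩
  have h1 := (S.hasSum_form ⟨u, hdom⟩ v).mul_left h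
  have h2 := S.basis.hasSum_inner_mul_inner u (v : L2 m)
  have h3 := S.basis.hasSum_inner_mul_inner g (v : L2 m)
  refine (h1.add h2).unique ?_
  convert! h3 using 1
  ext i
  rw [real_inner_comm (S.basis i) u, hc, real_inner_comm (S.basis i) g]
  have := hμ i
  field_simp
  ring

end EigenSystem

lemma inner_L2 (f g : L2 m) : inner ℝ f g = ∫ x, f x * g x ∂m := by
  rw [L2.inner_def]
  refine integral_congr_ae (ae_of_all _ fun x => ?_)
  simp [mul_comm]

lemma integrable_mul_L2 (f g : L2 m) : Integrable (fun x => f x * g x) m := by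
  have := L2.integrable_inner (𝕜 := ℝ) g f
  simpa using this

variable [IsFiniteMeasure m]

lemma integrable_L2 (g : L2 m) : Integrable (fun x => g x) m :=
  (Lp.memLp g).integrable (by norm_num)

lemma inner_le_integral_abs {g r : L2 m} (hr : ∀ᵐ x ∂m, |r x| ≤ 1) :
    inner ℝ g r ≤ ∫ x, |g x| ∂m := by
  rw [inner_L2]
  refine integral_mono_ae (integrable_mul_L2 _ _) (integrable_L2 g).abs ?_
  filter_upwards [hr] with x hx
  calc g x * r x ≤ |g x * r x| := le_abs_self _
    _ = |g x| * |r x| := abs_mul _ _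
    _ ≤ |g x| := mul_le_of_le_one_right (abs_nonneg _) hx

/-- The resolvents of a Dirichlet form are contractions in `L¹`. -/
lemma EigenSystem.integral_abs_resolvent_le (S : EigenSystem E) {h : ℝ} (hh : 0 < h) {g : L2 m}
    {u : E.dom} (hu : ∀ v : E.dom, h * (E.form u v + inner ℝ (u : L2 m) (v : L2 m)) +
      inner ℝ (u : L2 m) (v : L2 m) = inner ℝ g (v : L2 m)) :
    ∫ x, |(u : L2 m) x| ∂m ≤ ∫ x, |g x| ∂m := by
  -- Duality: with R the symmetric resolvent, ∫|u| = (u, sgn u) = (g, R sgn u), and |R sgn u| ≤ 1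
  -- because R sends [0,1]-valued functions to [0,1]-valued functions.
  have hres : ∀ s : L2 m, (∀ᵐ x ∂m, s x ∈ Icc (0 : ℝ) 1) → ∃ r : E.dom,
      (∀ᵐ x ∂m, (r : L2 m) x ∈ Icc (0 : ℝ) 1) ∧
      inner ℝ (u : L2 m) s = inner ℝ g (r : L2 m) := by
    intro s hs
    obtain ⟨r, -, hr⟩ := S.exists_resolvent hh s
    refine ⟨r, ?_, ?_⟩
    -- Dividing h E(r,v) + (1+h)(r,v) = (s,v) by h gives κ = (1+h)/h with right-hand side s/(1+h),
    -- still between 0 and 1.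
    · refine DirichletForm.mem_Icc_of_resolvent (κ := (1 + h) / h) (s := (1 + h)⁻¹ • s)
        (by positivity) (fun v => ?_) ?_
      · have := hr v
        rw [inner_smul_left, ← this]
        simp only [conj_trivial]
        field_simp
        ring
      · filter_upwards [hs, Lp.coeFn_smul (1 + h)⁻¹ s] with x hx h2
        rw [h2, Pi.smul_apply, smul_eq_mul]
        exact ⟨mul_nonneg (by positivity) hx.1, mul_le_one₀ (inv_le_one_of_one_le₀ (by linarith))
          hx.1 hx.2⟩
    · rw [← hu r, real_inner_comm, ← hr u, E.symm, real_inner_comm]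
  have hmeas := (Lp.stronglyMeasurable (u : L2 m)).measurable
  have hA : MeasurableSet {x | 0 < (u : L2 m) x} := measurableSet_lt measurable_const hmeas
  have hB : MeasurableSet {x | (u : L2 m) x < 0} := measurableSet_lt hmeas measurable_const
  set sp : L2 m := indicatorConstLp 2 hA (measure_ne_top _ _) 1
  set sm : L2 m := indicatorConstLp 2 hB (measure_ne_top _ _) 1
  have hsp : sp =ᵐ[m] _ := indicatorConstLp_coeFn
  have hsm : sm =ᵐ[m] _ := indicatorConstLp_coeFn
  obtain ⟨rp, hrp, hp⟩ := hres sp (by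
    filter_upwards [hsp] with x hx
    rw [hx]
    by_cases h : x ∈ {x | 0 < (u : L2 m) x} <;> simp [h])
  obtain ⟨rm, hrm, hm⟩ := hres sm (by
    filter_upwards [hsm] with x hx
    rw [hx]
    by_cases h : x ∈ {x | (u : L2 m) x < 0} <;> simp [h])
  have h1 : ∫ x, |(u : L2 m) x| ∂m = inner ℝ (u : L2 m) (sp - sm) := by
    rw [inner_L2]
    refine integral_congr_ae ?_
    filter_upwards [hsp, hsm, Lp.coeFn_sub sp sm] with x h1 h2 h3
    rw [h3, Pi.sub_apply, h1, h2]
    rcases lt_trichotomy ((u : L2 m) x) 0 with h | h | h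
    · simp [h, not_lt.2 h.le, abs_of_neg]
    · simp [h]
    · simp [h, not_lt.2 h.le, abs_of_pos]
  rw [h1, inner_sub_right, hp, hm, ← inner_sub_right]
  refine inner_le_integral_abs ?_
  filter_upwards [hrp, hrm, Lp.coeFn_sub (rp : L2 m) (rm : L2 m)] with x h1 h2 h3
  rw [h3, Pi.sub_apply, abs_le]
  constructor <;> linarith [h1.1, h1.2, h2.1, h2.2]

end Markov

end FracWave

/-! ### From Nash's inequality to ultracontractivity. -/

namespace FracWave

/-- A discrete form of Nash's differential inequality. -/
lemma exists_bound_of_nash {c ν : ℝ} (hc : 0 < c) (hν : 0 < ν) : ∃ K : ℝ, 0 < K ∧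
    ∀ (h : ℝ) (y : ℕ → ℝ), 0 < h → (∀ k, 0 ≤ y k) →
      (∀ k, y (k + 1) + c * h * y (k + 1) ^ (1 + ν) ≤ y k) → y 0 ≤ K * h ^ (-ν⁻¹) →
      ∀ n : ℕ, y (n + 1) ≤ K * (((n + 1 : ℕ) : ℝ) * h) ^ (-ν⁻¹) := by
  set b := ν⁻¹ with hb
  have hb0 : 0 < b := inv_pos.2 hν
  -- D is chosen so that (1 + 1/(k+1))^b ≤ 1 + D/(k+2); K is then determined by c K^ν = D.
  set D := 2 * (b * Real.exp b) with hD
  have hD0 : 0 < D := by positivity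
  have hpow : ∀ k : ℕ, (1 + 1 / ((k : ℝ) + 1)) ^ b ≤ 1 + D / ((k : ℝ) + 2) := by
    intro k
    set x := 1 / ((k : ℝ) + 1) with hx
    have hx0 : 0 < x := by positivity
    have hx1 : x ≤ 1 := by rw [hx, div_le_one (by positivity)]; linarith [(Nat.cast_nonneg k : (0:ℝ) ≤ k)]
    have h1 : (1 + x) ^ b ≤ Real.exp (b * x) := by
      rw [mul_comm, Real.exp_mul]
      exact Real.rpow_le_rpow (by positivity) (by linarith [Real.add_one_le_exp x]) hb0.le
    have h2 : Real.exp (b * x) ≤ 1 + b * x * Real.exp (b * x) := by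
      have h3 := Real.add_one_le_exp (-(b * x))
      have h4 : Real.exp (-(b * x)) * Real.exp (b * x) = 1 := by rw [← Real.exp_add]; simp
      have := mul_le_mul_of_nonneg_right h3 (Real.exp_pos (b * x)).le
      rw [h4] at this
      linarith
    have h3 : Real.exp (b * x) ≤ Real.exp b := Real.exp_le_exp.2 (by nlinarith)
    have h4 : x ≤ 2 / ((k : ℝ) + 2) := by
      rw [hx, div_le_div_iff₀ (by positivity) (by positivity)]
      linarith [(Nat.cast_nonneg k : (0:ℝ) ≤ k)]
    calc (1 + x) ^ b ≤ 1 + b * x * Real.exp (b * x) := h1.trans h2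
      _ ≤ 1 + b * (2 / ((k : ℝ) + 2)) * Real.exp b := by gcongr
      _ = 1 + D / ((k : ℝ) + 2) := by rw [hD]; ring
  refine ⟨(D / c) ^ b, by positivity, fun h y hh hy hrec h0 n => ?_⟩
  set K := (D / c) ^ b with hK
  have hK0 : 0 < K := by positivity
  have hKν : c * K ^ ν = D := by
    rw [hK, ← Real.rpow_mul (by positivity), hb, inv_mul_cancel₀ hν.ne', Real.rpow_one]
    field_simp
  induction n with
  | zero =>
    have h1 := hrec 0
    have : 0 ≤ c * h * y (0 + 1) ^ (1 + ν) := by have := hy (0 + 1); positivity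
    simp only [zero_add, Nat.cast_one, one_mul] at h1 this ⊢
    linarith
  | succ k ih =>
    -- If y(k+2) exceeded Z = K((k+2)h)^(-b), the recursion would force y(k+1) > Z(1 + D/(k+2)) ≥
    -- Z(1 + 1/(k+1))^b = K((k+1)h)^(-b), against the induction hypothesis.
    by_contra! hcon
    set Z := K * (((k + 1 + 1 : ℕ) : ℝ) * h) ^ (-b) with hZ
    have hkh : 0 < ((k + 1 + 1 : ℕ) : ℝ) * h := by positivity
    have hZ0 : 0 < Z := by positivity
    have hZν : c * h * Z ^ ν = D / ((k : ℝ) + 2) := by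
      rw [hZ, Real.mul_rpow hK0.le (by positivity), ← Real.rpow_mul hkh.le, hb, neg_mul,
        inv_mul_cancel₀ hν.ne', Real.rpow_neg_one, ← hKν]
      push_cast
      field_simp
      try ring
    have h1 : Z * (1 + D / ((k : ℝ) + 2)) < y (k + 1) := by
      have h2 := hrec (k + 1)
      have h3 : c * h * Z ^ (1 + ν) ≤ c * h * y (k + 1 + 1) ^ (1 + ν) := by gcongr
      rw [Real.rpow_add hZ0, Real.rpow_one] at h3
      rw [← hZν]
      linarith
    have h4 : K * (((k + 1 : ℕ) : ℝ) * h) ^ (-b) = Z * (1 + 1 / ((k : ℝ) + 1)) ^ b := by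
      have h5 : ((k + 1 + 1 : ℕ) : ℝ) * h = (1 + 1 / ((k : ℝ) + 1)) * (((k + 1 : ℕ) : ℝ) * h) := by
        push_cast; field_simp
      have h6 : (0:ℝ) < 1 + 1 / ((k : ℝ) + 1) := by positivity
      rw [hZ, h5, Real.mul_rpow h6.le (by positivity), Real.rpow_neg h6.le]
      have h7 : (0:ℝ) < (1 + 1 / ((k : ℝ) + 1)) ^ b := by positivity
      generalize (1 + 1 / ((k : ℝ) + 1)) ^ b = A at h7 ⊢
      generalize (((k + 1 : ℕ) : ℝ) * h) ^ (-b) = B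
      field_simp
    rw [h4] at ih
    have h6 := mul_le_mul_of_nonneg_left (hpow k) hZ0.le
    linarith

lemma thetaA_pos {q : ℝ≥0∞} (hq : 1 < q) : 0 < thetaA q := by
  have h : (q⁻¹).toReal < 1 := by
    have : q⁻¹ < 1 := ENNReal.inv_lt_one.2 hq
    simpa using (ENNReal.toReal_lt_toReal (ne_top_of_lt this) ENNReal.one_ne_top).2 this
  unfold thetaA
  have : 0 < 1 - (q⁻¹).toReal := by linarith
  positivity

/-- Interpolation between `L¹` and `L^{2q}`. -/
lemma eLpNorm_two_le_interpolation {X : Type*} [MeasurableSpace X] {m : Measure X} {f : X → ℝ}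
    (hf : AEStronglyMeasurable f m) {q : ℝ≥0∞} (hq : 1 < q) :
    eLpNorm f 2 m ≤ eLpNorm f 1 m ^ ((1 - (q⁻¹).toReal) / (2 - (q⁻¹).toReal)) *
      eLpNorm f (2 * q) m ^ (1 / (2 - (q⁻¹).toReal)) := by
  set κ := (q⁻¹).toReal with hκ
  have hq1 : q⁻¹ < 1 := ENNReal.inv_lt_one.2 hq
  have hκ1 : κ < 1 := by
    exact (ENNReal.toReal_lt_toReal (ne_top_of_lt hq1) ENNReal.one_ne_top).2 hq1
  have hκ0 : 0 ≤ κ := ENNReal.toReal_nonneg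
  have hqκ : q = (ENNReal.ofReal κ)⁻¹ := by
    rw [hκ, ENNReal.ofReal_toReal (ne_top_of_lt hq1), inv_inv]
  have h2κ : 0 < 2 - κ := by linarith
  -- Hölder for |f|^a |f|^b with exponents 1/a and 2q/b, from a + b = 1 and a + bκ/2 = 1/2. Working
  -- with κ = 1/q includes q = ∞.
  set a := (1 - κ) / (2 - κ) with ha
  set b := 1 / (2 - κ) with hb
  have ha0 : 0 < a := div_pos (by linarith) h2κ
  have hb0 : 0 < b := by positivity
  set P : ℝ≥0∞ := (ENNReal.ofReal a)⁻¹ with hP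
  set Q : ℝ≥0∞ := (ENNReal.ofReal (b * κ / 2))⁻¹ with hQ
  have hPQ : ENNReal.HolderTriple P Q 2 := by
    refine ⟨?_⟩
    rw [hP, hQ, inv_inv, inv_inv, ← ENNReal.ofReal_add ha0.le (by positivity)]
    have : a + b * κ / 2 = 2⁻¹ := by rw [ha, hb]; field_simp; ring
    rw [this, ENNReal.ofReal_inv_of_pos two_pos, ENNReal.ofReal_ofNat]
  have hPa : P * ENNReal.ofReal a = 1 := by
    rw [hP, ENNReal.inv_mul_cancel (by simpa using ha0) ENNReal.ofReal_ne_top]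
  have hQb : Q * ENNReal.ofReal b = 2 * q := by
    have hb1 : ENNReal.ofReal b ≠ 0 := by simpa using hb0
    rw [hQ, hqκ, show b * κ / 2 = b * (κ * 2⁻¹) by ring, ENNReal.ofReal_mul hb0.le,
      ENNReal.ofReal_mul hκ0, ENNReal.ofReal_inv_of_pos two_pos, ENNReal.ofReal_ofNat,
      ENNReal.mul_inv (Or.inl hb1) (Or.inl ENNReal.ofReal_ne_top),
      ENNReal.mul_inv (Or.inr (by simp)) (Or.inl ENNReal.ofReal_ne_top), inv_inv, mul_comm,
      ← mul_assoc, ENNReal.mul_inv_cancel hb1 ENNReal.ofReal_ne_top, one_mul, mul_comm]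
  have hm1 : AEStronglyMeasurable (fun x => ‖f x‖ ^ a) m :=
    (hf.norm.aemeasurable.pow_const a).aestronglyMeasurable
  have hm2 : AEStronglyMeasurable (fun x => ‖f x‖ ^ b) m :=
    (hf.norm.aemeasurable.pow_const b).aestronglyMeasurable
  have h := eLpNorm_smul_le_mul_eLpNorm (p := P) (q := Q) (r := 2) hm2 hm1
  rw [eLpNorm_norm_rpow f ha0, eLpNorm_norm_rpow f hb0, hPa, hQb] at h
  refine le_trans (le_of_eq ?_) h
  rw [← eLpNorm_norm]
  congr 1
  ext x
  rw [Pi.smul_apply', smul_eq_mul, ← Real.rpow_add_of_nonneg (norm_nonneg _) ha0.le hb0.le]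
  have : a + b = 1 := by rw [ha, hb]; field_simp; ring
  rw [this, Real.rpow_one]

section Ultracontractive

variable {X : Type*} [MeasurableSpace X] {m : Measure X} [IsFiniteMeasure m] {E : DirichletForm m}

/-- Nash's inequality. -/
lemma DirichletForm.SobolevEmbedding.nash {q : ℝ≥0∞} (hq : 1 < q) (hE : E.SobolevEmbedding q) :
    ∃ C : ℝ, 0 < C ∧ ∀ u : E.dom, ∫ x, |(u : L2 m) x| ∂m ≤ 1 →
      (‖(u : L2 m)‖ ^ 2) ^ (1 + (1 - (q⁻¹).toReal)) ≤ C * (E.form u u + ‖(u : L2 m)‖ ^ 2) := by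
  obtain ⟨C, hC⟩ := hE
  refine ⟨(C + 1) ^ 2, by positivity, fun u hu => ?_⟩
  set κ := (q⁻¹).toReal with hκ
  have hq1 : q⁻¹ < 1 := ENNReal.inv_lt_one.2 hq
  have hκ1 : κ < 1 := by
    exact (ENNReal.toReal_lt_toReal (ne_top_of_lt hq1) ENNReal.one_ne_top).2 hq1
  have hκ0 : 0 ≤ κ := ENNReal.toReal_nonneg
  have h2κ : 0 < 2 - κ := by linarith
  have h := eLpNorm_two_le_interpolation (Lp.aestronglyMeasurable (u : L2 m)) hq
  have h1 : eLpNorm (u : L2 m) 1 m ≤ 1 := by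
    rw [eLpNorm_one_eq_lintegral_enorm, ← ofReal_integral_norm_eq_lintegral_enorm (integrable_L2 _)]
    simpa using hu
  have hEn : 0 ≤ E.form u u + ‖(u : L2 m)‖ ^ 2 := add_nonneg (E.nonneg u) (sq_nonneg _)
  set B := E.form u u + ‖(u : L2 m)‖ ^ 2 with hB
  -- With ‖u‖₁ ≤ 1 only the L^{2q} factor of the interpolation remains; the power 2(2-κ) then gives
  -- Nash's inequality. C + 1 replaces C to keep the constant positive.
  have h2 : eLpNorm (u : L2 m) 2 m ≤ ENNReal.ofReal (((C + 1) * √B) ^ (1 / (2 - κ))) := by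
    refine h.trans ?_
    rw [← one_mul (ENNReal.ofReal _)]
    refine mul_le_mul' ?_ ?_
    · exact ENNReal.rpow_le_one h1 (div_nonneg (by linarith) h2κ.le)
    · rw [← ENNReal.ofReal_rpow_of_nonneg (by positivity) (by positivity)]
      refine ENNReal.rpow_le_rpow ((hC u).trans ?_) (by positivity)
      rw [ENNReal.ofReal_mul (by positivity)]
      gcongr
      rw [← ENNReal.ofReal_coe_nnreal]
      exact ENNReal.ofReal_le_ofReal (by linarith)
  have h3 : ‖(u : L2 m)‖ ≤ ((C + 1) * √B) ^ (1 / (2 - κ)) := by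
    rw [Lp.norm_def]
    exact ENNReal.toReal_le_of_le_ofReal (by positivity) h2
  calc (‖(u : L2 m)‖ ^ 2) ^ (1 + (1 - κ)) ≤
      ((((C + 1) * √B) ^ (1 / (2 - κ))) ^ 2) ^ (1 + (1 - κ)) := by
        refine Real.rpow_le_rpow (by positivity) ?_ (by linarith)
        gcongr
    _ = ((C + 1) * √B) ^ 2 := by
        rw [← Real.rpow_natCast, ← Real.rpow_mul (by positivity), ← Real.rpow_mul (by positivity),
          ← Real.rpow_natCast]
        congr 1
        push_cast
        field_simp
        ring
    _ = (C + 1) ^ 2 * B := by rw [mul_pow, Real.sq_sqrt hEn]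

/-- Implicit Euler takes the place of the heat semigroup. The time t = 1/Λ is split into n+1
resolvent steps, each an L¹ contraction, so Nash's inequality yields ‖g_{n+1}‖² ≤ K t^(-1/ν) = K
Λ^(2θ_A), independently of n and of ‖g‖₂. On modes with 1 + λ ≤ Λ the n+1 steps shrink a coefficient
by at most the factor e. -/
lemma EigenSystem.exists_sum_sq_le_of_integral_le (S : EigenSystem E) {q : ℝ≥0∞} (hq : 1 < q)
    (hE : E.SobolevEmbedding q) : ∃ C : ℝ, 0 < C ∧ ∀ (g : L2 m) (F : Finset S.ι) (Λ : ℝ), 0 < Λ →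
      (∀ i ∈ F, 1 + S.eigenvalue i ≤ Λ) → ∫ x, |g x| ∂m ≤ 1 →
      ∑ i ∈ F, inner ℝ (S.basis i) g ^ 2 ≤ C * Λ ^ (2 * thetaA q) := by
  obtain ⟨C, hC, hnash⟩ := hE.nash hq
  set ν := 1 - (q⁻¹).toReal with hν
  have hq1 : q⁻¹ < 1 := ENNReal.inv_lt_one.2 hq
  have hν0 : 0 < ν := by
    have := (ENNReal.toReal_lt_toReal (ne_top_of_lt hq1) ENNReal.one_ne_top).2 hq1
    simp only [ENNReal.toReal_one] at this
    linarith
  have hθ : 2 * thetaA q = ν⁻¹ := by rw [thetaA, ← hν]; field_simp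
  obtain ⟨K, hK, hiter⟩ := exists_bound_of_nash (c := 2 / C) (ν := ν) (by positivity) hν0
  refine ⟨Real.exp 2 * K, by positivity, fun g F Λ hΛ hF hg => ?_⟩
  set t := Λ⁻¹ with ht
  have ht0 : 0 < t := by positivity
  have hb : 0 < ν⁻¹ := inv_pos.2 hν0
  -- n depends on g: the steps are made so short that ‖g‖² itself meets the initial bound of
  -- `exists_bound_of_nash`.
  obtain ⟨n, hn⟩ : ∃ n : ℕ, ‖g‖ ^ 2 ≤ K * (t / ((n + 1 : ℕ) : ℝ)) ^ (-ν⁻¹) := by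
    have h1 : Tendsto (fun n : ℕ => K * ((((n + 1 : ℕ) : ℝ) / t)) ^ ν⁻¹) atTop atTop := by
      refine Tendsto.const_mul_atTop hK ((tendsto_rpow_atTop hb).comp ?_)
      exact ((tendsto_natCast_atTop_atTop (R := ℝ)).comp (tendsto_add_atTop_nat 1)).atTop_div_const
        ht0
    obtain ⟨n, hn⟩ := (h1.eventually_ge_atTop (‖g‖ ^ 2)).exists
    refine ⟨n, hn.trans (le_of_eq ?_)⟩
    rw [Real.rpow_neg (by positivity), ← Real.inv_rpow (by positivity), inv_div]
  set h := t / ((n + 1 : ℕ) : ℝ) with hh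
  have hh0 : 0 < h := by positivity
  choose R hR1 hR2 using S.exists_resolvent hh0
  set gk : ℕ → L2 m := fun k => Nat.rec g (fun _ f => ((R f : E.dom) : L2 m)) k with hgk
  have hgs : ∀ k, gk (k + 1) = (R (gk k) : L2 m) := fun k => rfl
  have hL1 : ∀ k, ∫ x, |gk k x| ∂m ≤ 1 := by
    intro k
    induction k with
    | zero => exact hg
    | succ k ih => exact (S.integral_abs_resolvent_le hh0 (hR2 (gk k))).trans ih
  have hcoef : ∀ k i, inner ℝ (S.basis i) (gk k) =
      inner ℝ (S.basis i) g / (1 + h * (1 + S.eigenvalue i)) ^ k := by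
    intro k i
    induction k with
    | zero => simp [hgk]
    | succ k ih => rw [hgs, hR1, ih, div_div, pow_succ]
  have hy := hiter h (fun k => ‖gk k‖ ^ 2) hh0 (fun k => sq_nonneg _) (fun k => by
    have h1 := hR2 (gk k) (R (gk k))
    have h2 := hnash (R (gk k)) (hL1 (k + 1))
    rw [real_inner_self_eq_norm_sq] at h1
    have h3 := real_inner_le_norm (gk k) (R (gk k) : L2 m)
    -- Young's inequality turns the energy identity into ‖u‖² + 2h(E(u,u) + ‖u‖²) ≤ ‖g‖²; with
    -- Nash's constant C this explains 2/C.
    have h4 : ‖gk k‖ * ‖(R (gk k) : L2 m)‖ ≤ (‖gk k‖ ^ 2 + ‖(R (gk k) : L2 m)‖ ^ 2) / 2 := by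
      nlinarith [sq_nonneg (‖gk k‖ - ‖(R (gk k) : L2 m)‖)]
    simp only [hgs]
    have h5 : 2 / C * h * (‖(R (gk k) : L2 m)‖ ^ 2) ^ (1 + ν) ≤
        2 * (h * (E.form (R (gk k)) (R (gk k)) + ‖(R (gk k) : L2 m)‖ ^ 2)) := by
      calc 2 / C * h * (‖(R (gk k) : L2 m)‖ ^ 2) ^ (1 + ν) ≤ 2 / C * h *
          (C * (E.form (R (gk k)) (R (gk k)) + ‖(R (gk k) : L2 m)‖ ^ 2)) := by gcongr
        _ = _ := by field_simp
    linarith) hn n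
  have hnh : ((n + 1 : ℕ) : ℝ) * h = t := by rw [hh]; field_simp
  have hN := hy
  simp only [hnh] at hN
  have hN' : K * t ^ (-ν⁻¹) = K * Λ ^ (2 * thetaA q) := by
    rw [hθ, ht, Real.rpow_neg (by positivity), Real.inv_rpow hΛ.le, inv_inv]
  rw [hN'] at hN
  calc ∑ i ∈ F, inner ℝ (S.basis i) g ^ 2
      ≤ ∑ i ∈ F, Real.exp 2 * inner ℝ (S.basis i) (gk (n + 1)) ^ 2 := by
        refine Finset.sum_le_sum fun i hi => ?_
        have hμ := S.one_le_add_eigenvalue i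
        have hp : 0 < (1 + h * (1 + S.eigenvalue i)) ^ (n + 1) := by positivity
        have he : (1 + h * (1 + S.eigenvalue i)) ^ (n + 1) ≤ Real.exp 1 := by
          calc (1 + h * (1 + S.eigenvalue i)) ^ (n + 1)
              ≤ (Real.exp (h * (1 + S.eigenvalue i))) ^ (n + 1) := by
                gcongr
                linarith [Real.add_one_le_exp (h * (1 + S.eigenvalue i))]
            _ = Real.exp (((n + 1 : ℕ) : ℝ) * h * (1 + S.eigenvalue i)) := by
                rw [← Real.exp_nat_mul, mul_assoc]
            _ ≤ Real.exp 1 := by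
                rw [hnh, Real.exp_le_exp, ht, inv_mul_le_iff₀ hΛ, mul_one]
                exact hF i hi
        have h2 : ((1 + h * (1 + S.eigenvalue i)) ^ (n + 1)) ^ 2 ≤ Real.exp 2 := by
          calc _ ≤ Real.exp 1 ^ 2 := by gcongr
            _ = Real.exp 2 := by rw [← Real.exp_nat_mul]; norm_num
        rw [hcoef (n + 1) i, div_pow, mul_div_assoc', le_div_iff₀ (by positivity), mul_comm]
        gcongr
    _ ≤ Real.exp 2 * ‖gk (n + 1)‖ ^ 2 := by
        rw [← Finset.mul_sum]
        gcongr
        exact sum_le_hasSum F (fun i _ => sq_nonneg _) (S.tsum_inner_sq _)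
    _ ≤ Real.exp 2 * (K * Λ ^ (2 * thetaA q)) := by gcongr
    _ = _ := by ring

/-- Ultracontractivity, as a bound of spectral projections from `L¹` to `L²`. -/
theorem EigenSystem.exists_sum_sq_le (S : EigenSystem E) {q : ℝ≥0∞} (hq : 1 < q)
    (hE : E.SobolevEmbedding q) : ∃ C : ℝ, 0 < C ∧ ∀ (g : L2 m) (F : Finset S.ι) (Λ : ℝ), 0 < Λ →
      (∀ i ∈ F, 1 + S.eigenvalue i ≤ Λ) →
      ∑ i ∈ F, inner ℝ (S.basis i) g ^ 2 ≤ C * Λ ^ (2 * thetaA q) * (∫ x, |g x| ∂m) ^ 2 := by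
  obtain ⟨C, hC, h⟩ := S.exists_sum_sq_le_of_integral_le hq hE
  refine ⟨C, hC, fun g F Λ hΛ hF => ?_⟩
  set L := ∫ x, |g x| ∂m with hL
  have hL0 : 0 ≤ L := integral_nonneg fun x => abs_nonneg _
  rcases hL0.eq_or_lt with h0 | h0
  · have h1 : (fun x => |g x|) =ᵐ[m] 0 :=
      (integral_eq_zero_iff_of_nonneg (fun x => abs_nonneg _) (integrable_L2 g).abs).1 h0.symm
    have h2 : g = 0 := by
      refine Lp.ext ?_
      filter_upwards [h1, Lp.coeFn_zero ℝ 2 m] with x hx hx2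
      rw [hx2]
      simpa using hx
    simp [h2]
    positivity
  · have h1 := h (L⁻¹ • g) F Λ hΛ hF (by
      have h2 : ∫ x, |(L⁻¹ • g : L2 m) x| ∂m = L⁻¹ * L := by
        rw [hL, ← integral_const_mul]
        refine integral_congr_ae ?_
        filter_upwards [Lp.coeFn_smul L⁻¹ g] with x hx
        rw [hx, Pi.smul_apply, smul_eq_mul, abs_mul, abs_of_pos (inv_pos.2 h0)]
      rw [h2, inv_mul_cancel₀ h0.ne'])
    have h2 : ∑ i ∈ F, inner ℝ (S.basis i) (L⁻¹ • g) ^ 2 =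
        L⁻¹ ^ 2 * ∑ i ∈ F, inner ℝ (S.basis i) g ^ 2 := by
      rw [Finset.mul_sum]
      refine Finset.sum_congr rfl fun i _ => ?_
      rw [inner_smul_right, mul_pow]
    rw [h2, inv_pow, inv_mul_le_iff₀ (by positivity)] at h1
    linarith

end Ultracontractive

end FracWave

/-! ### Dyadic sums, L¹ duality and tail integrals. -/

namespace FracWave

lemma sum_le_of_shells {ι : Type*} (F : Finset ι) (k : ι → ℕ) {b : ι → ℝ} {B r : ℝ} (hr0 : 0 ≤ r)
    (hr1 : r < 1) (hB : 0 ≤ B) (h : ∀ n, ∑ i ∈ F with k i = n, b i ≤ B * r ^ n) :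
    ∑ i ∈ F, b i ≤ B * (1 - r)⁻¹ := by
  classical
  rw [← Finset.sum_fiberwise_of_maps_to (t := F.image k) (g := k)
    (fun i hi => Finset.mem_image_of_mem k hi)]
  calc _ ≤ ∑ n ∈ F.image k, B * r ^ n := Finset.sum_le_sum fun n _ => h n
    _ ≤ _ := sum_le_hasSum _ (fun n _ => by positivity) ((hasSum_geometric_of_lt_one hr0 hr1).mul_left B)

/-- Dyadic decomposition above level one. -/
lemma sum_rpow_mul_le_of_lt {ι : Type*} {μ a : ι → ℝ} (hμ : ∀ i, 1 ≤ μ i) (ha : ∀ i, 0 ≤ a i)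
    {D θ s : ℝ} (hD : 0 ≤ D) (hs : θ < s) (hs0 : 0 ≤ s)
    (h : ∀ (F : Finset ι) (Λ : ℝ), 0 < Λ → (∀ i ∈ F, μ i ≤ Λ) → ∑ i ∈ F, a i ≤ D * Λ ^ (2 * θ))
    (F : Finset ι) :
    ∑ i ∈ F, μ i ^ (-(2 * s)) * a i ≤ D * 2 ^ (2 * θ) * (1 - 2 ^ (2 * (θ - s)))⁻¹ := by
  -- The shell 2^n ≤ μ < 2^(n+1) contributes at most D 2^(2θ) 2^(2(θ-s)n), a convergent series since
  -- s > θ.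
  have hk : ∀ i, ∃ k : ℕ, (2:ℝ) ^ k ≤ μ i ∧ μ i < 2 ^ (k + 1) := fun i =>
    exists_nat_pow_near (hμ i) one_lt_two
  choose k hk1 hk2 using hk
  refine sum_le_of_shells F k (by positivity)
    (Real.rpow_lt_one_of_one_lt_of_neg one_lt_two (by linarith)) (by positivity) fun n => ?_
  calc ∑ i ∈ F with k i = n, μ i ^ (-(2 * s)) * a i
      ≤ ∑ i ∈ F with k i = n, ((2:ℝ) ^ n) ^ (-(2 * s)) * a i := by
        refine Finset.sum_le_sum fun i hi => ?_
        have hi := (Finset.mem_filter.1 hi).2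
        refine mul_le_mul_of_nonneg_right ?_ (ha i)
        refine Real.rpow_le_rpow_of_nonpos (by positivity) ?_ (by linarith)
        rw [← hi]; exact hk1 i
    _ = ((2:ℝ) ^ n) ^ (-(2 * s)) * ∑ i ∈ F with k i = n, a i := by rw [Finset.mul_sum]
    _ ≤ ((2:ℝ) ^ n) ^ (-(2 * s)) * (D * ((2:ℝ) ^ (n + 1)) ^ (2 * θ)) := by
        refine mul_le_mul_of_nonneg_left (h _ _ (by positivity) fun i hi => ?_) (by positivity)
        have hi := (Finset.mem_filter.1 hi).2
        rw [← hi]; exact (hk2 i).le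
    _ = _ := by
        rw [← Real.rpow_natCast, ← Real.rpow_natCast, ← Real.rpow_natCast, ← Real.rpow_mul two_pos.le,
          ← Real.rpow_mul two_pos.le, ← Real.rpow_mul two_pos.le, mul_left_comm, mul_assoc,
          ← Real.rpow_add two_pos, ← Real.rpow_add two_pos]
        congr 2
        push_cast
        ring

/-- Dyadic decomposition below level `Λ`. -/
lemma sum_rpow_mul_le_of_gt {ι : Type*} {μ a : ι → ℝ} (hμ : ∀ i, 1 ≤ μ i) (ha : ∀ i, 0 ≤ a i)
    {D θ s : ℝ} (hD : 0 ≤ D) (hs : s < θ) (hs0 : 0 ≤ s)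
    (h : ∀ (F : Finset ι) (Λ : ℝ), 0 < Λ → (∀ i ∈ F, μ i ≤ Λ) → ∑ i ∈ F, a i ≤ D * Λ ^ (2 * θ))
    (F : Finset ι) {Λ : ℝ} (hΛ : 0 < Λ) (hF : ∀ i ∈ F, μ i ≤ Λ) :
    ∑ i ∈ F, μ i ^ (-(2 * s)) * a i ≤
      D * 2 ^ (2 * s) * (1 - 2 ^ (2 * (s - θ)))⁻¹ * Λ ^ (2 * (θ - s)) := by
  -- Shells are counted downwards from Λ, so that 2^(2(s-θ)n) decays. Indices with μ > Λ do not
  -- occur in F and get a dummy value.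
  have hk : ∀ i, ∃ k : ℕ, μ i ≤ Λ → Λ * (2:ℝ) ^ (-((k : ℝ) + 1)) ≤ μ i ∧
      μ i ≤ Λ * (2:ℝ) ^ (-(k:ℝ)) := fun i => by
    have hi := hμ i
    by_cases hΛi : μ i ≤ Λ
    · obtain ⟨k, h1, h2⟩ := exists_nat_pow_near
        ((one_le_div₀ (by linarith)).2 hΛi : 1 ≤ Λ / μ i) one_lt_two
      refine ⟨k, fun _ => ?_⟩
      rw [Real.rpow_neg two_pos.le, Real.rpow_neg two_pos.le, ← div_eq_mul_inv, ← div_eq_mul_inv,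
        div_le_iff₀ (by positivity), le_div_iff₀ (by positivity)]
      rw [le_div_iff₀ (by linarith)] at h1
      rw [div_lt_iff₀ (by linarith)] at h2
      have : (2:ℝ) ^ ((k:ℝ) + 1) = 2 ^ (k + 1) := by rw [← Real.rpow_natCast]; push_cast; rfl
      rw [this, Real.rpow_natCast]
      constructor <;> linarith
    · exact ⟨0, fun h => absurd h hΛi⟩
  choose k hk using hk
  have hr : (2:ℝ) ^ (2 * (s - θ)) < 1 :=
    Real.rpow_lt_one_of_one_lt_of_neg one_lt_two (by linarith)
  rw [mul_right_comm]
  refine sum_le_of_shells F k (by positivity) hr (by positivity) fun n => ?_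
  calc ∑ i ∈ F with k i = n, μ i ^ (-(2 * s)) * a i
      ≤ ∑ i ∈ F with k i = n, (Λ * (2:ℝ) ^ (-((n : ℝ) + 1))) ^ (-(2 * s)) * a i := by
        refine Finset.sum_le_sum fun i hi => ?_
        obtain ⟨h1, hi⟩ := Finset.mem_filter.1 hi
        refine mul_le_mul_of_nonneg_right ?_ (ha i)
        refine Real.rpow_le_rpow_of_nonpos (by positivity) ?_ (by linarith)
        rw [← hi]; exact (hk i (hF i h1)).1
    _ = (Λ * (2:ℝ) ^ (-((n : ℝ) + 1))) ^ (-(2 * s)) * ∑ i ∈ F with k i = n, a i := by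
        rw [Finset.mul_sum]
    _ ≤ (Λ * (2:ℝ) ^ (-((n : ℝ) + 1))) ^ (-(2 * s)) * (D * (Λ * (2:ℝ) ^ (-(n:ℝ))) ^ (2 * θ)) := by
        refine mul_le_mul_of_nonneg_left (h _ _ (by positivity) fun i hi => ?_) (by positivity)
        obtain ⟨h1, hi⟩ := Finset.mem_filter.1 hi
        rw [← hi]; exact (hk i (hF i h1)).2
    _ = D * ((2:ℝ) ^ (-((n : ℝ) + 1) * (-(2 * s))) * 2 ^ (-(n : ℝ) * (2 * θ))) *
        (Λ ^ (-(2 * s)) * Λ ^ (2 * θ)) := by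
        rw [Real.mul_rpow hΛ.le (by positivity), Real.mul_rpow hΛ.le (by positivity),
          ← Real.rpow_mul two_pos.le, ← Real.rpow_mul two_pos.le]
        ring
    _ = D * ((2:ℝ) ^ (2 * s) * 2 ^ (2 * (s - θ) * n)) * Λ ^ (2 * (θ - s)) := by
        rw [← Real.rpow_add two_pos, ← Real.rpow_add two_pos, ← Real.rpow_add hΛ]
        congr 3 <;> ring
    _ = _ := by
        rw [Real.rpow_mul two_pos.le _ (n : ℝ), Real.rpow_natCast]
        ring

section L2lemmas

variable {X : Type*} [MeasurableSpace X] {m : Measure X}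

/-- Testing with g = ±1_s compares the integrals of ±u and of K over every measurable set s. -/
lemma ae_abs_le_of_inner_le [IsFiniteMeasure m] {u : L2 m} {K : ℝ}
    (h : ∀ g : L2 m, inner ℝ u g ≤ K * ∫ x, |g x| ∂m) : ∀ᵐ x ∂m, |u x| ≤ K := by
  have key : ∀ σ : ℝ, |σ| = 1 → ∀ᵐ x ∂m, σ * u x ≤ K := by
    intro σ hσ
    refine ae_le_of_forall_setIntegral_le ((integrable_L2 u).const_mul σ) (integrable_const K)
      fun s hs hms => ?_
    have h1 := h (indicatorConstLp 2 hs hms.ne σ)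
    have h2 : inner ℝ u (indicatorConstLp 2 hs hms.ne σ) = ∫ x in s, σ * u x ∂m := by
      rw [inner_L2, ← integral_indicator hs]
      refine integral_congr_ae ?_
      filter_upwards [indicatorConstLp_coeFn (p := 2) (hs := hs) (hμs := hms.ne) (c := σ)] with x hx
      rw [hx]
      by_cases hxs : x ∈ s <;> simp [hxs, mul_comm]
    have h3 : ∫ x, |(indicatorConstLp 2 hs hms.ne σ : L2 m) x| ∂m = ∫ x in s, (1:ℝ) ∂m := by
      rw [← integral_indicator hs]
      refine integral_congr_ae ?_
      filter_upwards [indicatorConstLp_coeFn (p := 2) (hs := hs) (hμs := hms.ne) (c := σ)] with x hx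
      rw [hx]
      by_cases hxs : x ∈ s <;> simp [hxs, hσ]
    rw [h2, h3, ← integral_const_mul, mul_one] at h1
    exact h1
  filter_upwards [key 1 (by simp), key (-1) (by simp)] with x h1 h2
  rw [abs_le]
  constructor <;> linarith

/-- L² convergence provides an almost everywhere convergent subsequence, along which Fatou's lemma
preserves the bound. -/
lemma isClosed_setOf_eLpNorm_le (p : ℝ≥0∞) (K : ℝ≥0∞) :
    IsClosed {u : L2 m | eLpNorm u p m ≤ K} := by
  refine IsSeqClosed.isClosed fun u v hu hv => ?_
  have h1 : TendstoInMeasure m (fun n => (u n : X → ℝ)) atTop v :=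
    tendstoInMeasure_of_tendsto_Lp hv
  obtain ⟨ns, -, hns⟩ := h1.exists_seq_tendsto_ae
  refine (Lp.eLpNorm_lim_le_liminf_eLpNorm (fun n => Lp.aestronglyMeasurable (u (ns n))) _ hns).trans
    ?_
  exact liminf_le_of_le (by isBoundedDefault) fun b hb => by
    obtain ⟨n, hn⟩ := hb.exists
    exact hn.trans (hu _)

/-- Chebyshev's inequality. -/
lemma meas_lt_abs_le_div (w : L2 m) {t : ℝ} (ht : 0 < t) :
    m {x | t < |w x|} ≤ ENNReal.ofReal (‖w‖ ^ 2 / t ^ 2) := by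
  have h := mul_meas_ge_le_pow_eLpNorm' (μ := m) (p := 2) (by norm_num) (by norm_num)
    (Lp.aestronglyMeasurable w) (ENNReal.ofReal t)
  have h1 : eLpNorm w 2 m = ENNReal.ofReal ‖w‖ := by
    rw [Lp.norm_def, ENNReal.ofReal_toReal (Lp.eLpNorm_ne_top w)]
  rw [h1] at h
  simp only [ENNReal.toReal_ofNat, ENNReal.rpow_ofNat] at h
  rw [← ENNReal.ofReal_pow ht.le, ← ENNReal.ofReal_pow (norm_nonneg _)] at h
  rw [ENNReal.ofReal_div_of_pos (by positivity), ENNReal.le_div_iff_mul_le (Or.inl (by simpa using ht.ne')) (Or.inl ENNReal.ofReal_ne_top),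
    mul_comm]
  refine le_trans (mul_le_mul_right (measure_mono fun x hx => ?_) _) h
  simp only [Set.mem_ofPred_eq] at hx ⊢
  rw [← ofReal_norm, Real.norm_eq_abs]
  exact ENNReal.ofReal_le_ofReal (le_of_lt hx)

end L2lemmas

/-- The share of a single mode in the layer-cake integral: c ∫ t^(p-3) over (0, ℓ), finite because p
> 2. -/
lemma lintegral_rpow_Ioi_indicator_le {p ℓ : ℝ} (hp : 2 < p) (hℓ : 0 ≤ ℓ) (c : ℝ) (hc : 0 ≤ c) :
    ∫⁻ t in Ioi (0:ℝ), ENNReal.ofReal (if t < ℓ then c / t ^ 2 * t ^ (p - 1) else 0) ≤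
      ENNReal.ofReal (c * ℓ ^ (p - 2) / (p - 2)) := by
  have hint : IntervalIntegrable (fun t : ℝ => c * t ^ (p - 3)) volume 0 ℓ :=
    (intervalIntegral.intervalIntegrable_rpow' (by linarith)).const_mul c
  have hval : ∫ t in (0:ℝ)..ℓ, c * t ^ (p - 3) = c * ℓ ^ (p - 2) / (p - 2) := by
    rw [intervalIntegral.integral_const_mul, integral_rpow (Or.inl (by linarith))]
    rw [show p - 3 + 1 = p - 2 by ring, Real.zero_rpow (by linarith)]
    ring
  rw [intervalIntegrable_iff_integrableOn_Ioc_of_le hℓ] at hint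
  rw [← hval, intervalIntegral.integral_of_le hℓ, ofReal_integral_eq_lintegral_ofReal hint
    ((ae_restrict_iff' measurableSet_Ioc).2 (ae_of_all _ fun t ht => by
      have := ht.1; positivity)), ← lintegral_indicator measurableSet_Ioi,
      ← lintegral_indicator measurableSet_Ioc]
  refine lintegral_mono fun t => ?_
  by_cases h0 : t ∈ Ioi (0:ℝ)
  · have h0' : (0:ℝ) < t := h0
    by_cases h1 : t < ℓ
    · rw [indicator_of_mem h0, indicator_of_mem (show t ∈ Ioc 0 ℓ from ⟨h0', h1.le⟩), if_pos h1]
      refine ENNReal.ofReal_le_ofReal (le_of_eq ?_)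
      have : t ^ (p - 3) = t ^ (p - 1) / t ^ 2 := by
        rw [← Real.rpow_natCast t 2, ← Real.rpow_sub h0']
        congr 1
        push_cast
        ring
      rw [this]
      ring
    · rw [indicator_of_mem h0, if_neg h1]
      simp
  · rw [indicator_of_notMem h0]
    exact zero_le

end FracWave

/-! ### Embeddings of V_s into L^p and L^∞. -/

namespace FracWave

namespace EigenSystem

section Basic

variable {X : Type*} [MeasurableSpace X] {m : Measure X} {E : DirichletForm m}
  (S : EigenSystem E) (ε : S.Shift)

lemma hasSum_norm_sq {s : ℝ} (v : S.V ε s) :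
    HasSum (fun i => (S.weight ε s i * inner ℝ (S.basis i) (S.toL2Lin ε s v)) ^ 2) (‖v‖ ^ 2) := by
  have h := lp.hasSum_norm (p := 2) (by norm_num) (S.toSeq ε s v)
  have h1 : ‖v‖ = ‖S.toSeq ε s v‖ := rfl
  rw [h1]
  simpa [toSeq_apply, mul_pow] using h

lemma exists_one_add_eigenvalue_le : ∃ c : ℝ, 0 < c ∧ ∀ i,
    1 + S.eigenvalue i ≤ c * (S.eigenvalue i + ε.1) := by
  obtain ⟨hε, δ, hδ, h⟩ := ε.2
  refine ⟨1 + 1 / δ, by positivity, fun i => ?_⟩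
  have h1 : 1 ≤ 1 / δ * (S.eigenvalue i + ε.1) := by
    rw [one_div, inv_mul_eq_div, le_div_iff₀ hδ, one_mul]; exact h i
  rw [add_mul, one_mul]
  linarith

lemma exists_sum_rpow_mul_sq_le {s : ℝ} (hs : 0 ≤ s) : ∃ c : ℝ, 0 < c ∧ ∀ (v : S.V ε s)
    (F : Finset S.ι), ∑ i ∈ F, (1 + S.eigenvalue i) ^ (2 * s) *
      inner ℝ (S.basis i) (S.toL2Lin ε s v) ^ 2 ≤ c * ‖v‖ ^ 2 := by
  obtain ⟨c, hc, h⟩ := S.exists_one_add_eigenvalue_le ε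
  refine ⟨c ^ (2 * s), by positivity, fun v F => ?_⟩
  calc _ ≤ ∑ i ∈ F, c ^ (2 * s) * (S.weight ε s i * inner ℝ (S.basis i) (S.toL2Lin ε s v)) ^ 2 := by
        refine Finset.sum_le_sum fun i _ => ?_
        rw [mul_pow, ← mul_assoc]
        refine mul_le_mul_of_nonneg_right ?_ (sq_nonneg _)
        have hb := S.base_pos ε i
        have h1 := S.one_le_add_eigenvalue i
        calc _ ≤ (c * (S.eigenvalue i + ε.1)) ^ (2 * s) :=
              Real.rpow_le_rpow (by linarith) (h i) (by linarith)
          _ = _ := by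
            rw [Real.mul_rpow hc.le hb.le, weight, ← Real.rpow_natCast, ← Real.rpow_mul hb.le,
              mul_comm s]
            norm_num
    _ ≤ _ := by
        rw [← Finset.mul_sum]
        refine mul_le_mul_of_nonneg_left ?_ (by positivity)
        exact sum_le_hasSum F (fun i _ => sq_nonneg _) (S.hasSum_norm_sq ε v)

lemma inner_basis (i j : S.ι) [Decidable (i = j)] :
    inner ℝ (S.basis i) (S.basis j) = if i = j then 1 else 0 := by
  classical
  convert orthonormal_iff_ite.1 S.basis.orthonormal i j

lemma inner_sum_smul_basis (F : Finset S.ι) (c : S.ι → ℝ) (g : L2 m) :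
    inner ℝ (∑ i ∈ F, c i • S.basis i) g = ∑ i ∈ F, c i * inner ℝ (S.basis i) g := by
  rw [sum_inner]
  refine Finset.sum_congr rfl fun i _ => ?_
  rw [inner_smul_left]
  rfl

lemma norm_sq_sum_smul_basis (F : Finset S.ι) (c : S.ι → ℝ) :
    ‖∑ i ∈ F, c i • S.basis i‖ ^ 2 = ∑ i ∈ F, c i ^ 2 := by
  classical
  rw [← real_inner_self_eq_norm_sq, inner_sum_smul_basis]
  refine Finset.sum_congr rfl fun i hi => ?_
  rw [inner_sum, Finset.sum_eq_single i]
  · rw [inner_smul_right, inner_basis, if_pos rfl]; ring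
  · intro j _ hj
    rw [inner_smul_right, inner_basis, if_neg (Ne.symm hj), mul_zero]
  · exact fun h => absurd hi h

lemma hasSum_basis (u : L2 m) : HasSum (fun i => inner ℝ (S.basis i) u • S.basis i) u := by
  have := S.basis.hasSum_repr u
  simpa only [S.basis.repr_apply_apply] using this

end Basic

variable {X : Type*} [MeasurableSpace X] {m : Measure X} [IsFiniteMeasure m] {E : DirichletForm m}
  (S : EigenSystem E)

lemma sum_mul_le_sqrt {ι : Type*} (F : Finset ι) {μ : ι → ℝ} (hμ : ∀ i, 1 ≤ μ i) (s : ℝ)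
    (c g : ι → ℝ) :
    ∑ i ∈ F, c i * g i ≤ √(∑ i ∈ F, μ i ^ (2 * s) * c i ^ 2) *
      √(∑ i ∈ F, μ i ^ (-(2 * s)) * g i ^ 2) := by
  have h := Real.sum_mul_le_sqrt_mul_sqrt F (fun i => μ i ^ s * c i) (fun i => μ i ^ (-s) * g i)
  have h0 : ∀ i, 0 < μ i := fun i => by linarith [hμ i]
  have e1 : ∀ i, μ i ^ s * c i * (μ i ^ (-s) * g i) = c i * g i := fun i => by
    rw [Real.rpow_neg (h0 i).le]
    have := Real.rpow_pos_of_pos (h0 i) s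
    field_simp
  have e2 : ∀ (i) (s : ℝ), (μ i ^ s) ^ 2 = μ i ^ (2 * s) := fun i s => by
    rw [← Real.rpow_natCast, ← Real.rpow_mul (h0 i).le, mul_comm s]; norm_num
  simp only [e1, mul_pow, e2, mul_neg] at h
  exact h

/-- `V_s ↪ L^∞` for `s > θ_A`. -/
theorem exists_ae_abs_le {q : ℝ≥0∞} (hq : 1 < q) (hE : E.SobolevEmbedding q) (ε : S.Shift) {s : ℝ}
    (hs : thetaA q < s) : ∃ C : ℝ, 0 ≤ C ∧ ∀ v : S.V ε s,
      ∀ᵐ x ∂m, |S.toL2Lin ε s v x| ≤ C * ‖v‖ := by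
  have hs0 : 0 ≤ s := ((thetaA_pos hq).trans hs).le
  obtain ⟨D, hD, h⟩ := S.exists_sum_sq_le hq hE
  obtain ⟨c, hc, hcv⟩ := S.exists_sum_rpow_mul_sq_le ε hs0
  have hr : (2:ℝ) ^ (2 * (thetaA q - s)) < 1 :=
    Real.rpow_lt_one_of_one_lt_of_neg one_lt_two (by linarith)
  have hr' : 0 < 1 - (2:ℝ) ^ (2 * (thetaA q - s)) := by linarith
  set D' := D * 2 ^ (2 * thetaA q) * (1 - 2 ^ (2 * (thetaA q - s)))⁻¹ with hD'
  have hD0 : 0 ≤ D' := by positivity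
  -- Duality with L¹: Cauchy-Schwarz with weights μ^s and μ^(-s), then the spectral projection bound
  -- summed over dyadic shells.
  refine ⟨√c * √D', by positivity, fun v => ae_abs_le_of_inner_le fun g => ?_⟩
  have hsum := S.basis.hasSum_inner_mul_inner (S.toL2Lin ε s v) g
  refine le_of_tendsto' hsum fun F => ?_
  set L := ∫ x, |g x| ∂m with hL
  have hL0 : 0 ≤ L := integral_nonneg fun x => abs_nonneg _
  have h1 := sum_rpow_mul_le_of_lt (fun i => S.one_le_add_eigenvalue i)
    (fun i => sq_nonneg (inner ℝ (S.basis i) g)) (D := D * L ^ 2) (θ := thetaA q) (s := s)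
    (by positivity) hs hs0 (fun F Λ hΛ hF => (h g F Λ hΛ hF).trans (le_of_eq (by ring))) F
  have h2 := sum_mul_le_sqrt F (fun i => S.one_le_add_eigenvalue i) s
    (fun i => inner ℝ (S.basis i) (S.toL2Lin ε s v)) (fun i => inner ℝ (S.basis i) g)
  simp only [fun i => real_inner_comm (S.basis i) (S.toL2Lin ε s v)]
  refine h2.trans ?_
  calc _ ≤ √(c * ‖v‖ ^ 2) * √(D' * L ^ 2) := by
        refine mul_le_mul (Real.sqrt_le_sqrt (hcv v F)) (Real.sqrt_le_sqrt (h1.trans (le_of_eq ?_)))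
          (Real.sqrt_nonneg _) (Real.sqrt_nonneg _)
        rw [hD']; ring
    _ = _ := by
        rw [Real.sqrt_mul hc.le, Real.sqrt_mul hD0, Real.sqrt_sq (norm_nonneg _), Real.sqrt_sq hL0]
        ring

/-- The `L^p` bound of `V_s ↪ L^p`, `p = 2θ_A/(θ_A - s)`, for finite linear combinations of
eigenfunctions. -/
lemma exists_lintegral_sum_smul_le {q : ℝ≥0∞} (hq : 1 < q) (hE : E.SobolevEmbedding q) {s : ℝ}
    (hs0 : 0 < s) (hs : s < thetaA q) : ∃ C : ℝ, 0 < C ∧ ∀ (F : Finset S.ι) (c : S.ι → ℝ) (B : ℝ),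
      0 < B → ∑ i ∈ F, (1 + S.eigenvalue i) ^ (2 * s) * c i ^ 2 ≤ B ^ 2 →
      ∫⁻ x, ENNReal.ofReal (|(∑ i ∈ F, c i • S.basis i : L2 m) x| ^
        (2 * thetaA q / (thetaA q - s))) ∂m ≤
        ENNReal.ofReal (C * B ^ (2 * thetaA q / (thetaA q - s))) := by
  classical
  set θ := thetaA q with hθ
  set p := 2 * θ / (θ - s) with hp
  have hθs : 0 < θ - s := by linarith
  -- This is the exponent for which μ^((θ-s)(p-2)) = μ^(2s), so the layer-cake sum closes with
  -- exactly the V_s norm.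
  have hp2 : p - 2 = 2 * s / (θ - s) := by rw [hp]; field_simp; ring
  have hp2' : 0 < p - 2 := by rw [hp2]; positivity
  have hp0 : 0 < p := by linarith
  obtain ⟨D, hD, h⟩ := S.exists_sum_sq_le hq hE
  have hr : (2:ℝ) ^ (2 * (s - θ)) < 1 :=
    Real.rpow_lt_one_of_one_lt_of_neg one_lt_two (by linarith)
  have hr' : 0 < 1 - (2:ℝ) ^ (2 * (s - θ)) := by linarith
  set D' := D * 2 ^ (2 * s) * (1 - 2 ^ (2 * (s - θ)))⁻¹ with hD'
  have hD0 : 0 < D' := by positivity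
  set μ : S.ι → ℝ := fun i => 1 + S.eigenvalue i with hμ
  have hμ1 : ∀ i, 1 ≤ μ i := fun i => S.one_le_add_eigenvalue i
  have hμ0 : ∀ i, 0 < μ i := fun i => by linarith [hμ1 i]
  refine ⟨p * (4 * (2 * √D') ^ (p - 2) / (p - 2)), by positivity, fun F c B hB hcB => ?_⟩
  set u : L2 m := ∑ i ∈ F, c i • S.basis i with hu
  -- sup bound of the low frequency part
  have hlow : ∀ Λ : ℝ, 0 < Λ → ∀ᵐ x ∂m, |(∑ i ∈ F with μ i ≤ Λ, c i • S.basis i : L2 m) x| ≤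
      √D' * B * Λ ^ (θ - s) := by
    intro Λ hΛ
    refine ae_abs_le_of_inner_le fun g => ?_
    rw [S.inner_sum_smul_basis]
    set L := ∫ x, |g x| ∂m with hL
    have hL0 : 0 ≤ L := integral_nonneg fun x => abs_nonneg _
    have h1 := sum_rpow_mul_le_of_gt hμ1
      (fun i => sq_nonneg (inner ℝ (S.basis i) g)) (D := D * L ^ 2) (θ := θ) (s := s)
      (by positivity) hs hs0.le (fun F Λ hΛ hF => (h g F Λ hΛ hF).trans (le_of_eq (by ring)))
      (F.filter fun i => μ i ≤ Λ) hΛ (fun i hi => (Finset.mem_filter.1 hi).2)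
    refine (sum_mul_le_sqrt _ hμ1 s _ _).trans ?_
    have h2 : ∑ i ∈ F with μ i ≤ Λ, μ i ^ (2 * s) * c i ^ 2 ≤ B ^ 2 := by
      refine le_trans (Finset.sum_le_sum_of_subset_of_nonneg (Finset.filter_subset _ _)
        fun i _ _ => ?_) hcB
      have := hμ0 i; positivity
    have h3 : Λ ^ (2 * (θ - s)) = (Λ ^ (θ - s)) ^ 2 := by
      rw [← Real.rpow_natCast, ← Real.rpow_mul hΛ.le, mul_comm (θ - s)]; norm_num
    calc _ ≤ √(B ^ 2) * √(D' * (L * Λ ^ (θ - s)) ^ 2) := by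
          refine mul_le_mul (Real.sqrt_le_sqrt h2) (Real.sqrt_le_sqrt (h1.trans (le_of_eq ?_)))
            (Real.sqrt_nonneg _) (Real.sqrt_nonneg _)
          rw [hD', h3]; ring
      _ = _ := by
          rw [Real.sqrt_mul hD0.le, Real.sqrt_sq hB.le, Real.sqrt_sq (by positivity)]
          ring
  -- Real interpolation by hand. For each height t the frequencies are cut at the Λ where the low
  -- part is at most t/2. If |u| > t, the high part then exceeds t/2, and Chebyshev bounds this by
  -- the c_i² of the high modes. ℓ_i is the height below which mode i counts as high, so strong type
  -- is reached at the endpoint.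
  set ℓ : S.ι → ℝ := fun i => 2 * √D' * B * μ i ^ (θ - s) with hℓ
  have hℓ0 : ∀ i, 0 < ℓ i := fun i => by have := hμ0 i; positivity
  have htail : ∀ t : ℝ, 0 < t → m {x | t < |u x|} ≤
      ENNReal.ofReal (4 / t ^ 2 * ∑ i ∈ F with t < ℓ i, c i ^ 2) := by
    intro t ht
    set Λ := (t / (2 * √D' * B)) ^ (θ - s)⁻¹ with hΛ
    have hΛ0 : 0 < Λ := by positivity
    have hΛ1 : √D' * B * Λ ^ (θ - s) = t / 2 := by
      rw [hΛ, ← Real.rpow_mul (by positivity), inv_mul_cancel₀ hθs.ne', Real.rpow_one]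
      field_simp
    have hiff : ∀ i, t < ℓ i ↔ ¬ μ i ≤ Λ := by
      intro i
      rw [not_le, ← Real.rpow_lt_rpow_iff hΛ0.le (hμ0 i).le hθs]
      have : t = 2 * √D' * B * Λ ^ (θ - s) := by linarith
      rw [this, hℓ]
      exact mul_lt_mul_iff_right₀ (by positivity)
    have hfil : (F.filter fun i => t < ℓ i) = F.filter fun i => ¬ μ i ≤ Λ :=
      Finset.filter_congr fun i _ => hiff i
    set ul : L2 m := ∑ i ∈ F with μ i ≤ Λ, c i • S.basis i with hul
    set uh : L2 m := ∑ i ∈ F with ¬ μ i ≤ Λ, c i • S.basis i with huh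
    have hsplit : u = ul + uh := (Finset.sum_filter_add_sum_filter_not F _ _).symm
    have hsub : m {x | t < |u x|} ≤ m {x | t / 2 < |uh x|} := by
      refine measure_mono_ae ?_
      have h1 := hlow Λ hΛ0
      rw [hΛ1] at h1
      have h2 : u =ᵐ[m] ul + uh := by rw [hsplit]; exact Lp.coeFn_add _ _
      filter_upwards [h1, h2] with x hx1 hx2 hx
      have hx3 : t < |u x| := hx
      show t / 2 < |uh x|
      rw [hx2, Pi.add_apply] at hx3
      have := abs_add_le (ul x) (uh x)
      have hx1' : |ul x| ≤ t / 2 := hx1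
      linarith
    refine hsub.trans ((meas_lt_abs_le_div uh (by positivity)).trans (le_of_eq ?_))
    rw [huh, S.norm_sq_sum_smul_basis, hfil]
    congr 1
    field_simp
    norm_num
  rw [lintegral_rpow_eq_lintegral_meas_lt_mul m (ae_of_all _ fun x => abs_nonneg _)
    (Lp.aestronglyMeasurable u).aemeasurable.abs (by linarith : 0 < p)]
  calc _ ≤ ENNReal.ofReal p * ∫⁻ t in Ioi (0:ℝ), ∑ i ∈ F, ENNReal.ofReal
        (if t < ℓ i then (4 * c i ^ 2) / t ^ 2 * t ^ (p - 1) else 0) := by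
        refine mul_le_mul_right (lintegral_mono_ae ?_) _
        refine (ae_restrict_iff' measurableSet_Ioi).2 (ae_of_all _ fun t ht => ?_)
        have ht0 : 0 < t := ht
        refine (mul_le_mul_left (htail t ht0) _).trans (le_of_eq ?_)
        rw [← ENNReal.ofReal_mul (by positivity), ← ENNReal.ofReal_sum_of_nonneg]
        · congr 1
          rw [Finset.sum_filter, Finset.mul_sum, Finset.sum_mul]
          refine Finset.sum_congr rfl fun i _ => ?_
          split_ifs
          · ring
          · ring
        · intro i _
          split_ifs <;> positivity
    _ ≤ ENNReal.ofReal p * ∑ i ∈ F, ENNReal.ofReal ((4 * c i ^ 2) * ℓ i ^ (p - 2) / (p - 2)) := by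
        refine mul_le_mul_right ?_ _
        rw [lintegral_finsetSum']
        · exact Finset.sum_le_sum fun i _ => lintegral_rpow_Ioi_indicator_le (by linarith)
            (hℓ0 i).le _ (by positivity)
        · intro i _
          refine Measurable.aemeasurable (Measurable.ennreal_ofReal ?_)
          refine Measurable.ite (measurableSet_lt measurable_id measurable_const) ?_ measurable_const
          fun_prop
    _ = ENNReal.ofReal (p * ∑ i ∈ F, (4 * c i ^ 2) * ℓ i ^ (p - 2) / (p - 2)) := by
        rw [ENNReal.ofReal_mul (by linarith), ENNReal.ofReal_sum_of_nonneg]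
        intro i _
        have := hℓ0 i
        positivity
    _ = ENNReal.ofReal (p * (4 * (2 * √D' * B) ^ (p - 2) / (p - 2) *
          ∑ i ∈ F, μ i ^ (2 * s) * c i ^ 2)) := by
        congr 2
        rw [Finset.mul_sum]
        refine Finset.sum_congr rfl fun i _ => ?_
        have h1 : ℓ i ^ (p - 2) = (2 * √D' * B) ^ (p - 2) * μ i ^ (2 * s) := by
          rw [hℓ, Real.mul_rpow (by positivity) (by have := hμ0 i; positivity),
            ← Real.rpow_mul (hμ0 i).le, hp2]
          congr 2
          field_simp
        rw [h1]
        ring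
    _ ≤ ENNReal.ofReal (p * (4 * (2 * √D' * B) ^ (p - 2) / (p - 2) * B ^ 2)) := by
        refine ENNReal.ofReal_le_ofReal ?_
        gcongr
    _ = _ := by
        congr 1
        have h1 : B ^ p = B ^ (p - 2) * B ^ 2 := by
          rw [← Real.rpow_natCast B 2, ← Real.rpow_add hB]
          congr 1
          push_cast; ring
        rw [h1, Real.mul_rpow (by positivity) hB.le]
        ring

/-- `V_s ↪ L^p` for `p = 2θ_A/(θ_A - s')` and `0 < s' < θ_A`, `s' ≤ s`. -/
theorem exists_eLpNorm_le {q : ℝ≥0∞} (hq : 1 < q) (hE : E.SobolevEmbedding q) (ε : S.Shift)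
    {s' s : ℝ} (hs0 : 0 < s') (hs' : s' < thetaA q) (hs : s' ≤ s) : ∃ C : ℝ, 0 ≤ C ∧ ∀ v : S.V ε s,
      eLpNorm (S.toL2Lin ε s v) (ENNReal.ofReal (2 * thetaA q / (thetaA q - s'))) m ≤
        ENNReal.ofReal (C * ‖v‖) := by
  obtain ⟨C, hC, h⟩ := S.exists_lintegral_sum_smul_le hq hE hs0 hs'
  obtain ⟨c, hc, hcv⟩ := S.exists_sum_rpow_mul_sq_le ε (hs0.le.trans hs)
  set p := 2 * thetaA q / (thetaA q - s') with hp
  have hp0 : 0 < p := by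
    have := thetaA_pos hq
    exact div_pos (by linarith) (by linarith)
  -- The bound passes from finite sums to v since L^p balls are closed in L². It requires B > 0,
  -- hence the approximation of √c ‖v‖ from above by adding 1/(n+1).
  have key : ∀ (v : S.V ε s) (B : ℝ), 0 < B → √c * ‖v‖ ≤ B →
      eLpNorm (S.toL2Lin ε s v) (ENNReal.ofReal p) m ≤ ENNReal.ofReal (C ^ p⁻¹ * B) := by
    intro v B hB hvB
    refine (isClosed_setOf_eLpNorm_le (m := m) (ENNReal.ofReal p)
      (ENNReal.ofReal (C ^ p⁻¹ * B))).mem_of_tendsto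
      (S.hasSum_basis (S.toL2Lin ε s v)) (Eventually.of_forall fun F => ?_)
    have h1 := h F (fun i => inner ℝ (S.basis i) (S.toL2Lin ε s v)) B hB (by
      calc _ ≤ ∑ i ∈ F, (1 + S.eigenvalue i) ^ (2 * s) *
            inner ℝ (S.basis i) (S.toL2Lin ε s v) ^ 2 := by
            refine Finset.sum_le_sum fun i _ => ?_
            gcongr
            exact S.one_le_add_eigenvalue i
        _ ≤ c * ‖v‖ ^ 2 := hcv v F
        _ = (√c * ‖v‖) ^ 2 := by rw [mul_pow, Real.sq_sqrt hc.le]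
        _ ≤ B ^ 2 := by gcongr)
    show eLpNorm _ _ _ ≤ _
    rw [eLpNorm_eq_lintegral_rpow_enorm_toReal (by simpa using hp0) ENNReal.ofReal_ne_top,
      ENNReal.toReal_ofReal hp0.le]
    have h2 : ∀ y : ℝ, ‖y‖ₑ ^ p = ENNReal.ofReal (|y| ^ p) := fun y => by
      rw [← ofReal_norm, ENNReal.ofReal_rpow_of_nonneg (norm_nonneg _) hp0.le, Real.norm_eq_abs]
    simp only [h2]
    refine (ENNReal.rpow_le_rpow h1 (by positivity)).trans (le_of_eq ?_)
    rw [ENNReal.ofReal_rpow_of_nonneg (by positivity) (by positivity), Real.mul_rpow hC.le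
      (by positivity), ← Real.rpow_mul hB.le, one_div, mul_inv_cancel₀ hp0.ne', Real.rpow_one]
  refine ⟨C ^ p⁻¹ * √c, by positivity, fun v => ?_⟩
  have hcont : Tendsto (fun n : ℕ => ENNReal.ofReal (C ^ p⁻¹ * (√c * ‖v‖ + 1 / ((n:ℝ) + 1)))) atTop
      (𝓝 (ENNReal.ofReal (C ^ p⁻¹ * √c * ‖v‖))) := by
    refine (ENNReal.continuous_ofReal.tendsto _).comp ?_
    have := (tendsto_one_div_add_atTop_nhds_zero_nat (𝕜 := ℝ)).const_add (√c * ‖v‖)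
    have := this.const_mul (C ^ p⁻¹)
    simpa [mul_assoc] using this
  refine ge_of_tendsto' hcont fun n => key v _ (by positivity) ?_
  have : (0:ℝ) ≤ 1 / ((n:ℝ) + 1) := by positivity
  linarith

end EigenSystem

end FracWave

/-! ### Superposition operators and admissible exponents. -/

namespace FracWave

lemma abs_sub_le_of_deriv_le {f : ℝ → ℝ} (hf : Differentiable ℝ f) {M K : ℝ}
    (h : ∀ s, |s| ≤ M → |deriv f s| ≤ K) {a b : ℝ} (ha : |a| ≤ M) (hb : |b| ≤ M) :
    |f a - f b| ≤ K * |a - b| :=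
  (convex_Icc (-M) M).norm_image_sub_le_of_norm_deriv_le (fun x _ => hf x)
    (fun x hx => h x (abs_le.2 hx)) (abs_le.1 hb) (abs_le.1 ha)

lemma abs_sub_le_of_deriv_le_rpow {f : ℝ → ℝ} (hf : Differentiable ℝ f) {C r : ℝ} (hC : 0 ≤ C)
    (hr : 1 < r) (h : ∀ s, |deriv f s| ≤ C * |s| ^ (r - 1)) (a b : ℝ) :
    |f a - f b| ≤ C * ((|a| ^ (r - 1) + |b| ^ (r - 1)) * |a - b|) := by
  have h1 := abs_sub_le_of_deriv_le hf (M := max |a| |b|) (K := C * (max |a| |b|) ^ (r - 1))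
    (fun s hs => (h s).trans (by gcongr)) (le_max_left _ _) (le_max_right _ _)
  refine h1.trans ?_
  rw [mul_assoc]
  gcongr
  have ha : 0 ≤ |a| ^ (r - 1) := by positivity
  have hb : 0 ≤ |b| ^ (r - 1) := by positivity
  rcases max_choice |a| |b| with h | h <;> rw [h] <;> linarith

/-- Hölder with exponents 2r/(r-1) and 2r. -/
lemma eLpNorm_rpow_mul_le {X : Type*} [MeasurableSpace X] {m : Measure X} {a b : X → ℝ}
    (ha : AEStronglyMeasurable a m) (hb : AEStronglyMeasurable b m) {r : ℝ} (hr : 1 < r) :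
    eLpNorm (fun x => |a x| ^ (r - 1) * |b x|) 2 m ≤
      eLpNorm a (ENNReal.ofReal (2 * r)) m ^ (r - 1) * eLpNorm b (ENNReal.ofReal (2 * r)) m := by
  have hr0 : 0 < r - 1 := by linarith
  have htri : ENNReal.HolderTriple (ENNReal.ofReal (2 * r / (r - 1))) (ENNReal.ofReal (2 * r)) 2 := by
    refine ⟨?_⟩
    rw [← ENNReal.ofReal_inv_of_pos (by positivity), ← ENNReal.ofReal_inv_of_pos (by positivity),
      ← ENNReal.ofReal_add (by positivity) (by positivity)]
    have : (2 * r / (r - 1))⁻¹ + (2 * r)⁻¹ = 2⁻¹ := by field_simp; ring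
    rw [this, ENNReal.ofReal_inv_of_pos two_pos, ENNReal.ofReal_ofNat]
  have h := eLpNorm_smul_le_mul_eLpNorm (p := ENNReal.ofReal (2 * r / (r - 1)))
    (q := ENNReal.ofReal (2 * r)) (r := 2) (f := fun x => ‖b x‖) (φ := fun x => ‖a x‖ ^ (r - 1))
    (μ := m) hb.norm (ha.norm.aemeasurable.pow_const (r - 1)).aestronglyMeasurable
  rw [eLpNorm_norm_rpow a hr0, eLpNorm_norm, ← ENNReal.ofReal_mul (by positivity),
    div_mul_cancel₀ _ hr0.ne'] at h
  exact h

namespace EigenSystem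

section

variable {X : Type*} [MeasurableSpace X] {m : Measure X} {E : DirichletForm m}
  (S : EigenSystem E) (ε : S.Shift)

/-- The Nemytskii operator of a function vanishing at zero, given local Lipschitz bounds. -/
lemma exists_nemytskii {s : ℝ} {f : ℝ → ℝ} (hf : Continuous f) (hf0 : f 0 = 0)
    (h : ∀ R : ℝ, ∃ K : ℝ, 0 ≤ K ∧ ∀ v w : S.V ε s, ‖v‖ ≤ R → ‖w‖ ≤ R →
      eLpNorm (fun x => f (S.toL2Lin ε s v x) - f (S.toL2Lin ε s w x)) 2 m ≤
        ENNReal.ofReal (K * ‖v - w‖)) :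
    ∃ N : S.V ε s → L2 m, (∀ v, N v =ᵐ[m] fun x => f (S.toL2Lin ε s v x)) ∧
      ∀ R : ℝ, ∃ K : ℝ, 0 ≤ K ∧ ∀ v w : S.V ε s, ‖v‖ ≤ R → ‖w‖ ≤ R →
        ‖N v - N w‖ ≤ K * ‖v - w‖ := by
  have hmem : ∀ v : S.V ε s, MemLp (fun x => f (S.toL2Lin ε s v x)) 2 m := by
    intro v
    obtain ⟨K, -, hK⟩ := h ‖v‖
    have h1 := hK v 0 le_rfl (by simp)
    have h2 : (fun x => f (S.toL2Lin ε s v x) - f (S.toL2Lin ε s 0 x)) =ᵐ[m]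
        fun x => f (S.toL2Lin ε s v x) := by
      rw [map_zero]
      filter_upwards [Lp.coeFn_zero ℝ 2 m] with x hx
      rw [hx, Pi.zero_apply, hf0, sub_zero]
    rw [eLpNorm_congr_ae h2] at h1
    exact ⟨hf.comp_aestronglyMeasurable (Lp.aestronglyMeasurable _),
      h1.trans_lt ENNReal.ofReal_lt_top⟩
  refine ⟨fun v => (hmem v).toLp, fun v => (hmem v).coeFn_toLp, fun R => ?_⟩
  obtain ⟨K, hK0, hK⟩ := h R
  refine ⟨K, hK0, fun v w hv hw => ?_⟩
  rw [← MemLp.toLp_sub, Lp.norm_toLp]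
  exact ENNReal.toReal_le_of_le_ofReal (by positivity) (hK v w hv hw)

lemma toL2Lin_sub_ae {s : ℝ} (v w : S.V ε s) :
    S.toL2Lin ε s (v - w) =ᵐ[m] fun x => S.toL2Lin ε s v x - S.toL2Lin ε s w x := by
  rw [map_sub]
  exact Lp.coeFn_sub _ _

/-- The L^∞ embedding confines all values to [-CR, CR], where f' is bounded by Q₁(CR); this is why
no growth condition enters. -/
lemma exists_nemytskii_of_ae_abs_le {s : ℝ} (hs : 0 ≤ s) {C : ℝ} (hC : 0 ≤ C)
    (hemb : ∀ v : S.V ε s, ∀ᵐ x ∂m, |S.toL2Lin ε s v x| ≤ C * ‖v‖) {f : ℝ → ℝ} (hf : Hf2 f) :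
    ∃ N : S.V ε s → L2 m, (∀ v, N v =ᵐ[m] fun x => f (S.toL2Lin ε s v x)) ∧
      ∀ R : ℝ, ∃ K : ℝ, 0 ≤ K ∧ ∀ v w : S.V ε s, ‖v‖ ≤ R → ‖w‖ ≤ R →
        ‖N v - N w‖ ≤ K * ‖v - w‖ := by
  obtain ⟨hf1, hf0, Q, _, hQ, -, hQ0, hfQ⟩ := hf
  refine S.exists_nemytskii ε hf1.continuous hf0 fun R => ?_
  obtain ⟨D, hD⟩ := S.exists_norm_toL2Lin_le ε hs
  rcases lt_or_ge R 0 with hR | hR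
  · exact ⟨0, le_rfl, fun v w hv _ => absurd (norm_nonneg v) (by linarith)⟩
  have hCR : 0 ≤ C * R := by positivity
  refine ⟨Q (C * R) * |D|, mul_nonneg (hQ0 _ hCR).1 (abs_nonneg _), fun v w hv hw => ?_⟩
  have h1 : ∀ᵐ x ∂m, ‖f (S.toL2Lin ε s v x) - f (S.toL2Lin ε s w x)‖ ≤
      Q (C * R) * ‖S.toL2Lin ε s (v - w) x‖ := by
    filter_upwards [hemb v, hemb w, S.toL2Lin_sub_ae ε v w] with x hx1 hx2 hx3
    rw [hx3]
    refine abs_sub_le_of_deriv_le (M := C * R) (hf1.differentiable (by norm_num)) (fun t ht => ?_)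
      (hx1.trans (by gcongr)) (hx2.trans (by gcongr))
    exact (hfQ t).1.trans (hQ (abs_nonneg t) hCR ht)
  refine (eLpNorm_le_mul_eLpNorm_of_ae_le_mul h1 2).trans ?_
  rw [mul_assoc, ENNReal.ofReal_mul (hQ0 _ hCR).1]
  gcongr
  rw [← ENNReal.ofReal_toReal (Lp.eLpNorm_ne_top (S.toL2Lin ε s (v - w))), ← Lp.norm_def]
  refine ENNReal.ofReal_le_ofReal ((hD _).trans ?_)
  gcongr
  exact le_abs_self D

/-- By the mean value theorem |f(a) - f(b)| is at most a multiple of (|a|^(r-1) + |b|^(r-1))|a - b|,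
and Hölder puts all three functions in L^{2r}. -/
lemma exists_nemytskii_of_eLpNorm_le {s : ℝ} {C r : ℝ} (hr : 1 < r) (hC : 0 ≤ C)
    (hemb : ∀ v : S.V ε s, eLpNorm (S.toL2Lin ε s v) (ENNReal.ofReal (2 * r)) m ≤
      ENNReal.ofReal (C * ‖v‖)) {f : ℝ → ℝ} (hf : Hf1 f r) :
    ∃ N : S.V ε s → L2 m, (∀ v, N v =ᵐ[m] fun x => f (S.toL2Lin ε s v x)) ∧
      ∀ R : ℝ, ∃ K : ℝ, 0 ≤ K ∧ ∀ v w : S.V ε s, ‖v‖ ≤ R → ‖w‖ ≤ R →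
        ‖N v - N w‖ ≤ K * ‖v - w‖ := by
  obtain ⟨hf1, hf0, D, hD, hfD⟩ := hf
  refine S.exists_nemytskii ε hf1.continuous hf0 fun R => ?_
  rcases lt_or_ge R 0 with hR | hR
  · exact ⟨0, le_rfl, fun v w hv _ => absurd (norm_nonneg v) (by linarith)⟩
  refine ⟨D * (2 * (C * R) ^ (r - 1)) * C, by positivity, fun v w hv hw => ?_⟩
  set a := S.toL2Lin ε s v
  set b := S.toL2Lin ε s w
  set d := S.toL2Lin ε s (v - w)
  have h1 : ∀ᵐ x ∂m, ‖f (a x) - f (b x)‖ ≤ D * ‖|a x| ^ (r - 1) * |d x| +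
      |b x| ^ (r - 1) * |d x|‖ := by
    filter_upwards [S.toL2Lin_sub_ae ε v w] with x hx3
    have hx4 : d x = a x - b x := hx3
    have h5 : 0 ≤ |a x| ^ (r - 1) * |d x| + |b x| ^ (r - 1) * |d x| := by positivity
    rw [Real.norm_of_nonneg h5, hx4, ← add_mul, Real.norm_eq_abs]
    exact abs_sub_le_of_deriv_le_rpow (hf1.differentiable (by norm_num)) hD.le hr hfD _ _
  have hpow : ∀ y : S.V ε s, ‖y‖ ≤ R → eLpNorm (fun x => |S.toL2Lin ε s y x| ^ (r - 1) * |d x|) 2 m ≤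
      ENNReal.ofReal ((C * R) ^ (r - 1) * (C * ‖v - w‖)) := by
    intro y hy
    refine (eLpNorm_rpow_mul_le (Lp.aestronglyMeasurable _) (Lp.aestronglyMeasurable _) hr).trans ?_
    have hr1 : 0 ≤ r - 1 := by linarith
    have hCR : 0 ≤ C * R := by positivity
    rw [ENNReal.ofReal_mul (Real.rpow_nonneg hCR (r - 1)), ← ENNReal.ofReal_rpow_of_nonneg hCR hr1]
    refine mul_le_mul' (ENNReal.rpow_le_rpow ((hemb y).trans ?_) (by linarith)) (hemb _)
    exact ENNReal.ofReal_le_ofReal (by gcongr)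
  have hmeas : ∀ y : L2 m, AEStronglyMeasurable (fun x => |y x| ^ (r - 1) * |d x|) m := fun y =>
    (((Lp.aestronglyMeasurable y).aemeasurable.abs.pow_const (r - 1)).mul
      (Lp.aestronglyMeasurable d).aemeasurable.abs).aestronglyMeasurable
  refine (eLpNorm_le_mul_eLpNorm_of_ae_le_mul h1 2).trans ?_
  calc _ ≤ ENNReal.ofReal D * (ENNReal.ofReal ((C * R) ^ (r - 1) * (C * ‖v - w‖)) +
        ENNReal.ofReal ((C * R) ^ (r - 1) * (C * ‖v - w‖))) := by
        refine mul_le_mul_right ((eLpNorm_add_le (hmeas a) (hmeas b) (by norm_num)).trans ?_) _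
        exact add_le_add (hpow v hv) (hpow w hw)
    _ = _ := by
        rw [← ENNReal.ofReal_add (by positivity) (by positivity), ← ENNReal.ofReal_mul hD.le]
        congr 1
        ring

lemma exists_clm_Lp {s C : ℝ} {p : ℝ≥0∞} [Fact (1 ≤ p)]
    (hemb : ∀ v : S.V ε s, eLpNorm (S.toL2Lin ε s v) p m ≤ ENNReal.ofReal (C * ‖v‖)) (hC : 0 ≤ C) :
    ∃ L : S.V ε s →L[ℝ] Lp ℝ p m, ∀ v, L v =ᵐ[m] S.toL2Lin ε s v := by
  have hmem : ∀ v : S.V ε s, MemLp (S.toL2Lin ε s v) p m := fun v =>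
    ⟨Lp.aestronglyMeasurable _, (hemb v).trans_lt ENNReal.ofReal_lt_top⟩
  refine ⟨LinearMap.mkContinuous
    { toFun := fun v => (hmem v).toLp
      map_add' := fun v w => ?_
      map_smul' := fun c v => ?_ } C fun v => ?_, fun v => (hmem v).coeFn_toLp⟩
  · rw [← MemLp.toLp_add]
    refine MemLp.toLp_congr _ _ ?_
    rw [map_add]
    exact Lp.coeFn_add _ _
  · rw [RingHom.id_apply, ← MemLp.toLp_const_smul]
    refine MemLp.toLp_congr _ _ ?_
    rw [map_smul]
    exact Lp.coeFn_smul _ _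
  · show ‖(hmem v).toLp‖ ≤ _
    rw [Lp.norm_toLp]
    exact ENNReal.toReal_le_of_le_ofReal (by positivity) (hemb v)

end

end EigenSystem

lemma thetaA_lt_of_lt_alpha0 {q : ℝ≥0∞} (hq : 1 < q) {α : ℝ} (hα : 1 < α) (h : α < alpha0 q) :
    thetaA q < 1 / α := by
  have := thetaA_pos hq
  rw [alpha0, lt_div_iff₀ this] at h
  rw [lt_div_iff₀ (by linarith)]
  linarith

/-- Finds the smoothness s at which the embedding exponent is 2r. Away from α = α₀ it is 1/α itself,
which explains r = θ_Aα/(θ_Aα - 1). At α = α₀ one has 1/α = θ_A, just outside the range of the L^p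
embedding, and s = θ_A(1 - 1/r) serves any r > 1. -/
lemma AdmissibleExponent.exists_smoothness {q : ℝ≥0∞} (hq : 1 < q) {α r : ℝ} (hα : 1 < α)
    (h : AdmissibleExponent q α r) : 1 < r ∧ ∃ s : ℝ, 0 < s ∧ s < thetaA q ∧ s ≤ 1 / α ∧
      2 * thetaA q / (thetaA q - s) = 2 * r := by
  have hθ := thetaA_pos hq
  have hα0 : 0 < α := by linarith
  have key : 1 < thetaA q * α → r = thetaA q * α / (thetaA q * α - 1) →
      1 < r ∧ ∃ s : ℝ, 0 < s ∧ s < thetaA q ∧ s ≤ 1 / α ∧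
      2 * thetaA q / (thetaA q - s) = 2 * r := by
    intro h1 hr
    have h2 : 0 < thetaA q * α - 1 := by linarith
    refine ⟨?_, 1 / α, by positivity, ?_, le_rfl, ?_⟩
    · rw [hr, one_lt_div h2]; linarith
    · rw [div_lt_iff₀ hα0]; exact h1
    · rw [hr]
      have : thetaA q - 1 / α = (thetaA q * α - 1) / α := by field_simp
      rw [this]
      field_simp
  rcases h with ⟨-, ⟨h1, hr⟩ | ⟨h1, hr⟩⟩ | ⟨h1, hr⟩
  · refine ⟨hr, thetaA q * (1 - 1 / r), ?_, ?_, ?_, ?_⟩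
    · have : 1 / r < 1 := by rw [div_lt_one (by linarith)]; exact hr
      exact mul_pos hθ (by linarith)
    · have : 0 < 1 / r := by positivity
      nlinarith
    · have : 0 < 1 / r := by positivity
      rw [h1, alpha0, one_div_one_div]
      nlinarith
    · have : thetaA q - thetaA q * (1 - 1 / r) = thetaA q / r := by ring
      rw [this]
      field_simp
  · refine key ?_ hr
    rw [alpha0, div_lt_iff₀ hθ] at h1
    linarith
  -- q ≤ 2 forces θ_A ≥ 1, hence θ_A α > 1 for every α > 1.
  · refine key ?_ hr
    have h2 : 1 ≤ thetaA q := by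
      have hq1 : q⁻¹ < 1 := ENNReal.inv_lt_one.2 hq
      have h3 : (q⁻¹).toReal < 1 :=
        (ENNReal.toReal_lt_toReal (ne_top_of_lt hq1) ENNReal.one_ne_top).2 hq1
      have h4 : 2⁻¹ ≤ (q⁻¹).toReal := by
        have : (2:ℝ≥0∞)⁻¹ ≤ q⁻¹ := ENNReal.inv_le_inv.2 h1
        simpa using ENNReal.toReal_mono (ne_top_of_lt hq1) this
      rw [thetaA, one_le_div (by linarith)]
      linarith
    nlinarith

end FracWave

/-! ### Diagonal operators in eigen-coordinates. -/

namespace FracWave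

section Multiplier

variable {ι : Type*}

lemma lp_hasSum_sq (x : lp (fun _ : ι => ℝ) 2) : HasSum (fun i => x i ^ 2) (‖x‖ ^ 2) := by
  have h := lp.hasSum_norm (p := 2) (by norm_num) x
  simpa using h

lemma memℓp_mul_of_abs_le {a : ι → ℝ} {C : ℝ} (ha : ∀ i, |a i| ≤ C) (x : lp (fun _ : ι => ℝ) 2) :
    Memℓp (fun i => a i * x i) 2 := by
  refine Memℓp.mono ((lp.memℓp x).norm.const_smul C) fun i => ?_
  rw [norm_mul, Pi.smul_apply, smul_eq_mul]
  exact mul_le_mul_of_nonneg_right (ha i) (norm_nonneg _)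

lemma norm_le_of_eq_mul {a : ι → ℝ} {C : ℝ} (hC : 0 ≤ C) (ha : ∀ i, |a i| ≤ C)
    {x y : lp (fun _ : ι => ℝ) 2} (h : ∀ i, y i = a i * x i) : ‖y‖ ≤ C * ‖x‖ := by
  rw [← Real.norm_of_nonneg hC, ← norm_smul]
  refine lp.norm_mono (by norm_num) fun i => ?_
  rw [h, lp.coeFn_smul, Pi.smul_apply, norm_smul, norm_mul, Real.norm_of_nonneg hC]
  exact mul_le_mul_of_nonneg_right (ha i) (norm_nonneg _)

open Classical in
/-- The multiplication operator by a bounded sequence (and zero for an unbounded sequence). -/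
noncomputable def diag (a : ι → ℝ) : lp (fun _ : ι => ℝ) 2 →L[ℝ] lp (fun _ : ι => ℝ) 2 :=
  if h : ∃ C, ∀ i, |a i| ≤ C then
    LinearMap.mkContinuous
      { toFun := fun x => ⟨fun i => a i * x i, memℓp_mul_of_abs_le h.choose_spec x⟩
        map_add' := fun x y => by ext i; exact mul_add _ _ _
        map_smul' := fun c x => by ext i; exact mul_left_comm _ _ _ }
      |h.choose| fun x => norm_le_of_eq_mul (abs_nonneg _)
        (fun i => (h.choose_spec i).trans (le_abs_self _)) fun _ => rfl
  else 0

lemma diag_apply {a : ι → ℝ} {C : ℝ} (ha : ∀ i, |a i| ≤ C) (x : lp (fun _ : ι => ℝ) 2) (i : ι) :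
    diag a x i = a i * x i := by
  have h : ∃ C, ∀ i, |a i| ≤ C := ⟨C, ha⟩
  rw [diag, dif_pos h]
  rfl

variable {G₁ G₂ : Type*} [NormedAddCommGroup G₁] [NormedSpace ℝ G₁] [NormedAddCommGroup G₂]
  [NormedSpace ℝ G₂]

/-- The operator which multiplies the coordinates by a bounded sequence, between two spaces with
orthonormal coordinates. -/
noncomputable def mult (A : G₁ ≃ₗᵢ[ℝ] lp (fun _ : ι => ℝ) 2) (B : G₂ ≃ₗᵢ[ℝ] lp (fun _ : ι => ℝ) 2)
    (a : ι → ℝ) : G₁ →L[ℝ] G₂ :=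
  (B.symm.toContinuousLinearEquiv : lp (fun _ : ι => ℝ) 2 →L[ℝ] G₂).comp
    ((diag a).comp (A.toContinuousLinearEquiv : G₁ →L[ℝ] lp (fun _ : ι => ℝ) 2))

variable {A : G₁ ≃ₗᵢ[ℝ] lp (fun _ : ι => ℝ) 2} {B : G₂ ≃ₗᵢ[ℝ] lp (fun _ : ι => ℝ) 2}

lemma mult_apply {a : ι → ℝ} {C : ℝ} (ha : ∀ i, |a i| ≤ C) (x : G₁) (i : ι) :
    B (mult A B a x) i = a i * A x i := by
  have : B (mult A B a x) = diag a (A x) := B.apply_symm_apply _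
  rw [this, diag_apply ha]

lemma norm_mult_le {a : ι → ℝ} {C : ℝ} (hC : 0 ≤ C) (ha : ∀ i, |a i| ≤ C) :
    ‖mult A B a‖ ≤ C := by
  refine ContinuousLinearMap.opNorm_le_bound _ hC fun x => ?_
  rw [← B.norm_map, ← A.norm_map x]
  exact norm_le_of_eq_mul hC ha fun i => mult_apply ha x i

variable {a : ℝ → ι → ℝ} {k : ℝ → ℝ}

/-- Strong continuity only: dominated convergence in the ℓ² sum, where k(t) < k(t₀) + 1 near t₀
supplies the majorant. -/
lemma continuousOn_mult {s : Set ℝ} (ha : ∀ i, ContinuousOn (fun t => a t i) s)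
    (hk : ContinuousOn k s) (hak : ∀ t ∈ s, ∀ i, |a t i| ≤ k t) (x : G₁) :
    ContinuousOn (fun t => mult A B (a t) x) s := by
  intro t₀ ht₀
  have hkt : ∀ᶠ t in 𝓝[s] t₀, k t < k t₀ + 1 :=
    (hk t₀ ht₀).eventually (gt_mem_nhds (by linarith))
  have h1 : Tendsto (fun t => ∑' i, ((a t i - a t₀ i) * A x i) ^ 2) (𝓝[s] t₀)
      (𝓝 (∑' i : ι, (0:ℝ))) := by
    refine tendsto_tsum_of_dominated_convergence
      (bound := fun i => (2 * k t₀ + 1) ^ 2 * (A x i) ^ 2)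
      ((lp_hasSum_sq (A x)).summable.mul_left _) (fun i => ?_) ?_
    · have h2 : Tendsto (fun t => ((a t i - a t₀ i) * A x i) ^ 2) (𝓝[s] t₀)
          (𝓝 (((a t₀ i - a t₀ i) * A x i) ^ 2)) :=
        ((((ha i) t₀ ht₀).sub_const _).mul_const _).pow 2
      simpa using h2
    · filter_upwards [hkt, self_mem_nhdsWithin] with t ht hts i
      rw [Real.norm_of_nonneg (sq_nonneg _), mul_pow]
      refine mul_le_mul_of_nonneg_right ?_ (sq_nonneg _)
      rw [← sq_abs]
      have h3 := hak t hts i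
      have h4 := hak t₀ ht₀ i
      have h5 := abs_sub (a t i) (a t₀ i)
      gcongr
      linarith
  rw [tsum_zero] at h1
  rw [ContinuousWithinAt, tendsto_iff_norm_sub_tendsto_zero]
  have h2 : Tendsto (fun t => ‖mult A B (a t) x - mult A B (a t₀) x‖ ^ 2) (𝓝[s] t₀) (𝓝 0) := by
    refine h1.congr' ?_
    filter_upwards [self_mem_nhdsWithin] with t hts
    rw [← B.norm_map]
    refine ((lp_hasSum_sq _).tsum_eq.symm.trans ?_).symm
    refine tsum_congr fun i => ?_
    rw [map_sub, lp.coeFn_sub, Pi.sub_apply, mult_apply (hak t hts), mult_apply (hak t₀ ht₀), sub_mul]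
  have h3 := h2.sqrt
  simpa [Real.sqrt_sq] using h3

variable {T : ℝ}

lemma isConvKernel_mult (ha : ∀ i, ContinuousOn (fun t => a t i) (Ioi 0))
    (hk : ContinuousOn k (Ioi 0)) (hi : IntervalIntegrable k volume 0 T)
    (hk0 : ∀ t, 0 < t → 0 ≤ k t) (hak : ∀ t, 0 < t → ∀ i, |a t i| ≤ k t) :
    IsConvKernel T (fun t => mult A B (a t)) k where
  continuousOn_bound := hk
  integrable := hi
  norm_le τ hτ := norm_mult_le (hk0 τ hτ.1) (hak τ hτ.1)
  continuousOn := continuousOn_mult ha hk hak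

lemma opConv_mult_apply [CompleteSpace G₂] (hK : IsConvKernel T (fun t => mult A B (a t)) k)
    (hak : ∀ t, 0 < t → ∀ i, |a t i| ≤ k t) {F : ℝ → G₁} (hF : ContinuousOn F (Icc 0 T)) {t : ℝ}
    (ht : t ∈ Icc 0 T) (i : ι) :
    B (opConv (fun t => mult A B (a t)) F t) i = conv (fun t => a t i) (fun τ => A (F τ) i) t := by
  have h := hK.map_opConv hF ht
    ((lp.evalCLM ℝ (fun _ : ι => ℝ) 2 i).comp
      (B.toContinuousLinearEquiv : G₂ →L[ℝ] lp (fun _ : ι => ℝ) 2))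
  refine h.trans ?_
  rw [conv, intervalIntegral.integral_of_le ht.1, intervalIntegral.integral_of_le ht.1,
    integral_Ioc_eq_integral_Ioo, integral_Ioc_eq_integral_Ioo]
  refine setIntegral_congr_fun measurableSet_Ioo fun τ hτ => ?_
  exact mult_apply (hak (t - τ) (by linarith [hτ.2])) _ _

end Multiplier

namespace EigenSystem

variable {X : Type*} [MeasurableSpace X] {m : Measure X} {E : DirichletForm m}
  (S : EigenSystem E) (ε : S.Shift)

lemma exists_inv_weight_le {s : ℝ} (hs : 0 ≤ s) : ∃ C : ℝ, 0 ≤ C ∧ ∀ i, (S.weight ε s i)⁻¹ ≤ C := by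
  obtain ⟨-, δ, hδ, hle⟩ := ε.2
  refine ⟨(δ ^ s)⁻¹, by positivity, fun i => ?_⟩
  exact inv_anti₀ (by positivity) (Real.rpow_le_rpow hδ.le (hle i) hs)

/-- For s ≥ 0 the weights are bounded below, so dividing by them preserves square summability. Hence
V_s is isometric to ℓ², and in particular complete. -/
lemma toSeq_surjective {s : ℝ} (hs : 0 ≤ s) : Function.Surjective (S.toSeq ε s) := by
  intro c
  obtain ⟨C, hC, hle⟩ := S.exists_inv_weight_le ε hs
  have hmem := memℓp_mul_of_abs_le (a := fun i => (S.weight ε s i)⁻¹) (C := C) (fun i => by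
    rw [abs_of_pos (inv_pos.2 (S.weight_pos ε s i))]; exact hle i) c
  have hc : ∀ i, S.weight ε s i * inner ℝ (S.basis i) (S.ofCoeff _ hmem) = c i := fun i => by
    rw [S.inner_ofCoeff, mul_inv_cancel_left₀ (S.weight_pos ε s i).ne']
  have hV : S.ofCoeff _ hmem ∈ S.fracDomain ε s := by
    show Memℓp _ 2
    simp only [hc]
    exact c.2
  exact ⟨⟨_, hV⟩, by ext i; exact hc i⟩

/-- The space `V_s` in orthonormal coordinates. -/
noncomputable def seqIso {s : ℝ} (hs : 0 ≤ s) : S.V ε s ≃ₗᵢ[ℝ] lp (fun _ : S.ι => ℝ) 2 :=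
  LinearIsometryEquiv.ofSurjective ⟨S.toSeq ε s, fun _ => rfl⟩ (S.toSeq_surjective ε hs)

lemma seqIso_apply {s : ℝ} (hs : 0 ≤ s) (v : S.V ε s) (i : S.ι) :
    S.seqIso ε hs v i = S.weight ε s i * inner ℝ (S.basis i) (S.toL2 ε hs v) := rfl

lemma completeSpace_V {s : ℝ} (hs : 0 ≤ s) : CompleteSpace (S.V ε s) :=
  (S.seqIso ε hs).toIsometryEquiv.completeSpace

open Classical in
/-- The eigenfunctions as elements of `V_s`. -/
noncomputable def basisV {s : ℝ} (hs : 0 ≤ s) (i : S.ι) : S.V ε s :=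
  (S.seqIso ε hs).symm (lp.single 2 i (S.weight ε s i))

lemma toL2_basisV {s : ℝ} (hs : 0 ≤ s) (i : S.ι) : S.toL2 ε hs (S.basisV ε hs i) = S.basis i := by
  classical
  refine S.ext_inner fun j => ?_
  refine mul_left_cancel₀ (S.weight_pos ε s j).ne' ?_
  rw [← S.seqIso_apply, basisV, LinearIsometryEquiv.apply_symm_apply, lp.single_apply, S.inner_basis]
  by_cases h : j = i
  · subst h; simp
  · simp [h]

/-- Eigenfunctions span a dense subspace of V_s; identities in V_{-s} can thus be checked one mode
at a time, where the scalar theory applies. -/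
lemma dual_ext {s : ℝ} (hs : 0 ≤ s) {x y : S.Vdual ε s}
    (h : ∀ i, x (S.basisV ε hs i) = y (S.basisV ε hs i)) : x = y := by
  classical
  have key : x.comp ((S.seqIso ε hs).symm.toContinuousLinearEquiv :
      lp (fun _ : S.ι => ℝ) 2 →L[ℝ] S.V ε s) =
      y.comp ((S.seqIso ε hs).symm.toContinuousLinearEquiv :
      lp (fun _ : S.ι => ℝ) 2 →L[ℝ] S.V ε s) := by
    refine lp.ext_continuousLinearMap (by norm_num) fun i => ContinuousLinearMap.ext_ring ?_
    have h1 : lp.single (E := fun _ : S.ι => ℝ) 2 i (1:ℝ) =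
        (S.weight ε s i)⁻¹ • lp.single (E := fun _ : S.ι => ℝ) 2 i (S.weight ε s i) := by
      rw [← lp.single_smul, smul_eq_mul, inv_mul_cancel₀ (S.weight_pos ε s i).ne']
    show x ((S.seqIso ε hs).symm (lp.single 2 i (1:ℝ))) = y ((S.seqIso ε hs).symm (lp.single 2 i 1))
    rw [h1, map_smul, map_smul, map_smul]
    exact congrArg _ (h i)
  ext v
  have := DFunLike.congr_fun key (S.seqIso ε hs v)
  simpa using this

lemma toVdual_basisV {s : ℝ} (hs : 0 ≤ s) (h : L2 m) (i : S.ι) :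
    S.toVdual ε hs h (S.basisV ε hs i) = inner ℝ (S.basis i) h := by
  show inner ℝ h (S.toL2 ε hs (S.basisV ε hs i)) = _
  rw [toL2_basisV, real_inner_comm]

/-- The inclusion `L² ⊆ V_{-s}` as a continuous linear map. -/
noncomputable def toVdualL {s : ℝ} (hs : 0 ≤ s) : L2 m →L[ℝ] S.Vdual ε s :=
  LinearMap.mkContinuous
    { toFun := S.toVdual ε hs
      map_add' := fun a b => by ext v; simp [toVdual]
      map_smul' := fun c a => by ext v; simp [toVdual] }
    ‖S.toL2 ε hs‖ fun h => by
      refine (ContinuousLinearMap.opNorm_comp_le _ _).trans ?_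
      rw [innerSL_apply_norm, mul_comm]

end EigenSystem

end FracWave

/-! ### Mild solutions: local existence and uniqueness. -/

namespace FracWave

section Mild

variable {H G : Type*} [NormedAddCommGroup H] [NormedSpace ℝ H] [NormedAddCommGroup G]
  [NormedSpace ℝ G] {K : ℝ → H →L[ℝ] G} {k : ℝ → ℝ} {T : ℝ} {N : G → H}

/-- Lipschitz continuity on bounded sets. -/
def LipschitzOnBounded {H G : Type*} [NormedAddCommGroup H] [NormedAddCommGroup G] (N : G → H) :
    Prop :=
  ∀ R : ℝ, ∃ L : ℝ, 0 ≤ L ∧ ∀ v w : G, ‖v‖ ≤ R → ‖w‖ ≤ R → ‖N v - N w‖ ≤ L * ‖v - w‖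

lemma LipschitzOnBounded.continuous {H G : Type*} [NormedAddCommGroup H] [NormedAddCommGroup G]
    {N : G → H} (hN : LipschitzOnBounded N) : Continuous N := by
  refine continuous_iff_continuousAt.2 fun v => ?_
  obtain ⟨L, -, h⟩ := hN (‖v‖ + 1)
  rw [ContinuousAt, tendsto_iff_norm_sub_tendsto_zero]
  have h1 : Tendsto (fun w => L * ‖w - v‖) (𝓝 v) (𝓝 0) := by
    have h2 : Continuous fun w : G => L * ‖w - v‖ := by fun_prop
    simpa using h2.tendsto v
  refine squeeze_zero' (Eventually.of_forall fun _ => norm_nonneg _) ?_ h1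
  have h3 : ∀ᶠ w in 𝓝 v, ‖w‖ < ‖v‖ + 1 :=
    continuous_norm.continuousAt.eventually (gt_mem_nhds (by linarith))
  filter_upwards [h3] with w hw
  exact h w v hw.le (by linarith)

lemma IsConvKernel.opConv_sub (hK : IsConvKernel T K k) {F F' : ℝ → H}
    (hF : ContinuousOn F (Icc 0 T)) (hF' : ContinuousOn F' (Icc 0 T)) {t : ℝ} (ht : t ∈ Icc 0 T) :
    opConv K F t - opConv K F' t = opConv K (fun s => F s - F' s) t := by
  rw [opConv, opConv, opConv, ← intervalIntegral.integral_sub (hK.intervalIntegrable hF ht)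
    (hK.intervalIntegrable hF' ht)]
  simp

lemma IsConvKernel.integral_nonneg (hK : IsConvKernel T K k) {t : ℝ} (ht : t ∈ Icc 0 T) :
    0 ≤ ∫ τ in (0 : ℝ)..t, k τ := by
  rw [intervalIntegral.integral_of_le ht.1]
  exact setIntegral_nonneg measurableSet_Ioc fun τ hτ =>
    (norm_nonneg _).trans (hK.norm_le τ ⟨hτ.1, hτ.2.trans ht.2⟩)

lemma IsConvKernel.integral_mono (hK : IsConvKernel T K k) {s t : ℝ} (hs : 0 ≤ s) (hst : s ≤ t)
    (ht : t ≤ T) : ∫ τ in (0 : ℝ)..s, k τ ≤ ∫ τ in (0 : ℝ)..t, k τ := by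
  have h1 : IntervalIntegrable k volume 0 s := (hK.mono hs (hst.trans ht)).integrable
  have h2 : IntervalIntegrable k volume 0 t := (hK.mono (hs.trans hst) ht).integrable
  rw [← intervalIntegral.integral_add_adjacent_intervals h1 (h1.symm.trans h2)]
  have : 0 ≤ ∫ τ in s..t, k τ := by
    rw [intervalIntegral.integral_of_le hst]
    exact setIntegral_nonneg measurableSet_Ioc fun τ hτ =>
      (norm_nonneg _).trans (hK.norm_le τ ⟨hs.trans_lt hτ.1, hτ.2.trans ht⟩)
  linarith

lemma IsConvKernel.exists_integral_le (hK : IsConvKernel T K k) (hT : 0 < T) {η : ℝ} (hη : 0 < η) :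
    ∃ h : ℝ, 0 < h ∧ h ≤ T ∧ ∫ τ in (0 : ℝ)..h, k τ ≤ η := by
  have h1 : ContinuousOn (fun t => ∫ τ in (0 : ℝ)..t, k τ) (Icc 0 T) := by
    have := intervalIntegral.continuousOn_primitive_interval'
      (μ := volume) (f := k) (b₁ := 0) (b₂ := T) (a := 0) hK.integrable left_mem_uIcc
    rwa [uIcc_of_le hT.le] at this
  have h2 : Tendsto (fun t => ∫ τ in (0 : ℝ)..t, k τ) (𝓝[Icc 0 T] 0) (𝓝 0) := by
    have := h1 0 ⟨le_rfl, hT.le⟩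
    rw [ContinuousWithinAt, intervalIntegral.integral_same] at this
    exact this
  have h3 : ∀ᶠ t in 𝓝[>] (0:ℝ), ∫ τ in (0 : ℝ)..t, k τ < η := by
    have h4 : 𝓝[>] (0:ℝ) ≤ 𝓝[Icc 0 T] 0 := by
      rw [← nhdsWithin_Ioc_eq_nhdsGT hT]
      exact nhdsWithin_mono _ Ioc_subset_Icc_self
    exact (h2.mono_left h4).eventually (gt_mem_nhds hη)
  obtain ⟨h, hh, hh1⟩ := (h3.and (Ioc_mem_nhdsGT hT)).exists
  exact ⟨h, hh1.1, hh1.2, hh.le⟩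

/-- Local existence for the mild formulation. -/
theorem IsConvKernel.exists_mild [CompleteSpace G] (hK : IsConvKernel 1 K k) (hN : LipschitzOnBounded N) {g : ℝ → G}
    (hg : ContinuousOn g (Icc 0 1)) : ∃ T : ℝ, 0 < T ∧ T ≤ 1 ∧ ∃ u : ℝ → G, Continuous u ∧
      ∀ t ∈ Icc 0 T, u t = g t + opConv K (fun τ => N (u τ)) t := by
  obtain ⟨B, hB⟩ := isCompact_Icc.exists_bound_of_continuousOn hg
  have hB0 : 0 ≤ B := (norm_nonneg _).trans (hB 0 ⟨le_rfl, zero_le_one⟩)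
  -- The radius leaves room 1 above sup ‖g‖. T is taken with κ(L + M + 1) ≤ 1/2, so that κM ≤ 1
  -- keeps the ball invariant and κL ≤ 1/2 makes the map contract.
  set R := B + 1 with hR
  obtain ⟨L, hL0, hL⟩ := hN R
  set M := L * R + ‖N 0‖ with hM
  have hM0 : 0 ≤ M := by positivity
  obtain ⟨T, hT0, hT1, hTk⟩ := hK.exists_integral_le one_pos (η := 1 / (2 * (L + M + 1)))
    (by positivity)
  have hKT := hK.mono hT0.le hT1
  have hTT : T ∈ Icc 0 T := ⟨hT0.le, le_rfl⟩
  set κ := ∫ τ in (0 : ℝ)..T, k τ with hκ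
  have hκ0 : 0 ≤ κ := hKT.integral_nonneg hTT
  rw [le_div_iff₀ (by positivity)] at hTk
  have hκL : κ * L ≤ 1 / 2 := by nlinarith
  have hκM : κ * M ≤ 1 := by nlinarith
  have hle : ∀ t ∈ Icc 0 T, ∫ τ in (0 : ℝ)..t, k τ ≤ κ := fun t ht =>
    hKT.integral_mono ht.1 ht.2 le_rfl
  -- Extension by the end values makes u continuous on all of ℝ.
  let ex : C(Icc (0:ℝ) T, G) → ℝ → G := fun u => IccExtend hT0.le u
  have hex : ∀ u, Continuous (ex u) := fun u => u.continuous.Icc_extend'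
  have hexn : ∀ u t, ‖ex u t‖ ≤ ‖u‖ := fun u t => u.norm_coe_le_norm _
  have hF : ∀ u, ContinuousOn (fun τ => N (ex u τ)) (Icc 0 T) := fun u =>
    (hN.continuous.comp (hex u)).continuousOn
  let Φ : C(Icc (0:ℝ) T, G) → C(Icc (0:ℝ) T, G) := fun u =>
    ⟨fun t => g t + opConv K (fun τ => N (ex u τ)) t, by
      have h1 : ContinuousOn (fun t => g t + opConv K (fun τ => N (ex u τ)) t) (Icc 0 T) :=
        (hg.mono (Icc_subset_Icc_right hT1)).add (hKT.continuousOn_opConv (hF u))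
      exact h1.domRestrict⟩
  have hNb : ∀ v : G, ‖v‖ ≤ R → ‖N v‖ ≤ M := fun v hv => by
    have h1 := hL v 0 hv (by simp; positivity)
    have h2 : ‖N v‖ ≤ ‖N v - N 0‖ + ‖N 0‖ := by
      have := norm_add_le (N v - N 0) (N 0); rwa [sub_add_cancel] at this
    rw [sub_zero] at h1
    have : L * ‖v‖ ≤ L * R := by gcongr
    linarith
  have hmaps : MapsTo Φ (Metric.closedBall 0 R) (Metric.closedBall 0 R) := by
    intro u hu
    rw [mem_closedBall_zero_iff] at hu ⊢
    refine (ContinuousMap.norm_le _ (by positivity)).2 fun t => ?_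
    have h1 := hKT.norm_opConv_le (F := fun τ => N (ex u τ)) t.2 (M := M)
      (fun τ _ => hNb _ ((hexn u τ).trans hu))
    have h2 := mul_le_mul_of_nonneg_right (hle t t.2) hM0
    have h3 := hB t ⟨t.2.1, t.2.2.trans hT1⟩
    refine (norm_add_le _ _).trans ?_
    linarith
  have hcontr : ContractingWith (1 / 2) (hmaps.restrict Φ _ _) := by
    refine ⟨by norm_num, LipschitzWith.of_dist_le_mul fun u v => ?_⟩
    rw [Subtype.dist_eq, Subtype.dist_eq, dist_eq_norm, dist_eq_norm]
    have hu := u.2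
    have hv := v.2
    rw [mem_closedBall_zero_iff] at hu hv
    refine (ContinuousMap.norm_le _ (by positivity)).2 fun t => ?_
    have h0 : (((hmaps.restrict Φ _ _) u : C(Icc (0:ℝ) T, G)) -
        ((hmaps.restrict Φ _ _) v : C(Icc (0:ℝ) T, G))) t =
        opConv K (fun τ => N (ex u τ) - N (ex v τ)) t := by
      rw [← hKT.opConv_sub (hF u) (hF v) t.2]
      exact add_sub_add_left_eq_sub _ _ _
    rw [h0]
    have h1 := hKT.norm_opConv_le (F := fun τ => N (ex u τ) - N (ex v τ)) t.2
      (M := L * ‖(u : C(Icc (0:ℝ) T, G)) - v‖) (fun τ _ => by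
        refine (hL _ _ ((hexn _ τ).trans hu) ((hexn _ τ).trans hv)).trans ?_
        gcongr
        exact ((u : C(Icc (0:ℝ) T, G)) - v).norm_coe_le_norm (projIcc 0 T hT0.le τ))
    refine h1.trans ?_
    have h2 := mul_le_mul_of_nonneg_right (hle t t.2)
      (by positivity : 0 ≤ L * ‖(u : C(Icc (0:ℝ) T, G)) - v‖)
    refine h2.trans ?_
    rw [← mul_assoc]
    refine mul_le_mul_of_nonneg_right ?_ (norm_nonneg _)
    simpa using hκL
  obtain ⟨u, -, hu, -⟩ := hcontr.exists_fixedPoint' Metric.isClosed_closedBall.isComplete hmaps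
    (x := 0) (by simp; positivity) (edist_ne_top _ _)
  refine ⟨T, hT0, hT1, ex u, hex u, fun t ht => ?_⟩
  have h1 := DFunLike.congr_fun hu (⟨t, ht⟩ : Icc (0:ℝ) T)
  have h2 : ex u t = u ⟨t, ht⟩ := IccExtend_of_mem _ _ ht
  rw [h2]
  exact h1.symm

/-- Uniqueness for the mild formulation. -/
theorem IsConvKernel.eqOn_of_mild (hK : IsConvKernel T K k) (hT : 0 < T) (hN : LipschitzOnBounded N)
    {g u v : ℝ → G} (hu : ContinuousOn u (Icc 0 T)) (hv : ContinuousOn v (Icc 0 T))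
    (hu' : ∀ t ∈ Icc 0 T, u t = g t + opConv K (fun τ => N (u τ)) t)
    (hv' : ∀ t ∈ Icc 0 T, v t = g t + opConv K (fun τ => N (v τ)) t) : EqOn u v (Icc 0 T) := by
  obtain ⟨B₁, hB₁⟩ := isCompact_Icc.exists_bound_of_continuousOn hu
  obtain ⟨B₂, hB₂⟩ := isCompact_Icc.exists_bound_of_continuousOn hv
  obtain ⟨L, hL0, hL⟩ := hN (max B₁ B₂)
  obtain ⟨h, hh0, hhT, hhk⟩ := hK.exists_integral_le hT (η := 1 / (2 * (L + 1))) (by positivity)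
  rw [le_div_iff₀ (by positivity)] at hhk
  have hκ0 : 0 ≤ ∫ τ in (0 : ℝ)..h, k τ := hK.integral_nonneg ⟨hh0.le, hhT⟩
  have hκL : (∫ τ in (0 : ℝ)..h, k τ) * L ≤ 1 / 2 := by nlinarith
  have hFu : ContinuousOn (fun τ => N (u τ)) (Icc 0 T) := hN.continuous.comp_continuousOn hu
  have hFv : ContinuousOn (fun τ => N (v τ)) (Icc 0 T) := hN.continuous.comp_continuousOn hv
  have hd : ∀ τ ∈ Icc 0 T, ‖N (u τ) - N (v τ)‖ ≤ L * ‖u τ - v τ‖ := fun τ hτ =>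
    hL _ _ ((hB₁ τ hτ).trans (le_max_left _ _)) ((hB₂ τ hτ).trans (le_max_right _ _))
  -- Induction over windows of length h with L ∫₀ʰ k ≤ 1/2. Once u = v up to c = nh, the difference
  -- at s is driven only by times in (c, s], so its maximum M on [0, b] satisfies M ≤ M/2.
  have key : ∀ n : ℕ, ∀ t ∈ Icc 0 T, t ≤ n * h → u t = v t := by
    intro n
    induction n with
    | zero =>
      intro t ht ht0
      have : t = 0 := le_antisymm (by simpa using ht0) ht.1
      subst this
      rw [hu' 0 ht, hv' 0 ht]
      simp [opConv]
    | succ n ih =>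
      intro t ht htn
      set b := min T ((n + 1 : ℕ) * h) with hb
      have hb0 : 0 ≤ b := le_min hT.le (by positivity)
      have hsub : Icc 0 b ⊆ Icc 0 T := Icc_subset_Icc_right (min_le_left _ _)
      obtain ⟨s, hs, hmax⟩ := (isCompact_Icc (a := (0:ℝ)) (b := b)).exists_isMaxOn ⟨0, le_rfl, hb0⟩
        (((hu.sub hv).mono hsub).norm)
      have hsT := hsub hs
      set M := ‖u s - v s‖ with hMdef
      have hM : ∀ τ ∈ Icc 0 b, ‖u τ - v τ‖ ≤ M := fun τ hτ => hmax hτ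
      suffices hM0 : M = 0 by
        have := hM t ⟨ht.1, le_min ht.2 htn⟩
        rw [hM0] at this
        exact sub_eq_zero.1 (norm_le_zero_iff.1 this)
      rcases le_or_gt s (n * h) with hsn | hsn
      · rw [hMdef, ih s hsT hsn, sub_self, norm_zero]
      · set c := (n : ℝ) * h with hc
        have hc0 : 0 ≤ c := by positivity
        set D : ℝ → H := fun τ => N (u τ) - N (v τ) with hD
        have hDc : ContinuousOn D (Icc 0 T) := hFu.sub hFv
        have hD0 : ∀ τ ∈ Icc 0 c, D τ = 0 := fun τ hτ => by
          rw [hD]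
          simp only
          rw [ih τ ⟨hτ.1, hτ.2.trans (hsn.le.trans hsT.2)⟩ hτ.2, sub_self]
        have h1 : u s - v s = opConv K D s := by
          rw [hu' s hsT, hv' s hsT, add_sub_add_left_eq_sub, hK.opConv_sub hFu hFv hsT]
        have hint := hK.intervalIntegrable hDc hsT
        have h2 : opConv K D s = opConv K (fun τ => D (τ + c)) (s - c) := by
          have hi1 : IntervalIntegrable (fun τ => K (s - τ) (D τ)) volume 0 c :=
            hint.mono_set (by
              rw [uIcc_of_le hc0, uIcc_of_le hsT.1]; exact Icc_subset_Icc_right hsn.le)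
          have hi2 : IntervalIntegrable (fun τ => K (s - τ) (D τ)) volume c s := hi1.symm.trans hint
          have hz : ∫ τ in (0:ℝ)..c, K (s - τ) (D τ) = 0 := by
            rw [intervalIntegral.integral_congr (g := fun _ => (0:G)) fun τ hτ => ?_]
            · simp
            · rw [uIcc_of_le hc0] at hτ
              simp only [hD0 τ hτ, map_zero]
          rw [opConv, ← intervalIntegral.integral_add_adjacent_intervals hi1 hi2, hz, zero_add, opConv]
          have := intervalIntegral.integral_comp_add_right (a := 0) (b := s - c)
            (fun τ => K (s - τ) (D τ)) c
          rw [zero_add, sub_add_cancel] at this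
          rw [← this]
          refine intervalIntegral.integral_congr fun τ _ => ?_
          congr 2
          ring
        have hsc : s - c ∈ Icc 0 h := by
          refine ⟨by linarith, ?_⟩
          have := hs.2.trans (min_le_right _ _)
          push_cast at this
          rw [hc]
          linarith
        have h3 := hK.norm_opConv_le (F := fun τ => D (τ + c)) (t := s - c) (M := L * M)
          ⟨hsc.1, hsc.2.trans hhT⟩ (fun τ hτ => by
            have h4 : τ + c ∈ Icc 0 b := ⟨by linarith [hτ.1], by linarith [hτ.2, hs.2]⟩
            exact (hd _ (hsub h4)).trans (by gcongr; exact hM _ h4))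
        rw [← h2, ← h1] at h3
        have h4 := hK.integral_mono hsc.1 hsc.2 hhT
        have hMn : 0 ≤ M := norm_nonneg _
        have h5 : (∫ τ in (0 : ℝ)..(s - c), k τ) * (L * M) ≤ (∫ τ in (0 : ℝ)..h, k τ) * (L * M) := by
          gcongr
        have h6 : (∫ τ in (0 : ℝ)..h, k τ) * (L * M) ≤ 1 / 2 * M := by
          rw [← mul_assoc]; gcongr
        linarith
  intro t ht
  obtain ⟨n, hn⟩ := exists_nat_ge (t / h)
  exact key n t ht (by rwa [div_le_iff₀ hh0] at hn)

end Mild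

end FracWave

/-! ### Solution operators and their smoothing. -/

namespace FracWave

lemma conv_const_mul_left (a b : ℝ → ℝ) (r t : ℝ) : conv (fun s => r * a s) b t = r * conv a b t := by
  rw [conv_comm, conv_const_mul_right, conv_comm]

namespace EigenSystem

variable {X : Type*} [MeasurableSpace X] {m : Measure X} {E : DirichletForm m}
  (S : EigenSystem E) (ε : S.Shift) {α : ℝ}

/-- Subadditivity of x ↦ x^s for 0 ≤ s ≤ 1 separates the shift from the powers of λ. -/
lemma weight_le_add {s : ℝ} (h0 : 0 ≤ s) (h1 : s ≤ 1) (i : S.ι) :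
    S.weight ε s i ≤ S.eigenvalue i ^ s + ε.1 ^ s := by
  exact Real.rpow_add_le_add_rpow (S.eigenvalue_nonneg i) ε.2.1 h0 h1

/-- θ = 1/α handles λ^(1/α), θ = 0 handles the shift. For β = α the result is integrable at 0 since
α > 1; for β = 2 it is bounded there, which is why u₁ ∈ L² suffices for u to stay in V_{1/α}. -/
lemma exists_weight_mul_abs_mlKernel_le (hα : 1 < α) (hα2 : α < 2) {β : ℝ} (hβ : 1 < β) :
    ∃ C : ℝ, 0 ≤ C ∧ ∀ t : ℝ, 0 < t → ∀ i,
      |S.weight ε (1 / α) i * mlKernel α (S.eigenvalue i) β t| ≤ C * (t ^ (β - 2) + t ^ (β - 1)) := by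
  have hγ1 : 1 / α ≤ 1 := by rw [div_le_one (by linarith)]; exact hα.le
  have hα0 : α ≠ 0 := by linarith
  obtain ⟨C₁, hC₁, h₁⟩ := exists_rpow_mul_abs_mlKernel_le (β := β) hα hα2 (by linarith)
    (gamma_nonneg hα) hγ1 (by rw [mul_one_div_cancel hα0]; exact hβ)
  obtain ⟨C₂, hC₂, h₂⟩ := exists_rpow_mul_abs_mlKernel_le (β := β) hα hα2 (by linarith)
    le_rfl zero_le_one (by linarith)
  refine ⟨C₁ + ε.1 ^ (1 / α) * C₂, by have := ε.2.1; positivity, fun t ht i => ?_⟩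
  have e1 := h₁ _ (S.eigenvalue_nonneg i) t ht
  have e2 := h₂ _ (S.eigenvalue_nonneg i) t ht
  rw [mul_one_div_cancel hα0, show β - 1 - 1 = β - 2 by ring] at e1
  rw [Real.rpow_zero, one_mul, mul_zero, sub_zero] at e2
  rw [abs_mul, abs_of_pos (S.weight_pos ε _ i)]
  have e3 : 0 ≤ ε.1 ^ (1 / α) := Real.rpow_nonneg ε.2.1 _
  have p1 : 0 ≤ t ^ (β - 2) := by positivity
  have p2 : 0 ≤ t ^ (β - 1) := by positivity
  calc _ ≤ (S.eigenvalue i ^ (1 / α) + ε.1 ^ (1 / α)) * |mlKernel α (S.eigenvalue i) β t| := by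
        gcongr
        exact S.weight_le_add ε (gamma_nonneg hα) hγ1 i
    _ ≤ C₁ * t ^ (β - 2) + ε.1 ^ (1 / α) * (C₂ * t ^ (β - 1)) := by
        rw [add_mul]; gcongr
    _ ≤ _ := by
        have q1 : 0 ≤ C₁ * t ^ (β - 1) := by positivity
        have q2 : 0 ≤ ε.1 ^ (1 / α) * C₂ * t ^ (β - 2) := by positivity
        linarith

lemma exists_abs_mlKernel_le (hα : 1 < α) (hα2 : α < 2) {β : ℝ} (hβ : 0 < β) :
    ∃ C : ℝ, 0 ≤ C ∧ ∀ t : ℝ, 0 < t → ∀ i,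
      |mlKernel α (S.eigenvalue i) β t| ≤ C * t ^ (β - 1) := by
  obtain ⟨C₂, hC₂, h₂⟩ := exists_rpow_mul_abs_mlKernel_le (β := β) hα hα2 hβ
    le_rfl zero_le_one (by linarith)
  refine ⟨C₂, hC₂.le, fun t ht i => ?_⟩
  have e2 := h₂ _ (S.eigenvalue_nonneg i) t ht
  rwa [Real.rpow_zero, one_mul, mul_zero, sub_zero] at e2

lemma exists_abs_mlKernel_one_le (hα : 1 < α) (hα2 : α < 2) : ∃ C : ℝ, 0 ≤ C ∧ ∀ t : ℝ, 0 ≤ t →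
    ∀ i, |mlKernel α (S.eigenvalue i) 1 t| ≤ C := by
  obtain ⟨C, hC, h⟩ := S.exists_abs_mlKernel_le hα hα2 one_pos
  refine ⟨C + 1, by positivity, fun t ht i => ?_⟩
  rcases ht.eq_or_lt with rfl | ht
  · rw [mlKernel_one_at_zero hα]; simpa using hC
  · have := h t ht i
    rw [sub_self, Real.rpow_zero] at this
    linarith

lemma exists_abs_weight_mul_mlKernel_two_le (hα : 1 < α) (hα2 : α < 2) : ∃ C : ℝ, 0 ≤ C ∧
    ∀ t : ℝ, 0 ≤ t → ∀ i,
      |S.weight ε (1 / α) i * mlKernel α (S.eigenvalue i) 2 t| ≤ C * (1 + t) := by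
  obtain ⟨C, hC, h⟩ := S.exists_weight_mul_abs_mlKernel_le ε hα hα2 one_lt_two
  refine ⟨C, hC, fun t ht i => ?_⟩
  rcases ht.eq_or_lt with rfl | ht
  · rw [mlKernel_at_zero one_lt_two]; simpa using hC
  · have := h t ht i
    rwa [sub_self, Real.rpow_zero, show (2:ℝ) - 1 = 1 by norm_num, Real.rpow_one] at this

/-- For the velocity produced by u₀: in λ = λ^(1/α) λ^(1-1/α) the weight of V_{1/α} absorbs the
first factor, and θ = 1 - 1/α makes the power of t in the kernel bound vanish. So u₀ ∈ V_{1/α} is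
exactly matched to an L² velocity. -/
lemma exists_abs_eigenvalue_mul_mlKernel_le (hα : 1 < α) (hα2 : α < 2) : ∃ C : ℝ, 0 ≤ C ∧
    ∀ t : ℝ, 0 ≤ t → ∀ i, |-(S.eigenvalue i * mlKernel α (S.eigenvalue i) α t) *
      (S.weight ε (1 / α) i)⁻¹| ≤ C := by
  have hα0 : α ≠ 0 := by linarith
  have hγ : 1 / α < 1 := by rw [div_lt_one (by linarith)]; exact hα
  have e : α * (1 - 1 / α) = α - 1 := by field_simp
  obtain ⟨C, hC, h⟩ := exists_rpow_mul_abs_mlKernel_le (β := α) (θ := 1 - 1 / α) hα hα2 (by linarith)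
    (by linarith) (by linarith [gamma_nonneg hα]) (by rw [e]; linarith)
  refine ⟨C, hC.le, fun t ht i => ?_⟩
  rcases ht.eq_or_lt with rfl | ht
  · rw [mlKernel_at_zero hα]; simpa using hC.le
  have h1 := h _ (S.eigenvalue_nonneg i) t ht
  rw [e, show α - 1 - (α - 1) = 0 by ring, Real.rpow_zero, mul_one] at h1
  have hw := S.weight_pos ε (1 / α) i
  rw [abs_mul, abs_neg, abs_mul, abs_of_nonneg (S.eigenvalue_nonneg i), abs_of_pos (inv_pos.2 hw),
    ← div_eq_mul_inv, div_le_iff₀ hw]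
  have h2 : S.eigenvalue i = S.eigenvalue i ^ (1 / α) * S.eigenvalue i ^ (1 - 1 / α) := by
    rw [← Real.rpow_add_of_nonneg (S.eigenvalue_nonneg i) (gamma_nonneg hα) (by linarith)]
    simp
  have h3 : S.eigenvalue i ^ (1 / α) ≤ S.weight ε (1 / α) i :=
    Real.rpow_le_rpow (S.eigenvalue_nonneg i) (by linarith [ε.2.1]) (gamma_nonneg hα)
  calc S.eigenvalue i * |mlKernel α (S.eigenvalue i) α t|
      = S.eigenvalue i ^ (1 / α) * (S.eigenvalue i ^ (1 - 1 / α) *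
          |mlKernel α (S.eigenvalue i) α t|) := by
        rw [← mul_assoc, ← h2]
    _ ≤ S.weight ε (1 / α) i * C :=
        mul_le_mul h3 h1 (mul_nonneg (Real.rpow_nonneg (S.eigenvalue_nonneg i) _) (abs_nonneg _)) hw.le
    _ = _ := mul_comm _ _

/-- The solution operator of the inhomogeneous equation, with values in `V_{1/α}`. -/
noncomputable def kerV (hα : 1 < α) (t : ℝ) : L2 m →L[ℝ] S.V ε (1 / α) :=
  mult S.basis.repr (S.seqIso ε (gamma_nonneg hα))
    fun i => S.weight ε (1 / α) i * mlKernel α (S.eigenvalue i) α t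

/-- The time derivative of the solution operator of the inhomogeneous equation. -/
noncomputable def kerD (α t : ℝ) : L2 m →L[ℝ] L2 m :=
  mult S.basis.repr S.basis.repr fun i => mlKernel α (S.eigenvalue i) (α - 1) t

/-- The solution of the homogeneous equation. -/
noncomputable def freeV (hα : 1 < α) (u₀ : S.V ε (1 / α)) (u₁ : L2 m) (t : ℝ) : S.V ε (1 / α) :=
  mult (S.seqIso ε (gamma_nonneg hα)) (S.seqIso ε (gamma_nonneg hα))
    (fun i => mlKernel α (S.eigenvalue i) 1 t) u₀ +
  mult S.basis.repr (S.seqIso ε (gamma_nonneg hα))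
    (fun i => S.weight ε (1 / α) i * mlKernel α (S.eigenvalue i) 2 t) u₁

/-- The time derivative of the solution of the linear equation with right-hand side `F`. -/
noncomputable def velocity (hα : 1 < α) (u₀ : S.V ε (1 / α)) (u₁ : L2 m) (F : ℝ → L2 m) (t : ℝ) :
    L2 m :=
  mult (S.seqIso ε (gamma_nonneg hα)) S.basis.repr
    (fun i => -(S.eigenvalue i * mlKernel α (S.eigenvalue i) α t) * (S.weight ε (1 / α) i)⁻¹) u₀ +
  mult S.basis.repr S.basis.repr (fun i => mlKernel α (S.eigenvalue i) 1 t) u₁ +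
  opConv (S.kerD α) F t

lemma exists_isConvKernel_kerV (hα : 1 < α) (hα2 : α < 2) (T : ℝ) : ∃ k : ℝ → ℝ,
    IsConvKernel T (S.kerV ε hα) k ∧ ∀ t, 0 < t → ∀ i,
      |S.weight ε (1 / α) i * mlKernel α (S.eigenvalue i) α t| ≤ k t := by
  obtain ⟨C, hC, h⟩ := S.exists_weight_mul_abs_mlKernel_le ε hα hα2 hα
  refine ⟨fun t => C * (t ^ (α - 2) + t ^ (α - 1)), isConvKernel_mult (fun i => ?_) ?_ ?_
    (fun t ht => by positivity) h, h⟩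
  · exact continuousOn_const.mul (continuousOn_mlKernel hα (by linarith))
  · refine continuousOn_const.mul (ContinuousOn.add ?_ ?_) <;>
    exact fun t ht => (Real.continuousAt_rpow_const _ _ (Or.inl (ne_of_gt ht))).continuousWithinAt
  · exact ((intervalIntegral.intervalIntegrable_rpow' (by linarith)).add
      (intervalIntegral.intervalIntegrable_rpow' (by linarith))).const_mul C

lemma exists_isConvKernel_kerD (hα : 1 < α) (hα2 : α < 2) (T : ℝ) : ∃ k : ℝ → ℝ,
    IsConvKernel T (S.kerD α) k ∧ ∀ t, 0 < t → ∀ i,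
      |mlKernel α (S.eigenvalue i) (α - 1) t| ≤ k t := by
  obtain ⟨C, hC, h⟩ := S.exists_abs_mlKernel_le (β := α - 1) hα hα2 (by linarith)
  refine ⟨fun t => C * t ^ (α - 1 - 1), isConvKernel_mult (fun i => ?_) ?_ ?_
    (fun t ht => by positivity) h, h⟩
  · exact continuousOn_mlKernel hα (by linarith)
  · refine continuousOn_const.mul ?_
    exact fun t ht => (Real.continuousAt_rpow_const _ _ (Or.inl (ne_of_gt ht))).continuousWithinAt
  · exact (intervalIntegral.intervalIntegrable_rpow' (by linarith)).const_mul C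

lemma continuousOn_freeV (hα : 1 < α) (hα2 : α < 2) (u₀ : S.V ε (1 / α)) (u₁ : L2 m) :
    ContinuousOn (S.freeV ε hα u₀ u₁) (Ici 0) := by
  obtain ⟨C₁, -, h₁⟩ := S.exists_abs_mlKernel_one_le hα hα2
  obtain ⟨C₂, -, h₂⟩ := S.exists_abs_weight_mul_mlKernel_two_le ε hα hα2
  refine ContinuousOn.add ?_ ?_
  · exact continuousOn_mult (k := fun _ => C₁) (fun i => (continuous_mlKernel hα le_rfl).continuousOn)
      continuousOn_const h₁ u₀
  · exact continuousOn_mult (k := fun t => C₂ * (1 + t))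
      (fun i => ((continuous_mlKernel hα one_le_two).const_mul _).continuousOn)
      (by fun_prop) h₂ u₁

lemma inner_toL2_eq (hα : 1 < α) (v : S.V ε (1 / α)) (i : S.ι) :
    inner ℝ (S.basis i) (S.toL2 ε (gamma_nonneg hα) v) =
      (S.weight ε (1 / α) i)⁻¹ * S.seqIso ε (gamma_nonneg hα) v i := by
  rw [seqIso_apply, inv_mul_cancel_left₀ (S.weight_pos ε _ i).ne']

lemma inner_freeV_left (hα : 1 < α) (hα2 : α < 2) (u₀ : S.V ε (1 / α)) {t : ℝ}
    (ht : 0 ≤ t) (i : S.ι) :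
    inner ℝ (S.basis i) (S.toL2 ε (gamma_nonneg hα)
      (mult (S.seqIso ε (gamma_nonneg hα)) (S.seqIso ε (gamma_nonneg hα))
        (fun i => mlKernel α (S.eigenvalue i) 1 t) u₀)) =
      inner ℝ (S.basis i) (S.toL2 ε (gamma_nonneg hα) u₀) * mlKernel α (S.eigenvalue i) 1 t := by
  obtain ⟨C₁, -, h₁⟩ := S.exists_abs_mlKernel_one_le hα hα2
  rw [S.inner_toL2_eq ε hα, mult_apply (h₁ t ht), S.inner_toL2_eq ε hα]
  ring

lemma inner_freeV_right (hα : 1 < α) (hα2 : α < 2) (u₁ : L2 m) {t : ℝ} (ht : 0 ≤ t) (i : S.ι) :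
    inner ℝ (S.basis i) (S.toL2 ε (gamma_nonneg hα)
      (mult S.basis.repr (S.seqIso ε (gamma_nonneg hα))
        (fun i => S.weight ε (1 / α) i * mlKernel α (S.eigenvalue i) 2 t) u₁)) =
      inner ℝ (S.basis i) u₁ * mlKernel α (S.eigenvalue i) 2 t := by
  obtain ⟨C₂, -, h₂⟩ := S.exists_abs_weight_mul_mlKernel_two_le ε hα hα2
  rw [S.inner_toL2_eq ε hα, mult_apply (h₂ t ht), S.basis.repr_apply_apply]
  have := (S.weight_pos ε (1 / α) i).ne'
  field_simp

lemma inner_opConv_kerV (hα : 1 < α) (hα2 : α < 2) {F : ℝ → L2 m} {T : ℝ}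
    (hF : ContinuousOn F (Icc 0 T)) {t : ℝ} (ht : t ∈ Icc 0 T) (i : S.ι) :
    inner ℝ (S.basis i) (S.toL2 ε (gamma_nonneg hα) (opConv (S.kerV ε hα) F t)) =
      conv (mlKernel α (S.eigenvalue i) α) (fun τ => inner ℝ (S.basis i) (F τ)) t := by
  obtain ⟨k, hk, hk2⟩ := S.exists_isConvKernel_kerV ε hα hα2 T
  have := S.completeSpace_V ε (gamma_nonneg hα)
  rw [S.inner_toL2_eq ε hα]
  refine (congrArg _ (opConv_mult_apply hk hk2 hF ht i)).trans ?_
  rw [conv_const_mul_left, inv_mul_cancel_left₀ (S.weight_pos ε _ i).ne']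
  simp only [S.basis.repr_apply_apply]

lemma inner_mild (hα : 1 < α) (hα2 : α < 2) (u₀ : S.V ε (1 / α)) (u₁ : L2 m) {F : ℝ → L2 m} {T : ℝ}
    (hF : ContinuousOn F (Icc 0 T)) {t : ℝ} (ht : t ∈ Icc 0 T) (i : S.ι) :
    inner ℝ (S.basis i) (S.toL2 ε (gamma_nonneg hα)
      (S.freeV ε hα u₀ u₁ t + opConv (S.kerV ε hα) F t)) =
      mlSolution α (S.eigenvalue i) (inner ℝ (S.basis i) (S.toL2 ε (gamma_nonneg hα) u₀))
        (inner ℝ (S.basis i) u₁) (fun τ => inner ℝ (S.basis i) (F τ)) t := by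
  rw [freeV, map_add, map_add, inner_add_right, inner_add_right, S.inner_freeV_left ε hα hα2 u₀ ht.1,
    S.inner_freeV_right ε hα hα2 u₁ ht.1, S.inner_opConv_kerV ε hα hα2 hF ht, mlSolution]

lemma continuousOn_velocity (hα : 1 < α) (hα2 : α < 2) (u₀ : S.V ε (1 / α)) (u₁ : L2 m)
    {F : ℝ → L2 m} {T : ℝ} (hF : ContinuousOn F (Icc 0 T)) :
    ContinuousOn (S.velocity ε hα u₀ u₁ F) (Icc 0 T) := by
  obtain ⟨C₁, -, h₁⟩ := S.exists_abs_mlKernel_one_le hα hα2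
  obtain ⟨C₂, -, h₂⟩ := S.exists_abs_eigenvalue_mul_mlKernel_le ε hα hα2
  obtain ⟨k, hk, -⟩ := S.exists_isConvKernel_kerD hα hα2 T
  refine ContinuousOn.add (ContinuousOn.add ?_ ?_) (hk.continuousOn_opConv hF)
  · exact continuousOn_mult (k := fun _ => C₂) (fun i =>
      ((((continuous_mlKernel hα hα.le).const_mul _).neg).mul_const _).continuousOn)
      continuousOn_const (fun t ht => h₂ t ht.1) u₀
  · exact continuousOn_mult (k := fun _ => C₁) (fun i => (continuous_mlKernel hα le_rfl).continuousOn)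
      continuousOn_const (fun t ht => h₁ t ht.1) u₁

lemma inner_velocity (hα : 1 < α) (hα2 : α < 2) (u₀ : S.V ε (1 / α)) (u₁ : L2 m) {F : ℝ → L2 m}
    {T : ℝ} (hF : ContinuousOn F (Icc 0 T)) {t : ℝ} (ht : t ∈ Icc 0 T) (i : S.ι) :
    inner ℝ (S.basis i) (S.velocity ε hα u₀ u₁ F t) =
      mlSolutionDeriv α (S.eigenvalue i) (inner ℝ (S.basis i) (S.toL2 ε (gamma_nonneg hα) u₀))
        (inner ℝ (S.basis i) u₁) (fun τ => inner ℝ (S.basis i) (F τ)) t := by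
  obtain ⟨C₁, -, h₁⟩ := S.exists_abs_mlKernel_one_le hα hα2
  obtain ⟨C₂, -, h₂⟩ := S.exists_abs_eigenvalue_mul_mlKernel_le ε hα hα2
  obtain ⟨k, hk, hk2⟩ := S.exists_isConvKernel_kerD hα hα2 T
  rw [velocity, inner_add_right, inner_add_right, ← S.basis.repr_apply_apply,
    ← S.basis.repr_apply_apply, ← S.basis.repr_apply_apply, mult_apply (h₁ t ht.1),
    mult_apply (h₂ t ht.1), mlSolutionDeriv]
  have h3 := opConv_mult_apply hk hk2 hF ht i
  have h4 : S.basis.repr (opConv (S.kerD α) F t) i = conv (mlKernel α (S.eigenvalue i) (α - 1))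
    (fun τ => inner ℝ (S.basis i) (F τ)) t := by
    refine h3.trans ?_
    simp only [S.basis.repr_apply_apply]
  rw [h4, S.inner_toL2_eq ε hα, S.basis.repr_apply_apply]
  ring

lemma velocity_zero (hα : 1 < α) (hα2 : α < 2) (u₀ : S.V ε (1 / α)) (u₁ : L2 m) {F : ℝ → L2 m}
    {T : ℝ} (hT : 0 ≤ T) (hF : ContinuousOn F (Icc 0 T)) : S.velocity ε hα u₀ u₁ F 0 = u₁ := by
  refine S.ext_inner fun i => ?_
  rw [S.inner_velocity ε hα hα2 u₀ u₁ hF ⟨le_rfl, hT⟩, mlSolutionDeriv, mlKernel_at_zero hα,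
    mlKernel_one_at_zero hα, conv_zero]
  ring

lemma toL2_injective {s : ℝ} (hs : 0 ≤ s) : Function.Injective (S.toL2 ε hs) :=
  fun _ _ h => Subtype.ext h

/-- Mode by mode this is `mlSolution_eq_integral`. As the velocity is continuous in L², mild
solutions are C¹ with values in L². -/
lemma toL2_mild_eq_integral (hα : 1 < α) (hα2 : α < 2) (u₀ : S.V ε (1 / α)) (u₁ : L2 m)
    {F : ℝ → L2 m} {T : ℝ} (hF : ContinuousOn F (Icc 0 T)) {t : ℝ} (ht : t ∈ Icc 0 T) :
    S.toL2 ε (gamma_nonneg hα) (S.freeV ε hα u₀ u₁ t + opConv (S.kerV ε hα) F t) =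
      S.toL2 ε (gamma_nonneg hα) u₀ + ∫ s in (0:ℝ)..t, S.velocity ε hα u₀ u₁ F s := by
  refine S.ext_inner fun i => ?_
  have hc := S.continuousOn_velocity ε hα hα2 u₀ u₁ hF
  have hi : IntervalIntegrable (S.velocity ε hα u₀ u₁ F) volume 0 t := by
    refine ContinuousOn.intervalIntegrable ?_
    rw [uIcc_of_le ht.1]
    exact hc.mono (Icc_subset_Icc_right ht.2)
  have hFi : ContinuousOn (fun τ => inner ℝ (S.basis i) (F τ)) (Icc 0 T) := by fun_prop
  have h1 := ((innerSL ℝ (S.basis i)).intervalIntegral_comp_comm hi).symm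
  rw [S.inner_mild ε hα hα2 u₀ u₁ hF ht, inner_add_right, mlSolution_eq_integral hα hFi ht]
  congr 1
  refine Eq.trans ?_ h1.symm
  refine intervalIntegral.integral_congr fun s hs => ?_
  rw [uIcc_of_le ht.1] at hs
  exact (S.inner_velocity ε hα hα2 u₀ u₁ hF ⟨hs.1, hs.2.trans ht.2⟩ i).symm

lemma mild_zero (hα : 1 < α) (hα2 : α < 2) (u₀ : S.V ε (1 / α)) (u₁ : L2 m)
    {F : ℝ → L2 m} {T : ℝ} (hT : 0 ≤ T) (hF : ContinuousOn F (Icc 0 T)) :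
    S.freeV ε hα u₀ u₁ 0 + opConv (S.kerV ε hα) F 0 = u₀ := by
  refine S.toL2_injective ε (gamma_nonneg hα) ?_
  rw [S.toL2_mild_eq_integral ε hα hα2 u₀ u₁ hF ⟨le_rfl, hT⟩]
  simp

end EigenSystem

end FracWave

/-! ### From mild to weak solutions. -/

namespace FracWave

lemma HasSum.of_forall_eq {ι : Type*} {f g : ι → ℝ} {s : ℝ} (h : HasSum g s) (e : ∀ i, f i = g i) :
    HasSum f s := by
  rwa [funext e]

namespace EigenSystem

variable {X : Type*} [MeasurableSpace X] {m : Measure X} {E : DirichletForm m}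
  (S : EigenSystem E) (ε : S.Shift) {α : ℝ}

/-- α < 2 gives 2/α ≥ 1, so the V_{1/α} norm controls the energy norm. -/
lemma toL2_mem_dom (hα : 1 < α) (hα2 : α < 2) (v : S.V ε (1 / α)) :
    S.toL2 ε (gamma_nonneg hα) v ∈ E.dom := by
  obtain ⟨c, hc, h⟩ := S.exists_sum_rpow_mul_sq_le ε (gamma_nonneg hα)
  refine S.mem_dom_of_summable (summable_of_sum_le (c := c * ‖v‖ ^ 2) (fun i => ?_) fun F => ?_)
  · have := S.one_le_add_eigenvalue i
    positivity
  · refine le_trans (Finset.sum_le_sum fun i _ => ?_) (h v F)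
    refine mul_le_mul_of_nonneg_right ?_ (sq_nonneg _)
    have h1 : 1 ≤ 2 * (1 / α) := by
      rw [mul_one_div, one_le_div (by linarith)]; exact hα2.le
    exact Real.self_le_rpow_of_one_le (S.one_le_add_eigenvalue i) h1

/-- The sequence which represents the form in the coordinates of `V_{1/α}`. -/
noncomputable def symbol (α : ℝ) (i : S.ι) : ℝ := S.eigenvalue i * (S.weight ε (1 / α) i ^ 2)⁻¹

/-- The symbol is at most (λ+ε)^(1-2/α), a nonpositive power of a quantity bounded below by δ. This
is what makes A bounded from V_{1/α} to V_{-1/α}. -/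
lemma exists_abs_symbol_le (hα : 1 < α) (hα2 : α < 2) : ∃ C : ℝ, ∀ i, |S.symbol ε α i| ≤ C := by
  obtain ⟨hε, δ, hδ, hle⟩ := ε.2
  refine ⟨δ ^ (1 - 1 / α * 2), fun i => ?_⟩
  have hb := S.base_pos ε i
  have hw := S.weight_pos ε (1 / α) i
  have h1 : 1 ≤ 1 / α * 2 := by
    rw [one_div_mul_eq_div, one_le_div (by linarith)]; exact hα2.le
  rw [symbol, abs_of_nonneg (mul_nonneg (S.eigenvalue_nonneg i) (by positivity))]
  calc S.eigenvalue i * (S.weight ε (1 / α) i ^ 2)⁻¹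
      ≤ (S.eigenvalue i + ε.1) * (S.weight ε (1 / α) i ^ 2)⁻¹ := by gcongr; linarith
    _ = (S.eigenvalue i + ε.1) ^ (1 - 1 / α * 2) := by
        rw [Real.rpow_sub hb, Real.rpow_one, Real.rpow_mul hb.le, weight, Real.rpow_ofNat]
        exact (div_eq_mul_inv _ _).symm
    _ ≤ _ := Real.rpow_le_rpow_of_nonpos hδ (hle i) (by linarith)

/-- The operator `A : V_{1/α} → V_{-1/α}`. -/
noncomputable def stiffness (hα : 1 < α) : S.V ε (1 / α) →L[ℝ] S.Vdual ε (1 / α) :=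
  ((ContinuousLinearMap.compL ℝ (S.V ε (1 / α)) (lp (fun _ : S.ι => ℝ) 2) ℝ).flip
    ((S.seqIso ε (gamma_nonneg hα)).toContinuousLinearEquiv :
      S.V ε (1 / α) →L[ℝ] lp (fun _ : S.ι => ℝ) 2)).comp
  ((innerSL ℝ).comp ((diag (S.symbol ε α)).comp
    ((S.seqIso ε (gamma_nonneg hα)).toContinuousLinearEquiv :
      S.V ε (1 / α) →L[ℝ] lp (fun _ : S.ι => ℝ) 2)))

lemma hasSum_stiffness (hα : 1 < α) (hα2 : α < 2) (v φ : S.V ε (1 / α)) :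
    HasSum (fun i => S.eigenvalue i * (inner ℝ (S.basis i) (S.toL2 ε (gamma_nonneg hα) v) *
      inner ℝ (S.basis i) (S.toL2 ε (gamma_nonneg hα) φ))) (S.stiffness ε hα v φ) := by
  obtain ⟨C, hC⟩ := S.exists_abs_symbol_le ε hα hα2
  have h := lp.hasSum_inner (𝕜 := ℝ) (diag (S.symbol ε α) (S.seqIso ε (gamma_nonneg hα) v))
    (S.seqIso ε (gamma_nonneg hα) φ)
  have h1 : S.stiffness ε hα v φ = inner ℝ (diag (S.symbol ε α) (S.seqIso ε (gamma_nonneg hα) v))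
    (S.seqIso ε (gamma_nonneg hα) φ) := rfl
  rw [h1]
  refine HasSum.of_forall_eq h fun i => ?_
  rw [diag_apply hC, S.inner_toL2_eq ε hα, S.inner_toL2_eq ε hα, symbol]
  simp only [RCLike.inner_apply, conj_trivial]
  have := (S.weight_pos ε (1 / α) i).ne'
  field_simp

lemma stiffness_basisV (hα : 1 < α) (hα2 : α < 2) (v : S.V ε (1 / α)) (i : S.ι) :
    S.stiffness ε hα v (S.basisV ε (gamma_nonneg hα) i) =
      S.eigenvalue i * inner ℝ (S.basis i) (S.toL2 ε (gamma_nonneg hα) v) := by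
  classical
  refine (S.hasSum_stiffness ε hα hα2 v _).unique ?_
  have h := hasSum_ite_eq i (S.eigenvalue i * inner ℝ (S.basis i) (S.toL2 ε (gamma_nonneg hα) v))
  refine HasSum.of_forall_eq h fun j => ?_
  rw [toL2_basisV, inner_basis]
  by_cases hj : j = i
  · subst hj; simp
  · simp [hj]

/-- Subtract Parseval for the L² product from the spectral sum `hasSum_form`. -/
lemma form_eq_stiffness (hα : 1 < α) (hα2 : α < 2) (v φ : S.V ε (1 / α)) :
    E.form ⟨_, S.toL2_mem_dom ε hα hα2 v⟩ ⟨_, S.toL2_mem_dom ε hα hα2 φ⟩ =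
      S.stiffness ε hα v φ := by
  have h1 := S.hasSum_form ⟨_, S.toL2_mem_dom ε hα hα2 v⟩ ⟨_, S.toL2_mem_dom ε hα hα2 φ⟩
  have h2 := S.basis.hasSum_inner_mul_inner (S.toL2 ε (gamma_nonneg hα) v)
    (S.toL2 ε (gamma_nonneg hα) φ)
  have h3 := (h1.sub h2).unique (HasSum.of_forall_eq (S.hasSum_stiffness ε hα hα2 v φ) fun i => ?_)
  · simpa using h3
  · rw [real_inner_comm (S.basis i) (S.toL2 ε (gamma_nonneg hα) v)]
    ring

lemma norm_incl_zero_le {s : ℝ} (hs : 0 ≤ s) (v : S.V ε s) :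
    ‖S.incl ε le_rfl hs v‖ = ‖S.toL2 ε hs v‖ := by
  have h1 := S.hasSum_norm_sq ε (S.incl ε le_rfl hs v)
  have h2 := S.tsum_inner_sq (S.toL2 ε hs v)
  have h3 := h1.unique (HasSum.of_forall_eq h2 fun i => ?_)
  · exact (sq_eq_sq₀ (norm_nonneg _) (norm_nonneg _)).1 h3
  · rw [weight, Real.rpow_zero, one_mul]
    rfl

end EigenSystem

section Caputo

variable {X : Type*} [MeasurableSpace X] {m : Measure X} {E : DirichletForm m}
  (S : EigenSystem E) {α : ℝ}

/-- The kernel t^(1-α) is integrable because α < 2, so the coordinate functional passes under the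
integral and leaves a convolution with g_{2-α}. -/
lemma EigenSystem.inner_caputoIntegral (hα : 1 < α) (hα2 : α < 2) {U : ℝ → L2 m} {T : ℝ}
    (hU : ContinuousOn U (Icc 0 T)) (a b : L2 m) {t : ℝ} (ht : t ∈ Icc 0 T) (i : S.ι) :
    inner ℝ (S.basis i) (caputoIntegral α U a b t) = conv (mlKernel α 0 (2 - α))
      (fun s => inner ℝ (S.basis i) (U s) - inner ℝ (S.basis i) a - inner ℝ (S.basis i) b * s) t := by
  have hK : IsConvKernel T (fun τ => (τ ^ (1 - α)) • ContinuousLinearMap.id ℝ (L2 m))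
      (fun τ => τ ^ (1 - α)) := by
    have hc : ContinuousOn (fun τ : ℝ => τ ^ (1 - α)) (Ioi 0) := fun t ht =>
      (Real.continuousAt_rpow_const _ _ (Or.inl (ne_of_gt ht))).continuousWithinAt
    refine ⟨hc, intervalIntegral.intervalIntegrable_rpow' (by linarith), fun τ hτ => ?_, fun x => ?_⟩
    · have hτ0 : 0 ≤ τ ^ (1 - α) := Real.rpow_nonneg hτ.1.le _
      refine ContinuousLinearMap.opNorm_le_bound _ hτ0 fun x => ?_
      rw [smul_apply, norm_smul, Real.norm_of_nonneg hτ0]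
      rfl
    · exact hc.smul continuousOn_const
  have hc : ContinuousOn (fun s => U s - a - s • b) (Icc 0 T) := by fun_prop
  have hint := hK.intervalIntegrable hc ht
  have h1 := ((innerSL ℝ (S.basis i)).intervalIntegral_comp_comm hint).symm
  rw [caputoIntegral, inner_smul_right, conv]
  refine (congrArg _ h1).trans ?_
  rw [← intervalIntegral.integral_const_mul]
  refine intervalIntegral.integral_congr fun s _ => ?_
  simp only [smul_apply, ContinuousLinearMap.id_apply, innerSL_apply_apply,
    inner_smul_right, inner_sub_right]
  rw [mlKernel_zero_left hα (by linarith), show 2 - α - 1 = 1 - α by ring]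
  ring

end Caputo

namespace EigenSystem

variable {X : Type*} [MeasurableSpace X] {m : Measure X} {E : DirichletForm m}
  (S : EigenSystem E) (ε : S.Shift) {α : ℝ} {T : ℝ} {u₀ : S.V ε (1 / α)} {u₁ : L2 m}
  {F : ℝ → L2 m} {u : ℝ → S.V ε (1 / α)}

/-- On each eigenfunction this is `conv_mlSolution_sub`. It identifies the Caputo derivative as f(u)
- Au, continuous in V_{-1/α}. -/
lemma toVdual_caputoIntegral_mild (hα : 1 < α) (hα2 : α < 2) (hF : ContinuousOn F (Icc 0 T))
    (hu : ContinuousOn u (Icc 0 T))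
    (h : ∀ t ∈ Icc 0 T, u t = S.freeV ε hα u₀ u₁ t + opConv (S.kerV ε hα) F t)
    {t : ℝ} (ht : t ∈ Icc 0 T) :
    S.toVdual ε (gamma_nonneg hα) (caputoIntegral α (fun s => S.toL2 ε (gamma_nonneg hα) (u s))
      (S.toL2 ε (gamma_nonneg hα) u₀) u₁ t) =
    ∫ s in (0:ℝ)..t, ∫ r in (0:ℝ)..s, (S.toVdual ε (gamma_nonneg hα) (F r) -
      S.stiffness ε hα (u r)) := by
  set w : ℝ → S.Vdual ε (1 / α) := fun r => S.toVdual ε (gamma_nonneg hα) (F r) -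
      S.stiffness ε hα (u r) with hw
  have hwc : ContinuousOn w (Icc 0 T) :=
    ((S.toVdualL ε (gamma_nonneg hα)).continuous.comp_continuousOn hF).sub
      ((S.stiffness ε hα).continuous.comp_continuousOn hu)
  have hwc2 : ContinuousOn (fun s => ∫ r in (0:ℝ)..s, w r) (Icc 0 T) := fun s hs =>
    (hasDerivWithinAt_integral_Icc hwc hs).continuousWithinAt
  have hint : ∀ {g : ℝ → S.Vdual ε (1 / α)}, ContinuousOn g (Icc 0 T) → ∀ s ∈ Icc 0 T,
      IntervalIntegrable g volume 0 s := fun hg s hs => by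
    refine ContinuousOn.intervalIntegrable ?_
    rw [uIcc_of_le hs.1]
    exact hg.mono (Icc_subset_Icc_right hs.2)
  refine S.dual_ext ε (gamma_nonneg hα) fun i => ?_
  have hUc : ContinuousOn (fun s => S.toL2 ε (gamma_nonneg hα) (u s)) (Icc 0 T) := by fun_prop
  have hFi : ContinuousOn (fun τ => inner ℝ (S.basis i) (F τ)) (Icc 0 T) := by fun_prop
  have hui : ∀ s ∈ Icc 0 T, inner ℝ (S.basis i) (S.toL2 ε (gamma_nonneg hα) (u s)) =
      mlSolution α (S.eigenvalue i) (inner ℝ (S.basis i) (S.toL2 ε (gamma_nonneg hα) u₀))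
        (inner ℝ (S.basis i) u₁) (fun τ => inner ℝ (S.basis i) (F τ)) s := fun s hs => by
    rw [h s hs, S.inner_mild ε hα hα2 u₀ u₁ hF hs]
  rw [toVdual_basisV, S.inner_caputoIntegral hα hα2 hUc _ _ ht, conv_congr ht.1 (fun _ _ => rfl)
    (fun s hs => by rw [hui s ⟨hs.1.le, hs.2.le.trans ht.2⟩]), conv_mlSolution_sub hα hα2 hFi ht,
    ContinuousLinearMap.intervalIntegral_apply (hint hwc2 t ht)]
  refine intervalIntegral.integral_congr fun s hs => ?_
  rw [uIcc_of_le ht.1] at hs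
  have hs' : s ∈ Icc 0 T := ⟨hs.1, hs.2.trans ht.2⟩
  rw [ContinuousLinearMap.intervalIntegral_apply (hint hwc s hs')]
  refine intervalIntegral.integral_congr fun r hr => ?_
  rw [uIcc_of_le hs.1] at hr
  simp only [hw, sub_apply]
  rw [toVdual_basisV, S.stiffness_basisV ε hα hα2, hui r ⟨hr.1, hr.2.trans hs'.2⟩]

/-- A solution of the mild formulation is a weak solution. -/
theorem weakSolutionCore_of_mild (hα : 1 < α) (hα2 : α < 2) {f : ℝ → ℝ} {N : S.V ε (1 / α) → L2 m}
    (hN : ∀ v, N v =ᵐ[m] fun x => f (S.toL2Lin ε (1 / α) v x)) (hNc : Continuous N) (hT : 0 < T)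
    (hu : Continuous u) (h : ∀ t ∈ Icc 0 T, u t = S.freeV ε hα u₀ u₁ t +
      opConv (S.kerV ε hα) (fun τ => N (u τ)) t) :
    ∃ w, WeakSolutionCore S ε hα f u₀ u₁ T u (S.velocity ε hα u₀ u₁ fun τ => N (u τ)) w ∧
      ContinuousOn w (Icc 0 T) := by
  have hF : ContinuousOn (fun τ => N (u τ)) (Icc 0 T) := (hNc.comp hu).continuousOn
  have h0 : (0:ℝ) ∈ Icc 0 T := ⟨le_rfl, hT.le⟩
  have hu0 : u 0 = u₀ := by rw [h 0 h0, S.mild_zero ε hα hα2 u₀ u₁ hT.le hF]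
  have hv0 := S.velocity_zero ε hα hα2 u₀ u₁ hT.le hF
  have hvc := S.continuousOn_velocity ε hα hα2 u₀ u₁ hF
  have hGT : 𝓝[>] (0:ℝ) ≤ 𝓝[Icc 0 T] 0 := by
    rw [← nhdsWithin_Ioc_eq_nhdsGT hT]
    exact nhdsWithin_mono _ Ioc_subset_Icc_self
  set w : ℝ → S.Vdual ε (1 / α) := fun r => S.toVdual ε (gamma_nonneg hα) (N (u r)) -
      S.stiffness ε hα (u r) with hw
  have hwc : ContinuousOn w (Icc 0 T) :=
    ((S.toVdualL ε (gamma_nonneg hα)).continuous.comp_continuousOn hF).sub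
      ((S.stiffness ε hα).continuous.comp hu).continuousOn
  refine ⟨w, ⟨hu.continuousOn, fun t ht => ?_, hvc, ?_, hu0, hv0, ?_, ?_, ?_, ?_⟩, hwc⟩
  · refine ((hasDerivWithinAt_integral_Icc hvc ht).const_add
      (S.toL2 ε (gamma_nonneg hα) u₀)).congr (fun s hs => ?_) ?_
    · rw [h s hs, S.toL2_mild_eq_integral ε hα hα2 u₀ u₁ hF hs]
    · rw [h t ht, S.toL2_mild_eq_integral ε hα hα2 u₀ u₁ hF ht]
  · refine ⟨(hwc.integrableOn_Icc).mono_set Ioo_subset_Icc_self, fun s => ∫ r in (0:ℝ)..s, w r,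
      fun t ht => ?_, fun t _ => by simp⟩
    have hwc2 : ContinuousOn (fun s => ∫ r in (0:ℝ)..s, w r) (Icc 0 T) := fun s hs =>
      (hasDerivWithinAt_integral_Icc hwc hs).continuousWithinAt
    rw [hu0, hv0]
    exact (hasDerivWithinAt_integral_Icc hwc2 ht).congr
      (fun s hs => S.toVdual_caputoIntegral_mild ε hα hα2 hF hu.continuousOn h hs)
      (S.toVdual_caputoIntegral_mild ε hα hα2 hF hu.continuousOn h ht)
  -- σ = 0 is enough, the norm of V₀ being that of L².
  · refine ⟨0, le_rfl, by positivity, ?_⟩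
    have h1 : Continuous fun t => ‖S.toL2 ε (gamma_nonneg hα) (u t - u₀)‖ := by fun_prop
    have h2 := h1.tendsto 0
    rw [hu0, sub_self, map_zero, norm_zero] at h2
    refine (h2.mono_left nhdsWithin_le_nhds).congr fun t => ?_
    rw [S.norm_incl_zero_le ε (gamma_nonneg hα)]
  · have hβ : 0 < 1 - 1 / α := by
      rw [sub_pos, div_lt_one (by linarith)]; exact hα
    -- Any admissible β would do, since the velocity converges in L².
    refine ⟨1 - 1 / α, hβ, le_rfl, ?_⟩
    have h1 : ContinuousOn (fun t => ‖S.toVdualL ε hβ.le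
      (S.velocity ε hα u₀ u₁ (fun τ => N (u τ)) t - u₁)‖) (Icc 0 T) := by fun_prop
    have h2 := h1 0 h0
    rw [ContinuousWithinAt, hv0, sub_self, map_zero, norm_zero] at h2
    exact h2.mono_left hGT
  · exact ae_of_all _ fun t => (memLp_congr_ae (hN (u t))).1 (Lp.memLp _)
  · refine fun φ => ae_of_all _ fun t => ⟨S.toL2_mem_dom ε hα hα2 _, S.toL2_mem_dom ε hα hα2 _, ?_⟩
    rw [S.form_eq_stiffness ε hα hα2]
    have h1 : w t φ + S.stiffness ε hα (u t) φ =
        inner ℝ (N (u t)) (S.toL2 ε (gamma_nonneg hα) φ) := by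
      simp only [hw, sub_apply, sub_add_cancel]
      rfl
    rw [h1, inner_L2]
    refine integral_congr_ae ?_
    filter_upwards [hN (u t)] with x hx
    rw [hx]
    rfl

end EigenSystem

end FracWave

/-! ### From weak to mild solutions; local well-posedness. -/

namespace FracWave

/-- The convolution is bounded by M t ∫₀ᵗ |k| = o(t). This fixes the integration constant that
`IsSecondDeriv` leaves open. -/
lemma hasDerivWithinAt_conv_zero {k b : ℝ → ℝ} {T M : ℝ} (hT : 0 < T) (hk : ContinuousOn k (Ioi 0))
    (hi : IntervalIntegrable k volume 0 T) (hM : 0 ≤ M) (hb : ∀ s ∈ Icc 0 T, |b s| ≤ M * s) :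
    HasDerivWithinAt (conv k b) 0 (Icc 0 T) 0 := by
  have hK := isConvKernel_lsmul hk hi
  rw [hasDerivWithinAt_iff_isLittleO, Asymptotics.isLittleO_iff]
  intro c hc
  obtain ⟨h, hh0, hhT, hhk⟩ := hK.exists_integral_le hT (η := c / (M + 1)) (by positivity)
  have h1 : ∀ᶠ t in 𝓝[Icc 0 T] (0:ℝ), t < h :=
    eventually_nhdsWithin_of_eventually_nhds (gt_mem_nhds hh0)
  filter_upwards [h1, self_mem_nhdsWithin] with t ht htT
  rw [conv_zero, smul_zero, sub_zero, sub_zero, sub_zero, ← opConv_lsmul]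
  have h2 := hK.norm_opConv_le (F := b) htT (M := M * t) fun τ hτ =>
    (hb τ ⟨hτ.1, hτ.2.trans htT.2⟩).trans (by gcongr; exact hτ.2)
  have h3 := (hK.integral_mono htT.1 ht.le hhT).trans hhk
  refine h2.trans ?_
  rw [Real.norm_of_nonneg htT.1, ← mul_assoc]
  refine mul_le_mul_of_nonneg_right ?_ htT.1
  calc _ ≤ c / (M + 1) * M := by gcongr
    _ ≤ c := by
      rw [div_mul_eq_mul_div, div_le_iff₀ (by positivity)]
      nlinarith

lemma eq_zero_of_hasDerivWithinAt_zero {D : ℝ → ℝ} {T : ℝ} (hD0 : D 0 = 0)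
    (hD : ∀ t ∈ Icc 0 T, HasDerivWithinAt D 0 (Icc 0 T) t) : ∀ t ∈ Icc 0 T, D t = 0 := by
  intro t ht
  rw [← hD0]
  refine constant_of_has_deriv_right_zero (fun s hs => (hD s hs).continuousWithinAt)
    (fun s hs => ?_) t ht
  exact (hD s ⟨hs.1, hs.2.le⟩).mono_of_mem_nhdsWithin (Icc_mem_nhdsGE_of_mem hs)

namespace EigenSystem

variable {X : Type*} [MeasurableSpace X] {m : Measure X} {E : DirichletForm m}
  (S : EigenSystem E) (ε : S.Shift) {α : ℝ} {T : ℝ} {u₀ : S.V ε (1 / α)} {u₁ : L2 m}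
  {u : ℝ → S.V ε (1 / α)} {f : ℝ → ℝ} {N : S.V ε (1 / α) → L2 m}

lemma integral_nonlinearity (hα : 1 < α)
    (hN : ∀ v, N v =ᵐ[m] fun x => f (S.toL2Lin ε (1 / α) v x)) (v : S.V ε (1 / α)) (g : L2 m) :
    ∫ x, f (S.toL2 ε (gamma_nonneg hα) v x) * g x ∂m = inner ℝ g (N v) := by
  rw [real_inner_comm, inner_L2]
  refine integral_congr_ae ?_
  filter_upwards [hN v] with x hx
  rw [hx]
  rfl

/-- A weak solution satisfies the mild formulation. -/
theorem mild_of_weakSolutionCore (hα : 1 < α) (hα2 : α < 2)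
    (hN : ∀ v, N v =ᵐ[m] fun x => f (S.toL2Lin ε (1 / α) v x)) (hNc : Continuous N) (hT : 0 < T)
    {du : ℝ → L2 m} {w : ℝ → S.Vdual ε (1 / α)} (h : WeakSolutionCore S ε hα f u₀ u₁ T u du w) :
    ∀ t ∈ Icc 0 T, u t = S.freeV ε hα u₀ u₁ t + opConv (S.kerV ε hα) (fun τ => N (u τ)) t := by
  have hF : ContinuousOn (fun τ => N (u τ)) (Icc 0 T) := hNc.comp_continuousOn h.continuousOn
  have h0 : (0:ℝ) ∈ Icc 0 T := ⟨le_rfl, hT.le⟩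
  have hU : ContinuousOn (fun s => S.toL2 ε (gamma_nonneg hα) (u s)) (Icc 0 T) :=
    (S.toL2 ε (gamma_nonneg hα)).continuous.comp_continuousOn h.continuousOn
  suffices key : ∀ i, ∀ t ∈ Icc 0 T, inner ℝ (S.basis i) (S.toL2 ε (gamma_nonneg hα) (u t)) =
      mlSolution α (S.eigenvalue i) (inner ℝ (S.basis i) (S.toL2 ε (gamma_nonneg hα) u₀))
        (inner ℝ (S.basis i) u₁) (fun τ => inner ℝ (S.basis i) (N (u τ))) t by
    intro t ht
    refine S.toL2_injective ε (gamma_nonneg hα) (S.ext_inner fun i => ?_)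
    rw [key i t ht, S.inner_mild ε hα hα2 u₀ u₁ hF ht]
  intro i
  set e := S.basisV ε (gamma_nonneg hα) i with he
  set a := inner ℝ (S.basis i) (S.toL2 ε (gamma_nonneg hα) u₀) with ha
  set b := inner ℝ (S.basis i) u₁ with hb
  set ui : ℝ → ℝ := fun t => inner ℝ (S.basis i) (S.toL2 ε (gamma_nonneg hα) (u t)) with hui
  have huic : ContinuousOn ui (Icc 0 T) := by fun_prop
  have hFi : ContinuousOn (fun τ => inner ℝ (S.basis i) (N (u τ))) (Icc 0 T) :=
    (innerSL ℝ (S.basis i)).continuous.comp_continuousOn hF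
  refine eq_mlSolution_of_conv_sub hT hα hα2 hFi huic ?_
  set Gi : ℝ → ℝ := fun r => inner ℝ (S.basis i) (N (u r)) - S.eigenvalue i * ui r with hGi
  have hGc : ContinuousOn Gi (Icc 0 T) := hFi.sub (huic.const_mul _)
  set c := conv (mlKernel α 0 (2 - α)) (fun s => ui s - a - b * s) with hc
  -- the Caputo integral in coordinates
  have hcJ : ∀ t ∈ Icc 0 T, S.toVdual ε (gamma_nonneg hα)
      (caputoIntegral α (fun s => S.toL2 ε (gamma_nonneg hα) (u s))
        (S.toL2 ε (gamma_nonneg hα) (u 0)) (du 0) t) e = c t := fun t ht => by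
    rw [he, toVdual_basisV, h.init, h.init_deriv, S.inner_caputoIntegral hα hα2 hU _ _ ht]
  obtain ⟨hwi, K, hK, hKw⟩ := h.caputo
  have hcd : ∀ t ∈ Icc 0 T, HasDerivWithinAt c (K t e) (Icc 0 T) t := fun t ht => by
    have h1 := (hK t ht).clm_apply (hasDerivWithinAt_const t (Icc 0 T) e)
    simp only [map_zero, add_zero] at h1
    exact h1.congr (fun s hs => (hcJ s hs).symm) (hcJ t ht).symm
  -- A single test function e is used, so it does not matter that the exceptional set of times may
  -- depend on the test function.
  have hwG : ∀ᵐ r ∂(volume.restrict (Ioo 0 T)), w r e = Gi r := by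
    filter_upwards [h.variational e] with r ⟨h1, h2, h3⟩
    have h4 := S.form_eq_stiffness ε hα hα2 (u r) e
    rw [he, S.stiffness_basisV ε hα hα2, ← he] at h4
    rw [h4, S.integral_nonlinearity ε hα hN, he, toL2_basisV] at h3
    rw [hGi, he]
    linarith
  have hKe : ∀ t ∈ Icc 0 T, K t e = K 0 e + ∫ r in (0:ℝ)..t, Gi r := fun t ht => by
    have hwt : IntervalIntegrable w volume 0 t :=
      (intervalIntegrable_iff_integrableOn_Ioo_of_le ht.1).2
        (hwi.mono_set (Ioo_subset_Ioo_right ht.2))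
    rw [hKw t ht, add_apply, ContinuousLinearMap.intervalIntegral_apply hwt]
    congr 1
    rw [intervalIntegral.integral_of_le ht.1, intervalIntegral.integral_of_le ht.1,
      integral_Ioc_eq_integral_Ioo, integral_Ioc_eq_integral_Ioo]
    exact integral_congr_ae (ae_restrict_of_ae_restrict_of_subset (Ioo_subset_Ioo_right ht.2) hwG)
  -- the initial derivative of the Caputo integral
  have hK0 : K 0 e = 0 := by
    obtain ⟨B, hB⟩ := isCompact_Icc.exists_bound_of_continuousOn h.continuousOn_deriv
    have hB0 : 0 ≤ B := (norm_nonneg _).trans (hB 0 h0)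
    -- The velocity is bounded, so u(s) - u₀ - s u₁ is O(s) along the mode; its fractional integral
    -- is then o(t), and the derivative at 0 must vanish.
    have h1 : ∀ s ∈ Icc 0 T, |ui s - a - b * s| ≤ (B + |b|) * s := fun s hs => by
      have h2 := (convex_Icc 0 T).norm_image_sub_le_of_norm_hasDerivWithin_le h.hasDeriv hB h0 hs
      rw [sub_zero, Real.norm_of_nonneg hs.1, h.init, ← map_sub] at h2
      have h3 : |ui s - a| ≤ ‖S.toL2 ε (gamma_nonneg hα) (u s - u₀)‖ := by
        have := abs_real_inner_le_norm (S.basis i) (S.toL2 ε (gamma_nonneg hα) (u s - u₀))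
        rw [S.norm_basis, one_mul, map_sub, inner_sub_right] at this
        rw [map_sub]
        exact this
      have h4 : |b * s| = |b| * s := by rw [abs_mul, abs_of_nonneg hs.1]
      have h5 := abs_sub (ui s - a) (b * s)
      rw [h4] at h5
      linarith
    have h2 : HasDerivWithinAt c 0 (Icc 0 T) 0 :=
      hasDerivWithinAt_conv_zero hT (continuousOn_mlKernel hα (by linarith))
        (intervalIntegrable_mlKernel hα (by linarith) _ _) (by positivity) h1
    exact ((uniqueDiffOn_Icc hT) 0 h0).eq_deriv _ (hcd 0 h0) h2
  have hGc2 : ContinuousOn (fun s => ∫ r in (0:ℝ)..s, Gi r) (Icc 0 T) := fun s hs =>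
    (hasDerivWithinAt_integral_Icc hGc hs).continuousWithinAt
  intro t ht
  -- Both functions vanish at 0 and have the derivative ∫ Gi.
  have hD := eq_zero_of_hasDerivWithinAt_zero
    (D := fun t => c t - ∫ s in (0:ℝ)..t, ∫ r in (0:ℝ)..s, Gi r) (T := T)
    (by simp [hc, conv_zero]) (fun t ht => by
      have h1 := (hcd t ht).sub (hasDerivWithinAt_integral_Icc hGc2 ht)
      rw [hKe t ht, hK0, zero_add, sub_self] at h1
      exact h1) t ht
  exact sub_eq_zero.1 hD

lemma hasSum_of_inner {g : L2 m} {c : S.ι → ℝ} (h : ∀ i, inner ℝ (S.basis i) g = c i) :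
    HasSum (fun i => c i • S.basis i) g := by
  simpa only [h] using S.hasSum_basis g

/-- The variation-of-constants formula for solutions of the mild formulation. -/
theorem variationOfConstants_of_mild (hα : 1 < α) (hα2 : α < 2)
    (hN : ∀ v, N v =ᵐ[m] fun x => f (S.toL2Lin ε (1 / α) v x)) (hNc : Continuous N)
    (hu : Continuous u) (h : ∀ t ∈ Icc 0 T, u t = S.freeV ε hα u₀ u₁ t +
      opConv (S.kerV ε hα) (fun τ => N (u τ)) t) :
    VariationOfConstants S ε hα f u₀ u₁ T u := by
  have hF : ContinuousOn (fun τ => N (u τ)) (Icc 0 T) := (hNc.comp hu).continuousOn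
  refine ⟨fun t _ => (memLp_congr_ae (hN (u t))).1 (Lp.memLp _), fun t ht => ?_⟩
  have h3 : ∀ i, (fun τ => (∫ x, f (S.toL2 ε (gamma_nonneg hα) (u τ) x) * S.basis i x ∂m) *
      ((t - τ) ^ (α - 1) * mittagLeffler α α (-S.eigenvalue i * (t - τ) ^ α))) =
      fun τ => mlKernel α (S.eigenvalue i) α (t - τ) * inner ℝ (S.basis i) (N (u τ)) := fun i => by
    ext τ
    rw [S.integral_nonlinearity ε hα hN, mul_comm, mlKernel]
  have hFi : ∀ i, ContinuousOn (fun τ => inner ℝ (S.basis i) (N (u τ))) (Icc 0 T) := fun i =>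
    (innerSL ℝ (S.basis i)).continuous.comp_continuousOn hF
  refine ⟨_, _, _, S.hasSum_of_inner fun i => (S.inner_freeV_left ε hα hα2 u₀ ht.1 i).trans ?_,
    S.hasSum_of_inner fun i => (S.inner_freeV_right ε hα hα2 u₁ ht.1 i).trans ?_, fun i => ?_,
    S.hasSum_of_inner fun i => (S.inner_opConv_kerV ε hα hα2 hF ht i).trans ?_, ?_⟩
  · rw [mlKernel, sub_self, Real.rpow_zero, one_mul, real_inner_comm]
  · rw [mlKernel, show (2:ℝ) - 1 = 1 by norm_num, Real.rpow_one, real_inner_comm]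
  · rw [h3]
    exact intervalIntegrable_conv (continuousOn_mlKernel hα (by linarith))
      (intervalIntegrable_mlKernel hα (by linarith) _ _) (hFi i) ht
  · rw [h3, conv]
  · rw [h t ht, freeV, map_add, map_add]

/-- Local existence and uniqueness for a locally Lipschitz Nemytskii operator. -/
theorem exists_solution (hα : 1 < α) (hα2 : α < 2)
    (hN : ∀ v, N v =ᵐ[m] fun x => f (S.toL2Lin ε (1 / α) v x)) (hL : LipschitzOnBounded N)
    (u₀ : S.V ε (1 / α)) (u₁ : L2 m) :
    ∃ T : ℝ, 0 < T ∧ ∃ u : ℝ → S.V ε (1 / α), Continuous u ∧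
      (∃ du w, WeakSolutionCore S ε hα f u₀ u₁ T u du w ∧ ContinuousOn w (Icc 0 T)) ∧
      (∀ v dv w, WeakSolutionCore S ε hα f u₀ u₁ T v dv w → EqOn v u (Icc 0 T)) ∧
      VariationOfConstants S ε hα f u₀ u₁ T u := by
  have := S.completeSpace_V ε (gamma_nonneg hα)
  obtain ⟨k, hk, -⟩ := S.exists_isConvKernel_kerV ε hα hα2 1
  obtain ⟨T, hT0, hT1, u, hu, h⟩ := hk.exists_mild hL
    ((S.continuousOn_freeV ε hα hα2 u₀ u₁).mono Icc_subset_Ici_self)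
  refine ⟨T, hT0, u, hu, ⟨_, S.weakSolutionCore_of_mild ε hα hα2 hN hL.continuous hT0 hu h⟩,
    fun v dv w hv => ?_, S.variationOfConstants_of_mild ε hα hα2 hN hL.continuous hu h⟩
  -- Any function satisfying the common core of the two notions of weak solution is mild, and mild
  -- solutions are unique.
  exact (hk.mono hT0.le hT1).eqOn_of_mild hT0 hL hv.continuousOn hu.continuousOn
    (S.mild_of_weakSolutionCore ε hα hα2 hN hL.continuous hT0 hv) h

/-- u is continuous into L^{2r}, hence bounded on [0, T], hence in L^a(0,T; L^{2r}) for every a. The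
Caputo derivative is already continuous, so its L^q component is taken to be 0. -/
lemma isWeakSolutionCrit_of_core (hα : 1 < α) {r C : ℝ} (hr : 1 < r) (hC : 0 ≤ C)
    (hemb : ∀ v : S.V ε (1 / α), eLpNorm (S.toL2Lin ε (1 / α) v) (ENNReal.ofReal (2 * r)) m ≤
      ENNReal.ofReal (C * ‖v‖)) (hu : Continuous u) {du : ℝ → L2 m} {w : ℝ → S.Vdual ε (1 / α)}
    (h : WeakSolutionCore S ε hα f u₀ u₁ T u du w) (hw : ContinuousOn w (Icc 0 T)) (q : ℝ≥0∞) :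
    IsWeakSolutionCrit S ε hα f u₀ u₁ r q T u := by
  have hfact : Fact (1 ≤ ENNReal.ofReal (2 * r)) := ⟨by
    rw [ENNReal.one_le_ofReal]; linarith⟩
  obtain ⟨L, hL⟩ := S.exists_clm_Lp ε hemb hC
  refine ⟨hr, du, w, h, ⟨hfact, fun t => L (u t), ?_, ae_of_all _ fun t => hL (u t)⟩, w, 0, hw,
    MemLp.zero, ae_of_all _ fun t => ?_⟩
  · have hc : Continuous fun t => L (u t) := L.continuous.comp hu
    obtain ⟨B, hB⟩ := (isCompact_Icc (a := 0) (b := T)).exists_bound_of_continuousOn hc.continuousOn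
    refine MemLp.of_bound hc.aestronglyMeasurable.restrict B ?_
    exact (ae_restrict_iff' measurableSet_Ioo).2 (ae_of_all _ fun t ht => hB t ⟨ht.1.le, ht.2.le⟩)
  · have : S.toVdual ε (gamma_nonneg hα) ((0 : ℝ → L2 m) t) = 0 :=
      map_zero (S.toVdualL ε (gamma_nonneg hα))
    rw [this, add_zero]

end EigenSystem

end FracWave

/-! ### The main theorem. -/

theorem mainTheorem1 {X : Type*} [MetricSpace X] [MeasurableSpace X] [BorelSpace X]
    (hX : TotallyBounded (Set.univ : Set X)) (m : Measure X) [IsFiniteMeasure m] [m.Regular]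
    [m.IsOpenPosMeasure] (E : DirichletForm m) (hcomp : E.CompactEmbedding)
    (qA : ℝ≥0∞) (hqA : 1 < qA) (hsob : E.SobolevEmbedding qA) :
    Nonempty (EigenSystem E) ∧
    ∀ (S : EigenSystem E) (ε : S.Shift) (α : ℝ) (hα : 1 < α) (_ : α < 2) (f : ℝ → ℝ)
      (u₀ : S.V ε (1 / α)) (u₁ : L2 m),
      (2 < qA → α < alpha0 qA → Hf2 f →
        ∃ T : ℝ, 0 < T ∧ ∃ u : ℝ → S.V ε (1 / α),
          IsWeakSolution S ε hα f u₀ u₁ T u ∧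
          (∀ v : ℝ → S.V ε (1 / α), IsWeakSolution S ε hα f u₀ u₁ T v →
            Set.EqOn v u (Set.Icc 0 T)) ∧
          VariationOfConstants S ε hα f u₀ u₁ T u) ∧
      (∀ r : ℝ, AdmissibleExponent qA α r → Hf1 f r →
        ∃ T : ℝ, 0 < T ∧ ∃ u : ℝ → S.V ε (1 / α),
          (∀ p q : ℝ≥0∞, 1 ≤ p → p < ENNReal.ofReal (1 / (2 - α)) → p.HolderConjugate q →
            IsWeakSolutionCrit S ε hα f u₀ u₁ r q T u ∧
            ∀ (r' : ℝ) (v : ℝ → S.V ε (1 / α)), IsWeakSolutionCrit S ε hα f u₀ u₁ r' q T v →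
              Set.EqOn v u (Set.Icc 0 T)) ∧
          VariationOfConstants S ε hα f u₀ u₁ T u) := by
  refine ⟨DirichletForm.nonempty_eigenSystem hcomp, fun S ε α hα hα2 f u₀ u₁ =>
    ⟨fun _ hα0 hf => ?_, fun r hr hf => ?_⟩⟩
  -- α < α₀ means 1/α > θ_A, so V_{1/α} embeds in L^∞.
  · obtain ⟨C, hC, hemb⟩ := S.exists_ae_abs_le hqA hsob ε (thetaA_lt_of_lt_alpha0 hqA hα hα0)
    obtain ⟨N, hN, hL⟩ := S.exists_nemytskii_of_ae_abs_le ε (gamma_nonneg hα) hC hemb hf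
    obtain ⟨T, hT, u, -, hcore, huniq, hvoc⟩ := S.exists_solution ε hα hα2 hN hL u₀ u₁
    exact ⟨T, hT, u, hcore, fun v ⟨dv, w, hv, _⟩ => huniq v dv w hv, hvoc⟩
  · obtain ⟨hr1, s, hs0, hs, hsα, hsr⟩ := hr.exists_smoothness hqA hα
    obtain ⟨C, hC, hemb⟩ := S.exists_eLpNorm_le hqA hsob ε hs0 hs hsα
    rw [hsr] at hemb
    obtain ⟨N, hN, hL⟩ := S.exists_nemytskii_of_eLpNorm_le ε hr1 hC hemb hf
    obtain ⟨T, hT, u, hu, ⟨du, w, hcore, hw⟩, huniq, hvoc⟩ :=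
      S.exists_solution ε hα hα2 hN hL u₀ u₁
    -- T and u are fixed before p and q, and the uniqueness clause draws only on the core, so r' and
    -- q may be arbitrary.
    refine ⟨T, hT, u, fun p q _ _ _ => ⟨?_, fun r' v ⟨_, dv, w', hv, _⟩ => huniq v dv w' hv⟩, hvoc⟩
    exact S.isWeakSolutionCrit_of_core ε hα hr1 hC hemb hu hcore hw q
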